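/- Let $s\in(0,1)$, let $N>2s$ be an integer, and let $\Omega\subset\mathbb{R}^N$ be a bounded domain (nonempty, open, connected) with $C^\infty$ boundary. Put $\delta(x)=\mathrm{dist}(x,\partial\Omega)$ and let $L^1(\Omega;\delta^s dx)$ be the set of $f\in L^1_{loc}(\Omega)$ with $\|f\|_{L^1(\Omega;\delta^s dx)}:=\int_\Omega |f|\,\delta^s\,dx<\infty$. Let $X_0^s(\Omega)$ be the space of all $u\in L^2(\mathbb{R}^N)$ with $u=0$ a.e. in $\mathbb{R}^N\setminus\Omega$ and $\int_{\mathbb{R}^{2N}}\frac{|u(x)-u(y)|^2}{|x-y|^{N+2s}}\,dx\,dy<\infty$. Define $(-\Delta)^s$ from $X_0^s(\Omega)$ into its dual by $$\langle(-\Delta)^s u,v\rangle=\int_{\mathbb{R}^{2N}}\frac{(u(x)-u(y))(v(x)-v(y))}{|x-y|^{N+2s}}\,dx\,dy,\qquad u,v\in X_0^s(\Omega).$$ Let $\mathcal{T}_s(\Omega)$ be the set of $\varphi\in X_0^s(\Omega)$ with $(-\Delta)^s\varphi\in C_c^\infty(\Omega)$, i.e. for which there is $g\in C_c^\infty(\Omega)$,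 then denoted $(-\Delta)^s\varphi$, such that $\langle(-\Delta)^s\varphi,v\rangle=\int_\Omega g v\,dx$ for all $v\in X_0^s(\Omega)$. For $f\in L^1(\Omega;\delta^s dx)$, an $L^1$-weak solution of $(-\Delta)^s u=f$ in $\Omega$, $u=0$ in $\mathbb{R}^N\setminus\Omega$, is a function $u\in L^1(\Omega)$ such that for every $\varphi\in\mathcal{T}_s(\Omega)$ the function $f\varphi$ is integrable on $\Omega$ and $$\int_\Omega u\,(-\Delta)^s\varphi\,dx=\int_\Omega f\,\varphi\,dx.$$ Then for every $f\in L^1(\Omega;\delta^s dx)$ there exists a unique $L^1$-weak solution $u\in L^1(\Omega)$ of this problem. Moreover, there is a constant $C=C(s,\Omega)>0$ such that for every $f\in L^1(\Omega;\delta^s dx)$ the corresponding solution $u$ satisfies $$\|u\|_{L^1(\Omega)}\le C\,\|f\|_{L^1(\Omega;\delta^s dx)}.$$ -/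

import Mathlib

open MeasureTheory
open scoped ContDiff

/-- A bounded domain (nonempty, open, connected, bounded) of `ℝ^N` with `C^∞` boundary: near each
boundary point, `Ω` is the sublevel set `{ρ < 0}` of a smooth function `ρ` whose differential at
that point does not vanish. -/
structure IsSmoothBoundedDomain {N : ℕ} (Ω : Set (EuclideanSpace ℝ (Fin N))) : Prop where
  isOpen : IsOpen Ω
  isConnected : IsConnected Ω
  isBounded : Bornology.IsBounded Ω
  smooth_boundary : ∀ x₀ ∈ frontier Ω,
    ∃ (U : Set (EuclideanSpace ℝ (Fin N))) (ρ : EuclideanSpace ℝ (Fin N) → ℝ),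
      IsOpen U ∧ x₀ ∈ U ∧ ContDiffOn ℝ ∞ ρ U ∧ fderiv ℝ ρ x₀ ≠ 0 ∧ ∀ x ∈ U, x ∈ Ω ↔ ρ x < 0

/-- The space `X₀ˢ(Ω)`: functions in `L²(ℝ^N)` that vanish a.e. outside `Ω` and have finite
Gagliardo energy. -/
structure MemX0 {N : ℕ} (s : ℝ) (Ω : Set (EuclideanSpace ℝ (Fin N)))
    (u : EuclideanSpace ℝ (Fin N) → ℝ) : Prop where
  memLp : MemLp u 2 volume
  ae_eq_zero : ∀ᵐ x ∂volume, x ∉ Ω → u x = 0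
  energy : Integrable (fun p : EuclideanSpace ℝ (Fin N) × EuclideanSpace ℝ (Fin N) =>
    |u p.1 - u p.2| ^ 2 / ‖p.1 - p.2‖ ^ ((N : ℝ) + 2 * s)) (volume.prod volume)

/-- The pairing `⟨(-Δ)ˢ u, v⟩` for `u, v ∈ X₀ˢ(Ω)`, which defines `(-Δ)ˢ` as an operator from
`X₀ˢ(Ω)` into its dual. -/
noncomputable def fracLaplacianPairing {N : ℕ} (s : ℝ)
    (u v : EuclideanSpace ℝ (Fin N) → ℝ) : ℝ :=
  ∫ p : EuclideanSpace ℝ (Fin N) × EuclideanSpace ℝ (Fin N),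
    (u p.1 - u p.2) * (v p.1 - v p.2) / ‖p.1 - p.2‖ ^ ((N : ℝ) + 2 * s) ∂(volume.prod volume)

/-- `C_c^∞(Ω)`. -/
structure IsSmoothCompactlySupportedIn {N : ℕ} (Ω : Set (EuclideanSpace ℝ (Fin N)))
    (g : EuclideanSpace ℝ (Fin N) → ℝ) : Prop where
  contDiff : ContDiff ℝ ∞ g
  hasCompactSupport : HasCompactSupport g
  tsupport_subset : tsupport g ⊆ Ω

/-- `φ ∈ 𝒯ₛ(Ω)` with `(-Δ)ˢ φ = g`: that is, `φ ∈ X₀ˢ(Ω)`, `g ∈ C_c^∞(Ω)`, and the functional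
`(-Δ)ˢ φ` on `X₀ˢ(Ω)` is `v ↦ ∫_Ω g v`. -/
structure IsTestFunction {N : ℕ} (s : ℝ) (Ω : Set (EuclideanSpace ℝ (Fin N)))
    (φ g : EuclideanSpace ℝ (Fin N) → ℝ) : Prop where
  memX0 : MemX0 s Ω φ
  smooth : IsSmoothCompactlySupportedIn Ω g
  pairing_eq : ∀ v : EuclideanSpace ℝ (Fin N) → ℝ, MemX0 s Ω v →
    fracLaplacianPairing s φ v = ∫ x in Ω, g x * v x

/-- `δ(x) = dist(x, ∂Ω)`. -/
noncomputable def boundaryDist {N : ℕ} (Ω : Set (EuclideanSpace ℝ (Fin N)))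
    (x : EuclideanSpace ℝ (Fin N)) : ℝ :=
  Metric.infDist x (frontier Ω)

/-- `f ∈ L¹(Ω; δˢ dx)`. -/
structure MemWeightedL1 {N : ℕ} (s : ℝ) (Ω : Set (EuclideanSpace ℝ (Fin N)))
    (f : EuclideanSpace ℝ (Fin N) → ℝ) : Prop where
  locallyIntegrableOn : LocallyIntegrableOn f Ω volume
  integrableOn : IntegrableOn (fun x => |f x| * boundaryDist Ω x ^ s) Ω volume

/-- `‖f‖_{L¹(Ω; δˢ dx)}`. -/
noncomputable def weightedL1Norm {N : ℕ} (s : ℝ) (Ω : Set (EuclideanSpace ℝ (Fin N)))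
    (f : EuclideanSpace ℝ (Fin N) → ℝ) : ℝ :=
  ∫ x in Ω, |f x| * boundaryDist Ω x ^ s

/-- `u ∈ L¹(Ω)` is an `L¹`-weak solution of `(-Δ)ˢ u = f` in `Ω`, `u = 0` in `ℝ^N \ Ω`. The
right-hand integral of the weak formulation is required to converge absolutely (the left-hand one
does so automatically, `g` being bounded). -/
def IsL1WeakSolution {N : ℕ} (s : ℝ) (Ω : Set (EuclideanSpace ℝ (Fin N)))
    (f : EuclideanSpace ℝ (Fin N) → ℝ) (u : Lp ℝ 1 (volume.restrict Ω)) : Prop :=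
  ∀ φ g : EuclideanSpace ℝ (Fin N) → ℝ, IsTestFunction s Ω φ g →
    IntegrableOn (fun x => f x * φ x) Ω volume ∧
      ∫ x in Ω, u x * g x = ∫ x in Ω, f x * φ x

/-! The problem is dual to a pointwise bound: if `(-Δ)ˢ φ = g` in the energy sense and `|g| ≤ C`,
then `|φ| ≤ C K δˢ` a.e. in `Ω` (`BoundaryEstimate`). This makes `f φ` integrable for every test
function `φ`. If `f` is bounded with energy solution `u`, let `ψ` solve the problem with right-hand
side `sign u`; symmetry of the form gives `∫ |u| = ∫ f ψ ≤ K ∫ |f| δˢ`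
(`IsEnergySolution.integral_abs_le`). For general `f` the energy solutions of the truncated problems
are therefore Cauchy in `L¹(Ω)`, and their limit is the weak solution. Uniqueness holds because by
Lax-Milgram every `g ∈ C_c^∞(Ω)` is `(-Δ)ˢ φ` for a test function `φ`, so the difference of two
solutions is orthogonal to `C_c^∞(Ω)`.

The pointwise bound comes from barriers. A smooth boundary has exterior balls `B(c, R)` of one
radius, and the barrier is `min ((|y - c| - ρ)₊ˢ) (εˢ)` with `ρ < R`. Close to the ball it is
compared with the profile of the tangent half-space (`exists_ballBarrier_supersolution`). There are
three contributions: the profile `t₊ˢ` is `s`-superharmonic where it is positive, by an explicit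
primitive (`integral_posPowSecondDiff_nonneg`); truncation at height `εˢ` gains a multiple of
`ε^{-s}`; curvature costs at most a constant independent of `ε ≤ 1`
(`exists_integral_curvature_error_le`). Hence a small `ε` gives a supersolution with right-hand side
`1`.

Where the barrier is constant, a cruder barrier bounds `φ` (`exists_energySolution_le`). Weak
comparison, tested with `(φ - w)₊`, then puts a multiple of the barrier above `φ`
(`ae_le_of_barrier`); letting `ρ ↑ R` and taking the ball that touches `∂Ω` at the point nearest to
`x` gives `δˢ`. The operator is never evaluated pointwise: integrals are cut off at `|z| > κ`, and
`κ → 0` is taken in the weak form (`integral_le_pairing_of_truncated`). -/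

/-- The function `t ↦ t₊ˢ`. -/
noncomputable def posPow (s t : ℝ) : ℝ := (max t 0) ^ s

/-! ### Elementary inequalities for `t₊ˢ` and its second differences. -/

section PosPow

variable {s : ℝ}

lemma posPow_nonneg (s t : ℝ) : 0 ≤ posPow s t := Real.rpow_nonneg (le_max_right _ _) _

lemma posPow_of_nonneg {t : ℝ} (ht : 0 ≤ t) : posPow s t = t ^ s := by
  rw [posPow, max_eq_left ht]

lemma posPow_of_nonpos (hs : 0 < s) {t : ℝ} (ht : t ≤ 0) : posPow s t = 0 := by
  rw [posPow, max_eq_right ht, Real.zero_rpow hs.ne']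

lemma posPow_mono (hs : 0 < s) : Monotone (posPow s) := fun _ _ h =>
  Real.rpow_le_rpow (le_max_right _ _) (max_le_max_right 0 h) hs.le

lemma continuous_posPow (hs : 0 < s) : Continuous (posPow s) := by
  unfold posPow
  exact (continuous_id.max continuous_const).rpow_const fun _ => Or.inr hs.le

lemma posPow_mul {c : ℝ} (hc : 0 ≤ c) (t : ℝ) : posPow s (c * t) = c ^ s * posPow s t := by
  rw [posPow, posPow, ← Real.mul_rpow hc (le_max_right _ _), mul_max_of_nonneg _ _ hc, mul_zero]

lemma posPow_add_le_add_rpow (hs0 : 0 < s) (hs1 : s < 1) (a : ℝ) {q : ℝ} (hq : 0 ≤ q) :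
    posPow s (a + q) ≤ posPow s a + q ^ s := by
  have h : max (a + q) 0 ≤ max a 0 + q :=
    max_le (by linarith [le_max_left a 0]) (by linarith [le_max_right a 0])
  exact (Real.rpow_le_rpow (le_max_right _ _) h hs0.le).trans
    (Real.rpow_add_le_add_rpow (le_max_right _ _) hq hs0.le hs1.le)

lemma abs_posPow_sub_le (hs0 : 0 < s) (hs1 : s < 1) (a b : ℝ) :
    |posPow s a - posPow s b| ≤ |a - b| ^ s := by
  wlog h : b ≤ a generalizing a b
  · rw [abs_sub_comm, abs_sub_comm a b]
    exact this b a (le_of_not_ge h)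
  rw [abs_of_nonneg (sub_nonneg.2 (posPow_mono hs0 h)), abs_of_nonneg (sub_nonneg.2 h)]
  have := posPow_add_le_add_rpow hs0 hs1 b (sub_nonneg.2 h)
  rw [add_sub_cancel] at this
  linarith

/-- For `a > 0` this is `(1 + q/a)ˢ ≤ 1 + q/a`; for `a < 0` the left side is nonzero only if `q >
|a|`, and then `qˢ = q^{s-1} q ≤ |a|^{s-1} q`. Both signs occur when `a` is the signed distance to a
tangent hyperplane. -/
lemma posPow_add_le_add_mul (hs0 : 0 < s) (hs1 : s < 1) {a q : ℝ} (ha : a ≠ 0) (hq : 0 ≤ q) :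
    posPow s (a + q) ≤ posPow s a + |a| ^ (s - 1) * q := by
  rcases lt_or_gt_of_ne ha with ha | ha
  · rw [posPow_of_nonpos hs0 ha.le, zero_add]
    rcases le_or_gt (a + q) 0 with h | h
    · rw [posPow_of_nonpos hs0 h]
      positivity
    · have hqa : |a| ≤ q := by rw [abs_of_neg ha]; linarith
      have hq0 : 0 < q := by linarith
      calc posPow s (a + q) ≤ posPow s q := posPow_mono hs0 (by linarith)
        _ = q ^ (s - 1) * q := by
          rw [posPow_of_nonneg hq, Real.rpow_sub_one hq0.ne', div_mul_cancel₀ _ hq0.ne']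
        _ ≤ |a| ^ (s - 1) * q := by
          gcongr ?_ * q
          exact Real.rpow_le_rpow_of_nonpos (abs_pos.2 ha.ne) hqa (by linarith)
  · rw [posPow_of_nonneg ha.le, posPow_of_nonneg (by linarith), abs_of_pos ha]
    have h1 : a + q = a * (1 + q / a) := by field_simp
    have h2 : (1 + q / a) ^ s ≤ 1 + q / a :=
      Real.rpow_le_self_of_one_le (by have := div_nonneg hq ha.le; linarith) hs1.le
    rw [h1, Real.mul_rpow ha.le (by positivity), Real.rpow_sub_one ha.ne']
    calc a ^ s * (1 + q / a) ^ s ≤ a ^ s * (1 + q / a) := by gcongr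
      _ = _ := by ring

/-- The second difference `2 d₊ˢ - (d + τ)₊ˢ - (d - τ)₊ˢ`. -/
noncomputable def posPowSecondDiff (s d τ : ℝ) : ℝ :=
  2 * posPow s d - posPow s (d + τ) - posPow s (d - τ)

lemma posPowSecondDiff_neg (s d τ : ℝ) : posPowSecondDiff s d (-τ) = posPowSecondDiff s d τ := by
  unfold posPowSecondDiff
  rw [← sub_eq_add_neg, sub_neg_eq_add]; ring

lemma posPowSecondDiff_abs (s d τ : ℝ) : posPowSecondDiff s d |τ| = posPowSecondDiff s d τ := by
  rcases abs_choice τ with h | h <;> rw [h]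
  exact posPowSecondDiff_neg s d τ

lemma posPowSecondDiff_mul {c : ℝ} (hc : 0 ≤ c) (d τ : ℝ) :
    posPowSecondDiff s (c * d) (c * τ) = c ^ s * posPowSecondDiff s d τ := by
  unfold posPowSecondDiff
  rw [← mul_add, ← mul_sub, posPow_mul hc, posPow_mul hc, posPow_mul hc]; ring

lemma continuous_posPowSecondDiff (hs : 0 < s) (d : ℝ) : Continuous (posPowSecondDiff s d) := by
  unfold posPowSecondDiff
  have := continuous_posPow hs
  fun_prop

lemma posPowSecondDiff_zero (s d : ℝ) : posPowSecondDiff s d 0 = 0 := by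
  simp [posPowSecondDiff]; ring

lemma abs_posPowSecondDiff_le (hs0 : 0 < s) (hs1 : s < 1) (d τ : ℝ) :
    |posPowSecondDiff s d τ| ≤ 2 * |τ| ^ s := by
  have h1 := abs_posPow_sub_le hs0 hs1 d (d + τ)
  have h2 := abs_posPow_sub_le hs0 hs1 d (d - τ)
  rw [show d - (d + τ) = -τ by ring, abs_neg] at h1
  rw [show d - (d - τ) = τ by ring] at h2
  calc |posPowSecondDiff s d τ|
      = |(posPow s d - posPow s (d + τ)) + (posPow s d - posPow s (d - τ))| := by
        unfold posPowSecondDiff; congr 1; ring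
    _ ≤ _ := (abs_add_le _ _).trans (by linarith)

/-- Nonnegativity is concavity. For the upper bound, `a = (1 + t)ˢ` and `b = (1 - t)ˢ` satisfy `a b
= (1 - t²)ˢ ≥ 1 - t²`, and `(a + b)² ≥ 4ab` then forces `a + b ≥ 2(1 - t²)`. -/
lemma posPowSecondDiff_one_bounds (hs0 : 0 < s) (hs1 : s < 1) {t : ℝ} (ht : |t| ≤ 1) :
    0 ≤ posPowSecondDiff s 1 t ∧ posPowSecondDiff s 1 t ≤ 2 * t ^ 2 := by
  obtain ⟨h1, h2⟩ := abs_le.1 ht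
  have hp : 0 ≤ 1 + t := by linarith
  have hm : 0 ≤ 1 - t := by linarith
  unfold posPowSecondDiff
  rw [posPow_of_nonneg zero_le_one, posPow_of_nonneg hp, posPow_of_nonneg hm, Real.one_rpow]
  constructor
  · have := (Real.concaveOn_rpow hs0.le hs1.le).2 (Set.mem_Ici.2 hp) (Set.mem_Ici.2 hm)
      (by norm_num : (0 : ℝ) ≤ 1 / 2) (by norm_num : (0 : ℝ) ≤ 1 / 2) (by norm_num)
    simp only [smul_eq_mul] at this
    rw [show 1 / 2 * (1 + t) + 1 / 2 * (1 - t) = 1 by ring, Real.one_rpow] at this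
    linarith
  · have hsq : 0 ≤ 1 - t ^ 2 := by nlinarith
    have h3 : 1 - t ^ 2 ≤ (1 + t) ^ s * (1 - t) ^ s := by
      rw [← Real.mul_rpow hp hm, show (1 + t) * (1 - t) = 1 - t ^ 2 by ring]
      exact Real.self_le_rpow_of_le_one hsq (by nlinarith) hs1.le
    have ha := Real.rpow_nonneg hp s
    have hb := Real.rpow_nonneg hm s
    set a := (1 + t) ^ s
    set b := (1 - t) ^ s
    by_contra! h
    have h5 : a + b < 2 * (1 - t ^ 2) := by linarith
    have h6 : (a + b) ^ 2 < (2 * (1 - t ^ 2)) ^ 2 := by gcongr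
    nlinarith [sq_nonneg (a - b), sq_nonneg t]

lemma posPowSecondDiff_bounds (hs0 : 0 < s) (hs1 : s < 1) {d τ : ℝ} (hd : 0 < d) (h : |τ| ≤ d) :
    0 ≤ posPowSecondDiff s d τ ∧ posPowSecondDiff s d τ ≤ 2 * d ^ (s - 2) * τ ^ 2 := by
  have h1 : |τ / d| ≤ 1 := by rw [abs_div, abs_of_pos hd]; exact (div_le_one hd).2 h
  have h2 := posPowSecondDiff_one_bounds hs0 hs1 h1
  have h3 : posPowSecondDiff s d τ = d ^ s * posPowSecondDiff s 1 (τ / d) := by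
    rw [← posPowSecondDiff_mul hd.le, mul_one, mul_div_cancel₀ _ hd.ne']
  rw [h3]
  refine ⟨mul_nonneg (by positivity) h2.1, ?_⟩
  calc d ^ s * posPowSecondDiff s 1 (τ / d) ≤ d ^ s * (2 * (τ / d) ^ 2) := by
        gcongr; exact h2.2
    _ = _ := by
      rw [Real.rpow_sub hd, Real.rpow_two]; field_simp

end PosPow

/-! ### Superharmonicity of `t₊ˢ` on the line. -/

section OneDim

open Set Filter Topology

variable {s : ℝ}

lemma integrableOn_Ioi_of_abs_le_rpow {f : ℝ → ℝ} {a b C : ℝ} (ha : 0 < a) (hb : b < -1)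
    (hf : ContinuousOn f (Ioi a)) (h : ∀ r ∈ Ioi a, |f r| ≤ C * r ^ b) : IntegrableOn f (Ioi a) :=
  Integrable.mono' ((integrableOn_Ioi_rpow_of_lt hb ha).const_mul C)
    (hf.aestronglyMeasurable measurableSet_Ioi)
    ((ae_restrict_iff' measurableSet_Ioi).2 (Eventually.of_forall h))

lemma continuousOn_rpow_Ioi {a : ℝ} (ha : 0 < a) (b : ℝ) :
    ContinuousOn (fun r : ℝ => r ^ b) (Ioi a) :=
  continuousOn_id.rpow_const fun _ hr => Or.inl (ha.trans hr).ne'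

lemma integrableOn_posPow_sub (hs0 : 0 < s) (hs1 : s < 1) {σ a : ℝ} (hσ : |σ| = 1) (ha : 0 < a) :
    IntegrableOn (fun r : ℝ => (1 - posPow s (1 + σ * r)) * r ^ (-1 - 2 * s)) (Ioi a) := by
  have hc := continuous_posPow hs0
  refine integrableOn_Ioi_of_abs_le_rpow (b := s + (-1 - 2 * s)) (C := 1) ha (by linarith)
    ((by fun_prop : Continuous fun r : ℝ => 1 - posPow s (1 + σ * r)).continuousOn.mul
      (continuousOn_rpow_Ioi ha _)) fun r hr => ?_
  have hr0 : 0 < r := ha.trans hr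
  rw [abs_mul, abs_of_nonneg (Real.rpow_nonneg hr0.le _), Real.rpow_add hr0, one_mul]
  gcongr
  have := abs_posPow_sub_le hs0 hs1 1 (1 + σ * r)
  rw [posPow_of_nonneg zero_le_one, Real.one_rpow] at this
  rwa [show (1 : ℝ) - (1 + σ * r) = -(σ * r) by ring, abs_neg, abs_mul, hσ, one_mul,
    abs_of_pos hr0] at this

/-- The two terms of the product rule collapse into one because `(1 + p)ˢ = (1 + p)^{s-1} (1 + p)`.
This primitive makes the truncated integrals explicit. -/
lemma hasDerivAt_primitive (hs0 : 0 < s) {p : ℝ} (hp : 0 < p) :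
    HasDerivAt (fun p : ℝ => -(2 * s)⁻¹ * (((1 + p) ^ s - 1) ^ 2 * p ^ (-(2 * s))))
      (((1 + p) ^ s - 1) * ((1 + p) ^ (s - 1) - 1) * p ^ (-1 - 2 * s)) p := by
  have h1 : HasDerivAt (fun p : ℝ => (1 + p) ^ s) (s * (1 + p) ^ (s - 1)) p := by
    have := ((hasDerivAt_id p).const_add 1).rpow_const (p := s) (Or.inl (by simp; linarith))
    simpa using this
  have h2 : HasDerivAt (fun p : ℝ => p ^ (-(2 * s))) (-(2 * s) * p ^ (-(2 * s) - 1)) p :=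
    Real.hasDerivAt_rpow_const (Or.inl hp.ne')
  refine ((((h1.sub_const 1).pow 2).mul h2).const_mul (-(2 * s)⁻¹)).congr_deriv ?_
  have e1 : p ^ (-(2 * s)) = p ^ (-1 - 2 * s) * p := by
    rw [← Real.rpow_add_one hp.ne']; congr 1; ring
  have e2 : p ^ (-(2 * s) - 1) = p ^ (-1 - 2 * s) := by congr 1; ring
  have e3 : (1 + p) ^ s = (1 + p) ^ (s - 1) * (1 + p) := by
    rw [← Real.rpow_add_one (by linarith)]; congr 1; ring
  simp only [Pi.pow_apply, Nat.cast_ofNat, pow_one, Nat.add_one_sub_one]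
  rw [e1, e2, e3]
  field_simp
  ring

lemma tendsto_primitive_atTop (hs0 : 0 < s) :
    Tendsto (fun p : ℝ => -(2 * s)⁻¹ * (((1 + p) ^ s - 1) ^ 2 * p ^ (-(2 * s)))) atTop
      (𝓝 (-(2 * s)⁻¹)) := by
  have h1 : Tendsto (fun p : ℝ => (1 + p⁻¹) ^ s - p ^ (-s)) atTop (𝓝 1) := by
    have ha : Tendsto (fun p : ℝ => (1 + p⁻¹) ^ s) atTop (𝓝 ((1 + 0) ^ s)) :=
      (tendsto_inv_atTop_zero.const_add 1).rpow_const (Or.inl (by norm_num))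
    have hb := tendsto_rpow_neg_atTop hs0
    simpa using ha.sub hb
  have h2 := (h1.pow 2).const_mul (-(2 * s)⁻¹)
  rw [one_pow, mul_one] at h2
  refine h2.congr' ?_
  filter_upwards [eventually_gt_atTop 0] with p hp
  have e1 : (1 + p) ^ s = p ^ s * (1 + p⁻¹) ^ s := by
    rw [← Real.mul_rpow hp.le (by positivity)]; congr 1; field_simp; ring
  have e2 : p ^ (-(2 * s)) = (p ^ (-s)) ^ 2 := by
    rw [← Real.rpow_natCast, ← Real.rpow_mul hp.le]; congr 1; push_cast; ring
  have e3 : p ^ s * p ^ (-s) = 1 := by rw [← Real.rpow_add hp]; simp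
  rw [e1, e2, ← mul_pow]
  congr 2
  linear_combination (-(1 + p⁻¹) ^ s) * e3

lemma image_div_one_add {a : ℝ} (ha : 0 < a) :
    (fun p : ℝ => p / (1 + p)) '' Ioi a = Ioo (a / (1 + a)) 1 := by
  ext r
  constructor
  · rintro ⟨p, hp, rfl⟩
    have hp' : a < p := hp
    refine ⟨?_, ?_⟩
    · rw [div_lt_div_iff₀ (by linarith) (by linarith)]; nlinarith
    · rw [div_lt_one (by linarith)]; linarith
  · rintro ⟨h1, h2⟩
    rw [div_lt_iff₀ (by linarith)] at h1
    have h3 : 0 < 1 - r := by linarith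
    refine ⟨r / (1 - r), ?_, ?_⟩
    · rw [mem_Ioi, lt_div_iff₀ h3]; nlinarith
    · field_simp
      ring

lemma integral_Ioo_posPow_sub {a : ℝ} (ha : 0 < a) :
    ∫ r in Ioo (a / (1 + a)) 1, (1 - posPow s (1 + -1 * r)) * r ^ (-1 - 2 * s) =
      ∫ p in Ioi a, ((1 + p) ^ s - 1) * (1 + p) ^ (s - 1) * p ^ (-1 - 2 * s) := by
  have hd : ∀ p ∈ Ioi a, HasDerivWithinAt (fun p : ℝ => p / (1 + p)) (((1 + p) ^ 2)⁻¹) (Ioi a) p := by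
    intro p hp
    have hp0 : 0 < p := ha.trans hp
    have := (hasDerivAt_id p).div ((hasDerivAt_id p).const_add 1) (by simp; linarith)
    refine (this.congr_deriv ?_).hasDerivWithinAt
    simp
  have hinj : InjOn (fun p : ℝ => p / (1 + p)) (Ioi a) := by
    intro p hp q hq h
    have hp0 : 0 < p := ha.trans hp
    have hq0 : 0 < q := ha.trans hq
    simp only at h
    rw [div_eq_div_iff (by linarith) (by linarith)] at h
    linarith
  rw [← image_div_one_add ha, integral_image_eq_integral_abs_deriv_smul measurableSet_Ioi hd hinj]
  refine setIntegral_congr_fun measurableSet_Ioi fun p hp => ?_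
  have hp0 : 0 < p := ha.trans hp
  have h1 : 0 < 1 + p := by linarith
  have e0 : 1 + -1 * (p / (1 + p)) = (1 + p)⁻¹ := by field_simp; ring
  simp only [smul_eq_mul]
  rw [e0, posPow_of_nonneg (by positivity), Real.inv_rpow h1.le, Real.div_rpow hp0.le h1.le,
    abs_of_pos (by positivity)]
  have e1 : (1 + p) ^ (-1 - 2 * s) = (((1 + p) ^ s) ^ 2 * (1 + p))⁻¹ := by
    rw [show -1 - 2 * s = -(s * 2 + 1) by ring, Real.rpow_neg h1.le, Real.rpow_add h1,
      Real.rpow_mul h1.le, Real.rpow_two, Real.rpow_one]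
  rw [e1, Real.rpow_sub_one h1.ne']
  have : 0 < (1 + p) ^ s := by positivity
  field_simp

/-- The substitution `r = p/(1 + p)` maps `(a, ∞)` onto `(a/(1 + a), 1)`, which explains the
asymmetric cutoffs. The part `r > 1` on the left side of the line gives `1/(2s)`, which cancels the
limit of the primitive at infinity; the sum equals `(2s)⁻¹ ((1 + a)ˢ - 1)² a^{-2s}`. -/
lemma integral_Ioi_truncated_add (hs0 : 0 < s) (hs1 : s < 1) {a : ℝ} (ha : 0 < a) :
    0 ≤ (∫ r in Ioi a, (1 - posPow s (1 + 1 * r)) * r ^ (-1 - 2 * s)) +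
      ∫ r in Ioi (a / (1 + a)), (1 - posPow s (1 + -1 * r)) * r ^ (-1 - 2 * s) := by
  have ha' : 0 < a / (1 + a) := by positivity
  have ha1 : a / (1 + a) < 1 := by rw [div_lt_one (by linarith)]; linarith
  have hint := integrableOn_posPow_sub hs0 hs1 (σ := -1) (by simp) ha'
  have hint1 := integrableOn_posPow_sub hs0 hs1 (σ := 1) (by simp) ha
  have hsplit : Ioi (a / (1 + a)) = Ioo (a / (1 + a)) 1 ∪ Ici 1 := (Ioo_union_Ici_eq_Ioi ha1).symm
  have hdisj : Disjoint (Ioo (a / (1 + a)) 1) (Ici 1) :=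
    Set.disjoint_left.2 fun x hx hx' => absurd hx.2 (not_lt.2 hx')
  rw [hsplit, setIntegral_union hdisj measurableSet_Ici (hint.mono_set (by rw [hsplit]; simp))
    (hint.mono_set (by rw [hsplit]; simp)), integral_Ioo_posPow_sub ha]
  have htail : ∫ r in Ici 1, (1 - posPow s (1 + -1 * r)) * r ^ (-1 - 2 * s) = (2 * s)⁻¹ := by
    rw [integral_Ici_eq_integral_Ioi]
    rw [setIntegral_congr_fun (g := fun r => r ^ (-1 - 2 * s)) measurableSet_Ioi fun r hr => ?_]
    · rw [integral_Ioi_rpow_of_lt (by linarith) zero_lt_one, Real.one_rpow,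
        show -1 - 2 * s + 1 = -(2 * s) by ring, neg_div_neg_eq, one_div]
    · have : (1 : ℝ) < r := hr
      simp only
      rw [posPow_of_nonpos hs0 (by linarith), sub_zero, one_mul]
  rw [htail]
  have hder : ∀ p ∈ Ioi a, HasDerivAt _ _ p := fun p hp => hasDerivAt_primitive hs0 (ha.trans hp)
  have hcont : ContinuousWithinAt
      (fun p : ℝ => -(2 * s)⁻¹ * (((1 + p) ^ s - 1) ^ 2 * p ^ (-(2 * s)))) (Ici a) a :=
    (hasDerivAt_primitive hs0 ha).continuousAt.continuousWithinAt
  have hbase : ∀ p ∈ Ioi a, 1 ≤ (1 + p) ^ s := fun p hp =>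
    Real.one_le_rpow (by linarith [ha.trans hp]) hs0.le
  have hintF : IntegrableOn
      (fun p : ℝ => ((1 + p) ^ s - 1) * ((1 + p) ^ (s - 1) - 1) * p ^ (-1 - 2 * s)) (Ioi a) := by
    refine integrableOn_Ioi_deriv_of_nonpos hcont hder (fun p hp => ?_)
      (tendsto_primitive_atTop hs0)
    have hp0 : 0 < p := ha.trans hp
    have h2 : (1 + p) ^ (s - 1) ≤ 1 :=
      Real.rpow_le_one_of_one_le_of_nonpos (by linarith) (by linarith)
    exact mul_nonpos_of_nonpos_of_nonneg
      (mul_nonpos_of_nonneg_of_nonpos (by linarith [hbase p hp]) (by linarith)) (by positivity)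
  have hF := integral_Ioi_of_hasDerivAt_of_tendsto hcont hder hintF (tendsto_primitive_atTop hs0)
  have hsum : ∫ p in Ioi a, ((1 + p) ^ s - 1) * (1 + p) ^ (s - 1) * p ^ (-1 - 2 * s) =
      (∫ p in Ioi a, ((1 + p) ^ s - 1) * ((1 + p) ^ (s - 1) - 1) * p ^ (-1 - 2 * s)) -
        ∫ r in Ioi a, (1 - posPow s (1 + 1 * r)) * r ^ (-1 - 2 * s) := by
    rw [← integral_sub hintF hint1]
    refine setIntegral_congr_fun measurableSet_Ioi fun p hp => ?_
    have hp0 : 0 < p := ha.trans hp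
    simp only [one_mul]
    rw [posPow_of_nonneg (by linarith)]; ring
  rw [hsum, hF]
  have : 0 ≤ (2 * s)⁻¹ * (((1 + a) ^ s - 1) ^ 2 * a ^ (-(2 * s))) := by positivity
  linarith

lemma integrableOn_posPowSecondDiff (hs0 : 0 < s) (hs1 : s < 1) :
    IntegrableOn (fun r : ℝ => posPowSecondDiff s 1 r * r ^ (-1 - 2 * s)) (Ioi 0) := by
  rw [← Ioc_union_Ioi_eq_Ioi (zero_le_one : (0 : ℝ) ≤ 1)]
  have hc := continuous_posPowSecondDiff hs0 1
  have hcont : ContinuousOn (fun r : ℝ => posPowSecondDiff s 1 r * r ^ (-1 - 2 * s)) (Ioi 0) :=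
    hc.continuousOn.mul (continuousOn_id.rpow_const fun r hr => Or.inl (ne_of_gt hr))
  refine IntegrableOn.union ?_ ?_
  · have h1 : IntegrableOn (fun r : ℝ => 2 * r ^ (1 - 2 * s)) (Ioc 0 1) := by
      have := (intervalIntegral.intervalIntegrable_rpow' (a := 0) (b := 1) (r := 1 - 2 * s)
        (by linarith)).1
      exact this.const_mul 2
    refine Integrable.mono' h1 ((hcont.mono Ioc_subset_Ioi_self).aestronglyMeasurable
      measurableSet_Ioc) ((ae_restrict_iff' measurableSet_Ioc).2 (Eventually.of_forall ?_))
    intro r hr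
    have hb := posPowSecondDiff_one_bounds hs0 hs1 (t := r) (by rw [abs_of_pos hr.1]; exact hr.2)
    rw [Real.norm_eq_abs, abs_mul, abs_of_nonneg hb.1, abs_of_nonneg (Real.rpow_nonneg hr.1.le _)]
    calc _ ≤ 2 * r ^ 2 * r ^ (-1 - 2 * s) := by
          have := Real.rpow_nonneg hr.1.le (-1 - 2 * s)
          gcongr; exact hb.2
      _ = 2 * r ^ (1 - 2 * s) := by
          rw [mul_assoc, ← Real.rpow_two, ← Real.rpow_add hr.1]; congr 2; ring
  · refine integrableOn_Ioi_of_abs_le_rpow (b := s + (-1 - 2 * s)) (C := 2) zero_lt_one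
      (by linarith) (hcont.mono (Ioi_subset_Ioi zero_le_one)) fun r hr => ?_
    have hr0 : 0 < r := zero_lt_one.trans hr
    rw [abs_mul, abs_of_nonneg (Real.rpow_nonneg hr0.le _), Real.rpow_add hr0, ← mul_assoc]
    gcongr
    simpa [abs_of_pos hr0] using abs_posPowSecondDiff_le hs0 hs1 1 r

/-- The price of making the cutoffs symmetric: the integrand is at most `r^{-2s} ≤ (a/2)^{-2s}` on
an interval of length at most `a²`. It vanishes as `a → 0` since `s < 1`. -/
lemma integral_Ioc_posPow_sub_le (hs0 : 0 < s) (hs1 : s < 1) {a : ℝ} (ha : 0 < a) (ha1 : a ≤ 1) :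
    ∫ r in Ioc (a / (1 + a)) a, (1 - posPow s (1 + -1 * r)) * r ^ (-1 - 2 * s) ≤
      2 ^ (2 * s) * a ^ (2 - 2 * s) := by
  have ha' : 0 < a / (1 + a) := by positivity
  have hle : a / (1 + a) ≤ a := div_le_self ha.le (by linarith)
  have hint := (integrableOn_posPow_sub hs0 hs1 (σ := -1) (by simp) ha').mono_set
    (Ioc_subset_Ioi_self : Ioc (a / (1 + a)) a ⊆ _)
  calc _ ≤ ∫ r in Ioc (a / (1 + a)) a, (a / 2) ^ (-(2 * s)) := by
        refine setIntegral_mono_on hint (integrableOn_const (by simp)) measurableSet_Ioc ?_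
        intro r hr
        have hr0 : 0 < r := ha'.trans hr.1
        have hr1 : 0 ≤ 1 - r := by linarith [hr.2]
        have h1 : 1 - posPow s (1 + -1 * r) ≤ r := by
          rw [show 1 + -1 * r = 1 - r by ring, posPow_of_nonneg hr1]
          have := Real.self_le_rpow_of_le_one hr1 (by linarith) hs1.le
          linarith
        have har : a / 2 ≤ r := by
          refine le_trans ?_ hr.1.le
          gcongr; linarith
        calc _ ≤ r * r ^ (-1 - 2 * s) := by gcongr
          _ = r ^ (-(2 * s)) := by
            rw [mul_comm, ← Real.rpow_add_one hr0.ne']; congr 1; ring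
          _ ≤ _ := Real.rpow_le_rpow_of_nonpos (by positivity) har (by linarith)
    _ = (a - a / (1 + a)) * (a / 2) ^ (-(2 * s)) := by
        rw [setIntegral_const, smul_eq_mul, Real.volume_real_Ioc_of_le hle]
    _ ≤ a ^ 2 * (a / 2) ^ (-(2 * s)) := by
        gcongr
        rw [sub_le_iff_le_add, ← sub_le_iff_le_add', le_div_iff₀ (by linarith)]
        nlinarith [pow_pos ha 3]
    _ = _ := by
        rw [Real.div_rpow ha.le zero_le_two, Real.rpow_neg zero_le_two, div_inv_eq_mul,
          show 2 - 2 * s = 2 + -(2 * s) by ring, Real.rpow_add ha, Real.rpow_two]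
        ring

/-- The function `t₊ˢ` is `s`-superharmonic at `1` on the line. -/
theorem integral_posPowSecondDiff_nonneg (hs0 : 0 < s) (hs1 : s < 1) :
    0 ≤ ∫ r in Ioi (0 : ℝ), posPowSecondDiff s 1 r * r ^ (-1 - 2 * s) := by
  set f : ℝ → ℝ := fun r => posPowSecondDiff s 1 r * r ^ (-1 - 2 * s) with hf
  have hint := integrableOn_posPowSecondDiff hs0 hs1
  have hlow : ∀ a ∈ Ioc (0 : ℝ) 1, -(2 ^ (2 * s) * a ^ (2 - 2 * s)) ≤ ∫ r in Ioi a, f r := by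
    rintro a ⟨ha, ha1⟩
    have ha' : 0 < a / (1 + a) := by positivity
    have hle : a / (1 + a) ≤ a := div_le_self ha.le (by linarith)
    have hp := integrableOn_posPow_sub hs0 hs1 (σ := 1) (by simp) ha
    have hm := integrableOn_posPow_sub hs0 hs1 (σ := -1) (by simp) ha
    have hm' := integrableOn_posPow_sub hs0 hs1 (σ := -1) (by simp) ha'
    have h1 := integral_Ioi_truncated_add hs0 hs1 ha
    have h2 := integral_Ioc_posPow_sub_le hs0 hs1 ha ha1
    -- The left cutoff moves from `a/(1 + a)` to `a`; the removed piece is the error bounded in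
    -- `h2`.
    rw [← Ioc_union_Ioi_eq_Ioi hle, setIntegral_union (Ioc_disjoint_Ioi le_rfl) measurableSet_Ioi
      (hm'.mono_set Ioc_subset_Ioi_self) hm] at h1
    have h3 : ∫ r in Ioi a, f r =
        (∫ r in Ioi a, (1 - posPow s (1 + 1 * r)) * r ^ (-1 - 2 * s)) +
        ∫ r in Ioi a, (1 - posPow s (1 + -1 * r)) * r ^ (-1 - 2 * s) := by
      rw [← integral_add hp hm]
      refine setIntegral_congr_fun measurableSet_Ioi fun r _ => ?_
      simp only [hf, posPowSecondDiff]
      rw [posPow_of_nonneg zero_le_one, Real.one_rpow, one_mul, neg_one_mul, ← sub_eq_add_neg]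
      ring
    linarith
  set a : ℕ → ℝ := fun n => 1 / ((n : ℝ) + 1) with ha_def
  have ha_pos : ∀ n, 0 < a n := fun n => by positivity
  have ha_anti : Antitone a := fun m n h => by simp only [ha_def]; gcongr
  have ha_lim : Tendsto a atTop (𝓝 0) := tendsto_one_div_add_atTop_nhds_zero_nat
  have hU : ⋃ n, Ioi (a n) = Ioi 0 := by
    ext r
    simp only [mem_iUnion, mem_Ioi]
    exact ⟨fun ⟨n, h⟩ => (ha_pos n).trans h, fun h => (ha_lim.eventually_lt_const h).exists⟩
  have hlim := tendsto_setIntegral_of_monotone (μ := volume) (f := f) (s := fun n => Ioi (a n))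
    (fun n => measurableSet_Ioi) (fun m n h => Ioi_subset_Ioi (ha_anti h)) (by rw [hU]; exact hint)
  rw [hU] at hlim
  have hzero : Tendsto (fun n => -(2 ^ (2 * s) * a n ^ (2 - 2 * s))) atTop (𝓝 0) := by
    have := (ha_lim.rpow_const (p := 2 - 2 * s) (Or.inr (by linarith))).const_mul (2 ^ (2 * s))
    rw [Real.zero_rpow (by linarith)] at this
    simpa using this.neg
  refine le_of_tendsto_of_tendsto' hzero hlim fun n => hlow _ ⟨ha_pos n, ?_⟩
  simp only [ha_def]
  rw [div_le_one (by positivity)]; linarith [(Nat.cast_nonneg n : (0 : ℝ) ≤ n)]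

end OneDim

/-- The Euclidean space `ℝ^N`. -/
abbrev Euc (N : ℕ) := EuclideanSpace ℝ (Fin N)

/-! ### Integration in polar coordinates. -/

section Polar

open Set Filter Topology Metric
open scoped ENNReal RealInnerProductSpace

variable {N : ℕ}

lemma integral_volumeIoiPow (n : ℕ) (f : ℝ → ℝ) :
    ∫ r : Ioi (0 : ℝ), f r ∂(Measure.volumeIoiPow n) = ∫ r in Ioi (0 : ℝ), r ^ n * f r := by
  simp only [Measure.volumeIoiPow, ENNReal.ofReal]
  rw [integral_withDensity_eq_integral_smul
      (((measurable_subtype_coe.pow_const _).real_toNNReal)),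
    integral_subtype_comap measurableSet_Ioi fun a : ℝ => Real.toNNReal (a ^ n) • f a]
  refine setIntegral_congr_fun measurableSet_Ioi fun x hx => ?_
  rw [NNReal.smul_def, Real.coe_toNNReal _ (pow_nonneg (le_of_lt hx) _), smul_eq_mul]

lemma lintegral_volumeIoiPow (n : ℕ) {f : ℝ → ℝ≥0∞} (hf : Measurable f) :
    ∫⁻ r : Ioi (0 : ℝ), f r ∂(Measure.volumeIoiPow n) =
      ∫⁻ r in Ioi (0 : ℝ), ENNReal.ofReal (r ^ n) * f r := by
  refine (lintegral_withDensity_eq_lintegral_mul _ (by fun_prop)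
    (g := fun r : Ioi (0 : ℝ) => f r) (hf.comp measurable_subtype_coe)).trans ?_
  exact lintegral_subtype_comap measurableSet_Ioi fun r : ℝ => ENNReal.ofReal (r ^ n) * f r

theorem lintegral_polar (hN : 0 < N) {f : Euc N → ℝ≥0∞} (hf : Measurable f) :
    ∫⁻ z, f z = ∫⁻ θ : sphere (0 : Euc N) 1,
      (∫⁻ r in Ioi (0 : ℝ), ENNReal.ofReal (r ^ (N - 1)) * f (r • (θ : Euc N)))
        ∂(volume : Measure (Euc N)).toSphere := by
  have : Nonempty (Fin N) := ⟨⟨0, hN⟩⟩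
  have h := (Measure.measurePreserving_homeomorphUnitSphereProd
    (volume : Measure (Euc N))).symm (homeomorphUnitSphereProd (Euc N)).toMeasurableEquiv
  have h1 := h.lintegral_comp_emb (MeasurableEquiv.measurableEmbedding _)
    (fun z : ({(0 : Euc N)}ᶜ : Set (Euc N)) => f z)
  rw [lintegral_subtype_comap (measurableSet_singleton _).compl, restrict_compl_singleton] at h1
  rw [← h1]
  have hm : Measurable fun p : sphere (0 : Euc N) 1 × Ioi (0 : ℝ) => f ((p.2 : ℝ) • (p.1 : Euc N)) :=
    hf.comp (by fun_prop)
  refine (lintegral_congr fun p => ?_).trans ((lintegral_prod _ hm.aemeasurable).trans ?_)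
  · exact congrArg f (homeomorphUnitSphereProd_symm_apply_coe (Euc N) p)
  · rw [finrank_euclideanSpace_fin]
    refine lintegral_congr fun θ => ?_
    exact lintegral_volumeIoiPow (N - 1) (f := fun r => f (r • (θ : Euc N)))
      (hf.comp (by fun_prop))

theorem integral_nonneg_of_polar (hN : 0 < N) {f : Euc N → ℝ}
    (h : ∀ θ : Euc N, ‖θ‖ = 1 → 0 ≤ ∫ r in Ioi (0 : ℝ), r ^ (N - 1) * f (r • θ)) :
    0 ≤ ∫ z, f z := by
  have : Nonempty (Fin N) := ⟨⟨0, hN⟩⟩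
  have hmp := (Measure.measurePreserving_homeomorphUnitSphereProd
    (volume : Measure (Euc N))).symm (homeomorphUnitSphereProd (Euc N)).toMeasurableEquiv
  have h1 := hmp.integral_comp (MeasurableEquiv.measurableEmbedding _)
    (fun z : ({(0 : Euc N)}ᶜ : Set (Euc N)) => f z)
  rw [integral_subtype_comap (measurableSet_singleton _).compl, restrict_compl_singleton] at h1
  rw [← h1]
  by_cases hi : Integrable (fun p => f ((homeomorphUnitSphereProd (Euc N)).toMeasurableEquiv.symm p))
      ((volume : Measure (Euc N)).toSphere.prod
        (Measure.volumeIoiPow (Module.finrank ℝ (Euc N) - 1)))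
  · rw [integral_prod _ hi]
    refine integral_nonneg fun θ => ?_
    refine (h θ (norm_eq_of_mem_sphere θ)).trans_eq ?_
    rw [finrank_euclideanSpace_fin]
    refine (integral_volumeIoiPow (N - 1) (fun r => f (r • (θ : Euc N)))).symm.trans ?_
    refine integral_congr_ae (Eventually.of_forall fun r => ?_)
    exact congrArg f (homeomorphUnitSphereProd_symm_apply_coe (Euc N) (θ, r)).symm
  -- Without integrability the Bochner integral is `0` by convention, so no integrability hypothesis
  -- is needed.
  · rw [integral_undef hi]

end Polar

/-! ### The kernel, and superharmonicity of the half-space profile. -/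

section Kernel

open Set Filter Topology Metric
open scoped ENNReal RealInnerProductSpace

variable {N : ℕ} {s : ℝ}

/-- The kernel `z ↦ |z|^{-N-2s}`. -/
noncomputable def fracKernel (s : ℝ) (z : Euc N) : ℝ := (‖z‖ ^ ((N : ℝ) + 2 * s))⁻¹

lemma fracKernel_nonneg (s : ℝ) (z : Euc N) : 0 ≤ fracKernel s z :=
  inv_nonneg.2 (Real.rpow_nonneg (norm_nonneg _) _)

lemma fracKernel_neg (s : ℝ) (z : Euc N) : fracKernel s (-z) = fracKernel s z := by
  simp [fracKernel]

lemma measurable_fracKernel (s : ℝ) : Measurable (fracKernel s : Euc N → ℝ) := by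
  unfold fracKernel; fun_prop

/-- The origin is excluded because the kernel takes the default value `0` there. -/
lemma fracKernel_anti (hs : 0 < s) {z : Euc N} {r : ℝ} (hz : z ≠ 0) (h : ‖z‖ ≤ r) :
    (r ^ ((N : ℝ) + 2 * s))⁻¹ ≤ fracKernel s z := by
  unfold fracKernel
  have := norm_pos_iff.2 hz
  gcongr

/-- The radial majorant `z ↦ min(|z|², |z|ˢ)` of second differences. -/
noncomputable def kernelWeight (s : ℝ) (z : Euc N) : ℝ := min (‖z‖ ^ 2) (‖z‖ ^ s)

lemma kernelWeight_nonneg (s : ℝ) (z : Euc N) : 0 ≤ kernelWeight s z := by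
  unfold kernelWeight; positivity

lemma kernelWeight_of_le_one (hs1 : s < 1) {z : Euc N} (hz : ‖z‖ ≤ 1) :
    kernelWeight s z = ‖z‖ ^ 2 := by
  refine min_eq_left ?_
  rcases (norm_nonneg z).eq_or_lt with h | h
  · rw [← h]; simpa using Real.rpow_nonneg le_rfl s
  · rw [← Real.rpow_two]; exact Real.rpow_le_rpow_of_exponent_ge h hz (by linarith)

lemma kernelWeight_of_one_le (hs1 : s < 1) {z : Euc N} (hz : 1 ≤ ‖z‖) :
    kernelWeight s z = ‖z‖ ^ s := by
  refine min_eq_right ?_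
  rw [← Real.rpow_two]; exact Real.rpow_le_rpow_of_exponent_le hz (by linarith)

lemma min_sq_one_le_kernelWeight (hs0 : 0 < s) (hs1 : s < 1) (z : Euc N) :
    min (‖z‖ ^ 2) 1 ≤ kernelWeight s z := by
  rcases le_total ‖z‖ 1 with h | h
  · rw [kernelWeight_of_le_one hs1 h]; exact min_le_left _ _
  · rw [kernelWeight_of_one_le hs1 h]
    exact (min_le_right _ _).trans (Real.one_le_rpow h hs0.le)

lemma pow_mul_fracKernel_smul (hN : 0 < N) {θ : Euc N} (hθ : ‖θ‖ = 1) {r : ℝ} (hr : 0 < r) :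
    r ^ (N - 1) * fracKernel s (r • θ) = r ^ (-1 - 2 * s) := by
  rw [fracKernel, norm_smul, hθ, mul_one, Real.norm_eq_abs, abs_of_pos hr, ← Real.rpow_natCast,
    ← Real.rpow_neg hr.le, ← Real.rpow_add hr]
  congr 1
  push_cast [Nat.cast_sub (Nat.succ_le_of_lt hN)]
  ring

theorem integrable_kernelWeight_mul (hN : 0 < N) (hs0 : 0 < s) (hs1 : s < 1) :
    Integrable fun z : Euc N => kernelWeight s z * fracKernel s z := by
  have : Nonempty (Fin N) := ⟨⟨0, hN⟩⟩
  have key := integrable_fun_norm_addHaar (volume : Measure (Euc N))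
    (f := fun r : ℝ => min (r ^ 2) (r ^ s) * (r ^ ((N : ℝ) + 2 * s))⁻¹)
  refine key.2 ?_
  rw [finrank_euclideanSpace_fin]
  have hpow : ∀ r : ℝ, 0 < r → r ^ (N - 1) * (r ^ ((N : ℝ) + 2 * s))⁻¹ = r ^ (-1 - 2 * s) := by
    intro r hr
    rw [← Real.rpow_natCast, ← Real.rpow_neg hr.le, ← Real.rpow_add hr]
    congr 1
    push_cast [Nat.cast_sub (Nat.succ_le_of_lt hN)]
    ring
  have hmeas : Measurable fun r : ℝ =>
      r ^ (N - 1) • (min (r ^ 2) (r ^ s) * (r ^ ((N : ℝ) + 2 * s))⁻¹) := by fun_prop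
  have hval : ∀ r : ℝ, 0 < r → r ^ (N - 1) • (min (r ^ 2) (r ^ s) * (r ^ ((N : ℝ) + 2 * s))⁻¹) =
      min (r ^ 2) (r ^ s) * r ^ (-1 - 2 * s) := by
    intro r hr
    rw [← hpow r hr, smul_eq_mul]; ring
  rw [← Ioc_union_Ioi_eq_Ioi (zero_le_one : (0 : ℝ) ≤ 1)]
  refine IntegrableOn.union ?_ ?_
  -- In polar coordinates the integrand is `r^{1-2s}` near `0`, integrable as `s < 1`, and
  -- `r^{-1-s}` at infinity, integrable as `s > 0`.
  · have h1 : IntegrableOn (fun r : ℝ => r ^ (1 - 2 * s)) (Ioc 0 1) :=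
      (intervalIntegral.intervalIntegrable_rpow' (by linarith)).1
    refine Integrable.mono' h1 hmeas.aestronglyMeasurable
      ((ae_restrict_iff' measurableSet_Ioc).2 (Eventually.of_forall fun r hr => ?_))
    have hr0 : 0 < r := hr.1
    rw [hval r hr0, Real.norm_of_nonneg (by positivity),
      show 1 - 2 * s = 2 + (-1 - 2 * s) by ring, Real.rpow_add hr0, Real.rpow_two]
    gcongr
    exact min_le_left _ _
  · refine Integrable.mono' (integrableOn_Ioi_rpow_of_lt (a := s + (-1 - 2 * s)) (by linarith)
      zero_lt_one) hmeas.aestronglyMeasurable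
      ((ae_restrict_iff' measurableSet_Ioi).2 (Eventually.of_forall fun r hr => ?_))
    have hr0 : 0 < r := zero_lt_one.trans hr
    rw [hval r hr0, Real.norm_of_nonneg (by positivity), Real.rpow_add hr0]
    gcongr
    exact min_le_right _ _

/-- `z ↦ (d + n·z)₊ˢ` is `s`-superharmonic at the points where it is positive. -/
theorem integral_posPowSecondDiff_inner_nonneg (hN : 0 < N) (hs0 : 0 < s) (hs1 : s < 1)
    (n : Euc N) {d : ℝ} (hd : 0 < d) :
    0 ≤ ∫ z : Euc N, posPowSecondDiff s d ⟪n, z⟫ * fracKernel s z := by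
  refine integral_nonneg_of_polar hN fun θ hθ => ?_
  set a : ℝ := ⟪n, θ⟫ with ha
  have h1 : ∫ r in Ioi (0 : ℝ), r ^ (N - 1) *
      (posPowSecondDiff s d ⟪n, r • θ⟫ * fracKernel s (r • θ)) =
      ∫ r in Ioi (0 : ℝ), posPowSecondDiff s d (|a| * r) * r ^ (-1 - 2 * s) := by
    refine setIntegral_congr_fun measurableSet_Ioi fun r (hr : 0 < r) => ?_
    rw [← pow_mul_fracKernel_smul hN hθ hr, inner_smul_right, ← ha, ← posPowSecondDiff_abs,
      abs_mul, abs_of_pos hr, mul_comm r |a|]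
    ring
  rw [h1]
  rcases eq_or_ne a 0 with h0 | h0
  · simp [h0, posPowSecondDiff_zero]
  · have hb : 0 < |a| / d := div_pos (abs_pos.2 h0) hd
    set b := |a| / d with hb_def
    -- Homogeneity: on each ray, rescaling by `b = |a|/d` reduces to the one-dimensional integral at
    -- the point `1`.
    have h2 : ∫ r in Ioi (0 : ℝ), posPowSecondDiff s d (|a| * r) * r ^ (-1 - 2 * s) =
        ∫ r in Ioi (0 : ℝ), d ^ s * b ^ (1 + 2 * s) *
          (fun t => posPowSecondDiff s 1 t * t ^ (-1 - 2 * s)) (b * r) := by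
      refine setIntegral_congr_fun measurableSet_Ioi fun r (hr : 0 < r) => ?_
      simp only
      have e1 : |a| * r = d * (b * r) := by rw [hb_def]; field_simp
      have e2 : posPowSecondDiff s d (|a| * r) = d ^ s * posPowSecondDiff s 1 (b * r) := by
        rw [e1, ← posPowSecondDiff_mul hd.le, mul_one]
      have e3 : b ^ (1 + 2 * s) * b ^ (-1 - 2 * s) = 1 := by
        rw [← Real.rpow_add hb]; simp
      rw [e2, Real.mul_rpow hb.le hr.le]
      linear_combination (-(d ^ s * posPowSecondDiff s 1 (b * r) * r ^ (-1 - 2 * s))) * e3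
    rw [h2, integral_const_mul, integral_comp_mul_left_Ioi
      (fun t => posPowSecondDiff s 1 t * t ^ (-1 - 2 * s)) 0 hb, mul_zero]
    have := integral_posPowSecondDiff_nonneg hs0 hs1
    positivity

end Kernel

/-! ### Uniform bounds for integrals singular on a hyperplane. -/

section LineSingularity

open Set Filter Topology Metric
open scoped ENNReal RealInnerProductSpace

variable {N : ℕ} {s : ℝ}

lemma ennreal_rpow_anti {x y : ℝ≥0∞} {a : ℝ} (ha : a ≤ 0) (h : x ≤ y) : y ^ a ≤ x ^ a := by
  rw [← neg_neg a, ENNReal.rpow_neg, ENNReal.rpow_neg x]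
  exact ENNReal.inv_le_inv.2 (ENNReal.rpow_le_rpow h (by linarith))

/-- Negative powers decrease, so the product is at most the power `a + b` of the smaller of `x` and
`y`. In `ℝ≥0∞` a negative power of `0` is `⊤`, so such upper bounds hold at the singular points too.
-/
lemma ennreal_rpow_mul_rpow_le {x y : ℝ≥0∞} {a b : ℝ} (ha : a < 0) (hb : b < 0) :
    x ^ a * y ^ b ≤ x ^ (a + b) + y ^ (a + b) := by
  have aux : ∀ z : ℝ≥0∞, z ^ a * z ^ b ≤ z ^ (a + b) := by
    intro z
    rcases eq_or_ne z 0 with rfl | h0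
    · rw [ENNReal.zero_rpow_of_neg (add_neg ha hb)]; exact le_top
    rcases eq_or_ne z ⊤ with rfl | ht
    · simp [ENNReal.top_rpow_of_neg ha]
    · exact (ENNReal.rpow_add _ _ h0 ht).ge
  rcases le_total x y with h | h
  · exact ((mul_le_mul_right (ennreal_rpow_anti hb.le h) _).trans (aux x)).trans le_self_add
  · exact ((mul_le_mul_left (ennreal_rpow_anti ha.le h) _).trans (aux y)).trans le_add_self

lemma lintegral_ball_enorm_rpow_lt_top {a : ℝ} (ha : -1 < a) :
    ∫⁻ t in ball (0 : ℝ) 1, ‖t‖ₑ ^ a < ⊤ := by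
  have h := (integrableOn_fun_norm_addHaar (volume : Measure ℝ) (f := fun r : ℝ => r ^ a)
    (r := 1)).2 (by
      simp only [Module.finrank_self, Nat.sub_self, pow_zero, one_smul]
      exact (intervalIntegral.intervalIntegrable_rpow' (a := 0) (b := 1) ha).1.mono_set
        Ioo_subset_Ioc_self)
  refine lt_of_le_of_lt (le_of_eq ?_) h.2
  have hne : ∀ᵐ t : ℝ ∂(volume.restrict (ball (0 : ℝ) 1)), t ≠ 0 :=
    ae_restrict_of_ae (Measure.ae_ne volume 0)
  refine lintegral_congr_ae (hne.mono fun t ht => ?_)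
  have hp : 0 < ‖t‖ := norm_pos_iff.2 ht
  simp only
  rw [Real.enorm_of_nonneg (Real.rpow_nonneg hp.le _), ← ENNReal.ofReal_rpow_of_pos hp,
    ofReal_norm]

lemma exists_lintegral_Ioc_sub_le {a : ℝ} (ha : -1 < a) (ha0 : a < 0) :
    ∃ C : ℝ≥0∞, C ≠ ⊤ ∧ ∀ b : ℝ, ∫⁻ r in Ioc (0 : ℝ) 1, ‖r - b‖ₑ ^ a ≤ C := by
  set F : ℝ → ℝ≥0∞ := (ball (0 : ℝ) 1).indicator fun t => ‖t‖ₑ ^ a with hF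
  refine ⟨(∫⁻ t in ball (0 : ℝ) 1, ‖t‖ₑ ^ a) + 1,
    ENNReal.add_ne_top.2 ⟨(lintegral_ball_enorm_rpow_lt_top ha).ne, ENNReal.one_ne_top⟩,
    fun b => ?_⟩
  have hpt : ∀ t : ℝ, ‖t‖ₑ ^ a ≤ F t + 1 := by
    intro t
    by_cases ht : t ∈ ball (0 : ℝ) 1
    · rw [hF, indicator_of_mem ht]; exact le_self_add
    · refine le_add_left (ENNReal.rpow_le_one_of_one_le_of_neg ?_ ha0)
      rw [mem_ball_zero_iff, not_lt] at ht
      rw [← ofReal_norm, ← ENNReal.ofReal_one]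
      exact ENNReal.ofReal_le_ofReal ht
  calc ∫⁻ r in Ioc (0 : ℝ) 1, ‖r - b‖ₑ ^ a ≤ ∫⁻ r in Ioc (0 : ℝ) 1, (F (r - b) + 1) :=
        lintegral_mono fun r => hpt _
    _ = (∫⁻ r in Ioc (0 : ℝ) 1, F (r - b)) + 1 := by
        rw [lintegral_add_right _ measurable_const]; simp
    _ ≤ (∫⁻ r, F (r - b)) + 1 := by gcongr; exact Measure.restrict_le_self
    _ = _ := by
        rw [lintegral_sub_right_eq_self F b, hF, lintegral_indicator measurableSet_ball]

/-- The singularities at `b` and at `0` may coincide. From `(1 - s)² ≥ 0` follows `r^{1-2s} ≤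
r^{-s²}` on `(0, 1]`, and the total exponent `s - 1 - s²` still exceeds `-1` since `s(1 - s) > 0`.
The clause `1 ≤ C` only serves to make `⊤ * C = ⊤` later. -/
lemma exists_lintegral_Ioc_sub_mul_le (hs0 : 0 < s) (hs1 : s < 1) :
    ∃ C : ℝ≥0∞, C ≠ ⊤ ∧ 1 ≤ C ∧ ∀ b : ℝ,
      ∫⁻ r in Ioc (0 : ℝ) 1, ‖r - b‖ₑ ^ (s - 1) * ENNReal.ofReal (r ^ (1 - 2 * s)) ≤ C := by
  have hμ1 : -1 < s - 1 + -s ^ 2 := by nlinarith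
  have hμ0 : s - 1 + -s ^ 2 < 0 := by nlinarith
  obtain ⟨C, hC, h⟩ := exists_lintegral_Ioc_sub_le hμ1 hμ0
  refine ⟨C + C + 1, by finiteness, le_add_self, fun b => ?_⟩
  have hm : ∀ c : ℝ, Measurable fun r : ℝ => ‖r - c‖ₑ ^ (s - 1 + -s ^ 2) := fun c => by fun_prop
  calc _ ≤ ∫⁻ r in Ioc (0 : ℝ) 1,
        (‖r - b‖ₑ ^ (s - 1 + -s ^ 2) + ‖r - 0‖ₑ ^ (s - 1 + -s ^ 2)) := by
        refine setLIntegral_mono ((hm b).add (hm 0)) fun r hr => ?_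
        refine le_trans ?_ (ennreal_rpow_mul_rpow_le (by linarith) (by nlinarith))
        gcongr
        rw [sub_zero, Real.enorm_of_nonneg hr.1.le, ENNReal.ofReal_rpow_of_pos hr.1]
        exact ENNReal.ofReal_le_ofReal
          (Real.rpow_le_rpow_of_exponent_ge hr.1 hr.2 (by nlinarith [sq_nonneg (1 - s)]))
    _ = (∫⁻ r in Ioc (0 : ℝ) 1, ‖r - b‖ₑ ^ (s - 1 + -s ^ 2)) +
        ∫⁻ r in Ioc (0 : ℝ) 1, ‖r - 0‖ₑ ^ (s - 1 + -s ^ 2) := lintegral_add_left (hm b) _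
    _ ≤ C + C := add_le_add (h b) (h 0)
    _ ≤ _ := le_self_add

lemma exists_coordinate_isometry (hN : 0 < N) {n : Euc N} (hn : ‖n‖ = 1) :
    ∃ b : OrthonormalBasis (Fin N) ℝ (Euc N), ∀ z, ⟪n, z⟫ = b.repr z ⟨0, hN⟩ := by
  have horth : Orthonormal ℝ (({⟨0, hN⟩} : Set (Fin N)).domRestrict fun _ => n) :=
    ⟨fun _ => hn, fun i j hij => absurd (Subsingleton.elim i j) hij⟩
  obtain ⟨b, hb⟩ := horth.exists_orthonormalBasis_extension_of_card_eq (by simp)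
  exact ⟨b, fun z => by rw [b.repr_apply_apply, hb _ rfl]⟩

/-- A rotation turns `n` into a coordinate vector, which makes the bound independent of `n`; the
ball then sits in a cube, where the integral factorises and leaves a one-dimensional `|t|^a`. -/
lemma exists_lintegral_closedBall_inner_le (hN : 0 < N) {a : ℝ} (ha : -1 < a) :
    ∃ C : ℝ≥0∞, C ≠ ⊤ ∧ ∀ n : Euc N, ‖n‖ = 1 →
      ∫⁻ z in ball (0 : Euc N) 1, ‖(⟪n, z⟫ : ℝ)‖ₑ ^ a ≤ C := by
  set i₀ : Fin N := ⟨0, hN⟩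
  set Q : Set (Fin N → ℝ) := Set.univ.pi fun _ => ball (0 : ℝ) 1 with hQ
  set F : Euc N → ℝ≥0∞ := (ball (0 : Euc N) 1).indicator fun w => ‖w i₀‖ₑ ^ a with hF
  have hFle : ∀ w : Fin N → ℝ, F (WithLp.toLp 2 w) ≤ Q.indicator (fun w => ‖w i₀‖ₑ ^ a) w := by
    intro w
    by_cases hw : WithLp.toLp 2 w ∈ ball (0 : Euc N) 1
    · have hwi : w ∈ Q := fun i _ => by
        rw [mem_ball_zero_iff] at hw ⊢
        exact (PiLp.norm_apply_le (WithLp.toLp 2 w : Euc N) i).trans_lt hw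
      rw [hF, indicator_of_mem hw, indicator_of_mem hwi]
    · rw [hF, indicator_of_notMem hw]; exact zero_le
  have hQm : MeasurableSet Q := MeasurableSet.univ_pi fun _ => measurableSet_ball
  refine ⟨∫⁻ w : Euc N, F w, ?_, fun n hn => ?_⟩
  · have h1 : ∫⁻ w : Euc N, F w = ∫⁻ w : Fin N → ℝ, F (WithLp.toLp 2 w) :=
      ((PiLp.volume_preserving_toLp (Fin N)).lintegral_comp_emb
        (MeasurableEquiv.toLp 2 (Fin N → ℝ)).measurableEmbedding F).symm
    refine ne_top_of_le_ne_top ?_ (h1.le.trans (lintegral_mono hFle))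
    rw [lintegral_indicator hQm, volume_pi, hQ, Measure.restrict_pi_pi,
      ← lintegral_map (f := fun t : ℝ => ‖t‖ₑ ^ a) (by fun_prop) (measurable_pi_apply i₀),
      Measure.pi_map_eval, lintegral_smul_measure]
    refine ENNReal.mul_ne_top (ENNReal.prod_ne_top fun i _ => ?_)
      (lintegral_ball_enorm_rpow_lt_top ha).ne
    simp
  · obtain ⟨b, hb⟩ := exists_coordinate_isometry hN hn
    have h2 := b.measurePreserving_repr.lintegral_comp_emb
      b.repr.toHomeomorph.measurableEmbedding F
    rw [← h2, ← lintegral_indicator measurableSet_ball]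
    refine lintegral_mono fun z => ?_
    simp only [hF, indicator, mem_ball_zero_iff, LinearIsometryEquiv.norm_map, hb z]
    exact le_rfl

/-- Deduced from the ball: for `r < 1` and `a < 0` one has `|n·rθ|^a ≥ |n·θ|^a`, so in polar
coordinates the ball integral dominates `c₀` times the sphere integral. -/
lemma exists_lintegral_sphere_inner_le (hN : 0 < N) {a : ℝ} (ha : -1 < a) (ha0 : a < 0) :
    ∃ C : ℝ≥0∞, C ≠ ⊤ ∧ ∀ n : Euc N, ‖n‖ = 1 →
      ∫⁻ θ : sphere (0 : Euc N) 1, ‖(⟪n, (θ : Euc N)⟫ : ℝ)‖ₑ ^ a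
        ∂(volume : Measure (Euc N)).toSphere ≤ C := by
  obtain ⟨C, hC, h⟩ := exists_lintegral_closedBall_inner_le hN ha
  set c₀ : ℝ≥0∞ := ∫⁻ r in Ioo (0 : ℝ) 1, ENNReal.ofReal (r ^ (N - 1)) with hc₀
  have hc₀pos : c₀ ≠ 0 := by
    refine (setLIntegral_pos_iff (by fun_prop)).2 ?_ |>.ne'
    refine lt_of_lt_of_le (?_ : 0 < volume (Ioo (0 : ℝ) 1)) (measure_mono fun r hr => ⟨?_, hr⟩)
    · simp
    · simpa using pow_pos hr.1 _
  refine ⟨c₀⁻¹ * C, ENNReal.mul_ne_top (ENNReal.inv_ne_top.2 hc₀pos) hC, fun n hn => ?_⟩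
  have hm : Measurable ((ball (0 : Euc N) 1).indicator fun z => ‖(⟪n, z⟫ : ℝ)‖ₑ ^ a) :=
    Measurable.indicator (by fun_prop) measurableSet_ball
  have hpol := lintegral_polar hN hm
  rw [lintegral_indicator measurableSet_ball] at hpol
  have hlow : c₀ * ∫⁻ θ : sphere (0 : Euc N) 1, ‖(⟪n, (θ : Euc N)⟫ : ℝ)‖ₑ ^ a
        ∂(volume : Measure (Euc N)).toSphere ≤ C := by
    refine le_trans ?_ (hpol ▸ h n hn)
    rw [← lintegral_const_mul _ (by fun_prop)]
    refine lintegral_mono fun θ => ?_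
    rw [hc₀, ← lintegral_mul_const _ (by fun_prop)]
    refine le_trans (lintegral_mono_ae ?_) (lintegral_mono_set Ioo_subset_Ioi_self)
    refine (ae_restrict_iff' measurableSet_Ioo).2 (Eventually.of_forall fun r hr => ?_)
    have hmem : r • (θ : Euc N) ∈ ball (0 : Euc N) 1 := by
      rw [mem_ball_zero_iff, norm_smul, norm_eq_of_mem_sphere, mul_one, Real.norm_eq_abs,
        abs_of_pos hr.1]
      exact hr.2
    rw [indicator_of_mem hmem, inner_smul_right, enorm_mul]
    refine mul_le_mul_right (ennreal_rpow_anti ha0.le (mul_le_of_le_one_left' ?_)) _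
    rw [Real.enorm_of_nonneg hr.1.le]
    exact ENNReal.ofReal_le_one.2 hr.2.le
  have hc₀top : c₀ ≠ ⊤ := by
    refine ne_top_of_le_ne_top ENNReal.one_ne_top ?_
    calc c₀ ≤ ∫⁻ r in Ioo (0 : ℝ) 1, 1 := setLIntegral_mono measurable_const fun r hr =>
          ENNReal.ofReal_le_one.2 (pow_le_one₀ hr.1.le hr.2.le)
      _ = 1 := by simp
  calc _ = c₀⁻¹ * (c₀ * ∫⁻ θ : sphere (0 : Euc N) 1, ‖(⟪n, (θ : Euc N)⟫ : ℝ)‖ₑ ^ a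
        ∂(volume : Measure (Euc N)).toSphere) := by
        rw [← mul_assoc, ENNReal.inv_mul_cancel hc₀pos hc₀top, one_mul]
    _ ≤ _ := by gcongr

/-- The singular integrals that control the curvature error of the barrier. -/
theorem exists_lintegral_hyperplane_singularity_le (hN : 0 < N) (hs0 : 0 < s) (hs1 : s < 1) :
    ∃ C : ℝ≥0∞, C ≠ ⊤ ∧ ∀ n : Euc N, ‖n‖ = 1 → ∀ d : ℝ, 0 < d →
      ∫⁻ z in closedBall (0 : Euc N) 1, ‖d + (⟪n, z⟫ : ℝ)‖ₑ ^ (s - 1) *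
        ENNReal.ofReal (‖z‖ ^ 2 * fracKernel s z) ≤ C := by
  obtain ⟨C₁, hC₁, h1C, h₁⟩ := exists_lintegral_Ioc_sub_mul_le hs0 hs1
  obtain ⟨C₂, hC₂, h₂⟩ := exists_lintegral_sphere_inner_le hN (a := s - 1) (by linarith)
    (by linarith)
  refine ⟨C₂ * C₁, ENNReal.mul_ne_top hC₂ hC₁, fun n hn d hd => ?_⟩
  have hk := measurable_fracKernel (N := N) s
  have hm : Measurable ((closedBall (0 : Euc N) 1).indicator fun z =>
      ‖d + (⟪n, z⟫ : ℝ)‖ₑ ^ (s - 1) * ENNReal.ofReal (‖z‖ ^ 2 * fracKernel s z)) :=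
    Measurable.indicator (by fun_prop) measurableSet_closedBall
  rw [← lintegral_indicator measurableSet_closedBall, lintegral_polar hN hm]
  refine le_trans ?_ (mul_le_mul_left (h₂ n hn) C₁)
  rw [← lintegral_mul_const _ (by fun_prop)]
  refine lintegral_mono fun θ => ?_
  have hθ := norm_eq_of_mem_sphere θ
  set a : ℝ := ⟪n, (θ : Euc N)⟫ with ha
  have hinner : ∫⁻ r in Ioi (0 : ℝ), ENNReal.ofReal (r ^ (N - 1)) *
      (closedBall (0 : Euc N) 1).indicator (fun z => ‖d + (⟪n, z⟫ : ℝ)‖ₑ ^ (s - 1) *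
        ENNReal.ofReal (‖z‖ ^ 2 * fracKernel s z)) (r • (θ : Euc N)) =
      ∫⁻ r in Ioc (0 : ℝ) 1, ‖d + r * a‖ₑ ^ (s - 1) * ENNReal.ofReal (r ^ (1 - 2 * s)) := by
    have hsub : Ioc (0 : ℝ) 1 ⊆ Ioi 0 := Ioc_subset_Ioi_self
    rw [← inter_eq_self_of_subset_left hsub, ← Measure.restrict_restrict measurableSet_Ioc,
      ← lintegral_indicator measurableSet_Ioc]
    refine setLIntegral_congr_fun measurableSet_Ioi fun r (hr : 0 < r) => ?_
    have hnorm : ‖r • (θ : Euc N)‖ = r := by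
      rw [norm_smul, hθ, mul_one, Real.norm_eq_abs, abs_of_pos hr]
    simp only [indicator, mem_closedBall_zero_iff, hnorm, mem_Ioc, hr, true_and]
    split_ifs
    · rw [inner_smul_right, ← ha, mul_left_comm, ← ENNReal.ofReal_mul (by positivity)]
      congr 2
      rw [mul_left_comm, pow_mul_fracKernel_smul hN hθ hr, ← Real.rpow_two, ← Real.rpow_add hr]
      congr 1; ring
    · simp
  rw [hinner]
  rcases eq_or_ne a 0 with h0 | h0
  -- Directions orthogonal to `n`: the right side is `⊤ * C₁ = ⊤` because `C₁ ≥ 1`.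
  · rw [h0, enorm_zero, ENNReal.zero_rpow_of_neg (by linarith),
      ENNReal.top_mul (zero_lt_one.trans_le h1C).ne']
    exact le_top
  -- Factoring out `a = n·θ` leaves a singularity at `-(d/a)`, whose position does not matter for
  -- `h₁`; the factor `|n·θ|^{s-1}` is integrable over the sphere.
  · calc _ = ∫⁻ r in Ioc (0 : ℝ) 1, ‖a‖ₑ ^ (s - 1) *
          (‖r - -(d / a)‖ₑ ^ (s - 1) * ENNReal.ofReal (r ^ (1 - 2 * s))) := by
          refine lintegral_congr fun r => ?_
          rw [← mul_assoc, ← ENNReal.mul_rpow_of_ne_top (by simp) (by simp), ← enorm_mul]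
          congr 3
          field_simp; ring
      _ = ‖a‖ₑ ^ (s - 1) * ∫⁻ r in Ioc (0 : ℝ) 1,
          (‖r - -(d / a)‖ₑ ^ (s - 1) * ENNReal.ofReal (r ^ (1 - 2 * s))) :=
          lintegral_const_mul _ (by fun_prop)
      _ ≤ _ := by gcongr; exact h₁ _

end LineSingularity

/-! ### The truncated barrier around an exterior ball. -/

section Barrier

open Set Filter Topology Metric
open scoped ENNReal RealInnerProductSpace

variable {N : ℕ} {s : ℝ}

lemma one_add_rpow_le_kernelWeight (hs0 : 0 < s) (hs1 : s < 1) {κ : ℝ} (hκ : 0 < κ) (hκ1 : κ ≤ 1)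
    {z : Euc N} (hz : κ ≤ ‖z‖) : 1 + ‖z‖ ^ s ≤ 2 * (κ ^ 2)⁻¹ * kernelWeight s z := by
  have hκ2 : 0 < κ ^ 2 := by positivity
  have hκ3 : κ ^ 2 ≤ 1 := pow_le_one₀ hκ.le hκ1
  rw [mul_assoc, ← div_eq_inv_mul, ← mul_div_assoc, le_div_iff₀ hκ2]
  rcases le_total ‖z‖ 1 with h | h
  · rw [kernelWeight_of_le_one hs1 h]
    have h1 : ‖z‖ ^ s ≤ 1 := Real.rpow_le_one (norm_nonneg _) h hs0.le
    have h2 : κ ^ 2 ≤ ‖z‖ ^ 2 := by gcongr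
    nlinarith
  · rw [kernelWeight_of_one_le hs1 h]
    have h1 : 1 ≤ ‖z‖ ^ s := Real.one_le_rpow h hs0.le
    nlinarith

/-- Away from the origin growth of order `|z|ˢ` is harmless, since the kernel decays like
`|z|^{-N-2s}`. All cut-off integrals below are justified in this way. -/
lemma integrableOn_mul_fracKernel (hN : 0 < N) (hs0 : 0 < s) (hs1 : s < 1) {κ C : ℝ} (hκ : 0 < κ)
    (hκ1 : κ ≤ 1) {f : Euc N → ℝ} (hf : Measurable f) (hC : 0 ≤ C)
    (h : ∀ z, |f z| ≤ C * (1 + ‖z‖ ^ s)) :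
    IntegrableOn (fun z => f z * fracKernel s z) (closedBall 0 κ)ᶜ := by
  refine Integrable.mono'
    ((integrable_kernelWeight_mul hN hs0 hs1).const_mul (C * (2 * (κ ^ 2)⁻¹))).integrableOn
    (hf.mul (measurable_fracKernel s)).aestronglyMeasurable
    ((ae_restrict_iff' measurableSet_closedBall.compl).2 (Eventually.of_forall fun z hz => ?_))
  rw [mem_compl_iff, mem_closedBall_zero_iff, not_le] at hz
  rw [Real.norm_eq_abs, abs_mul, abs_of_nonneg (fracKernel_nonneg s z), ← mul_assoc, mul_assoc C]
  have := fracKernel_nonneg s z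
  gcongr
  exact (h z).trans (by gcongr; exact one_add_rpow_le_kernelWeight hs0 hs1 hκ hκ1 hz.le)

lemma abs_inner_rpow_le (hs0 : 0 < s) {n : Euc N} (hn : ‖n‖ = 1) (z : Euc N) :
    |(⟪n, z⟫ : ℝ)| ^ s ≤ ‖z‖ ^ s := by
  refine Real.rpow_le_rpow (abs_nonneg _) ?_ hs0.le
  simpa [hn] using abs_real_inner_le_norm n z

lemma integrable_posPowSecondDiff_inner (hN : 0 < N) (hs0 : 0 < s) (hs1 : s < 1) {n : Euc N}
    (hn : ‖n‖ = 1) {d : ℝ} (hd : 0 < d) :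
    Integrable fun z : Euc N => posPowSecondDiff s d ⟪n, z⟫ * fracKernel s z := by
  have hd1 : 0 < min d 1 := lt_min hd one_pos
  refine Integrable.mono' ((integrable_kernelWeight_mul hN hs0 hs1).const_mul
    (2 * d ^ (s - 2) + 2 * (2 * (min d 1 ^ 2)⁻¹))) ?_ (Eventually.of_forall fun z => ?_)
  · have := continuous_posPowSecondDiff hs0 d
    exact ((this.measurable.comp (by fun_prop)).mul (measurable_fracKernel s)).aestronglyMeasurable
  rw [Real.norm_eq_abs, abs_mul, abs_of_nonneg (fracKernel_nonneg s z), ← mul_assoc]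
  refine mul_le_mul_of_nonneg_right ?_ (fracKernel_nonneg s z)
  have hk := kernelWeight_nonneg s z
  have hin : |(⟪n, z⟫ : ℝ)| ≤ ‖z‖ := by simpa [hn] using abs_real_inner_le_norm n z
  rcases le_total ‖z‖ (min d 1) with h | h
  · have hb := posPowSecondDiff_bounds hs0 hs1 hd (hin.trans (h.trans (min_le_left _ _)))
    rw [abs_of_nonneg hb.1]
    calc _ ≤ _ := hb.2
      _ ≤ 2 * d ^ (s - 2) * ‖z‖ ^ 2 := by
          rw [← sq_abs]; gcongr
      _ = 2 * d ^ (s - 2) * kernelWeight s z := by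
          rw [kernelWeight_of_le_one hs1 (h.trans (min_le_right _ _))]
      _ ≤ _ := by
          have : 0 ≤ 2 * (2 * (min d 1 ^ 2)⁻¹) := by positivity
          gcongr
          linarith
  · calc _ ≤ 2 * |(⟪n, z⟫ : ℝ)| ^ s := abs_posPowSecondDiff_le hs0 hs1 _ _
      _ ≤ 2 * (1 + ‖z‖ ^ s) := by linarith [abs_inner_rpow_le hs0 hn z]
      _ ≤ 2 * (2 * (min d 1 ^ 2)⁻¹ * kernelWeight s z) := by
          gcongr; exact one_add_rpow_le_kernelWeight hs0 hs1 hd1 (min_le_right _ _) h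
      _ ≤ _ := by
          have : 0 ≤ 2 * d ^ (s - 2) := by positivity
          rw [← mul_assoc]
          gcongr
          linarith

lemma setIntegral_compl_closedBall_neg (f : Euc N → ℝ) (κ : ℝ) :
    ∫ z in (closedBall (0 : Euc N) κ)ᶜ, f (-z) = ∫ z in (closedBall (0 : Euc N) κ)ᶜ, f z := by
  have h := (Measure.measurePreserving_neg (volume : Measure (Euc N))).setIntegral_preimage_emb
    (MeasurableEquiv.neg (Euc N)).measurableEmbedding f (closedBall (0 : Euc N) κ)ᶜ
  convert h using 3
  ext z; simp

/-- Lower bound for the half-space profile on a truncated domain. -/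
lemma neg_le_integral_posPow_sub (hN : 0 < N) (hs0 : 0 < s) (hs1 : s < 1) {n : Euc N}
    (hn : ‖n‖ = 1) {d η κ : ℝ} (hη : 0 < η) (hd : η ≤ d) (hκ : 0 < κ) (hκ1 : κ ≤ 1)
    (hκη : κ ≤ η) :
    -(η ^ (s - 2) * ∫ z in closedBall (0 : Euc N) κ, kernelWeight s z * fracKernel s z) ≤
      ∫ z in (closedBall (0 : Euc N) κ)ᶜ,
        (posPow s d - posPow s (d + ⟪n, z⟫)) * fracKernel s z := by
  have hd0 : 0 < d := hη.trans_le hd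
  set f : Euc N → ℝ := fun z => (posPow s d - posPow s (d + ⟪n, z⟫)) * fracKernel s z with hf
  have hpp := continuous_posPow hs0
  have hin : ∀ z : Euc N, |(⟪n, z⟫ : ℝ)| ≤ ‖z‖ := fun z => by
    simpa [hn] using abs_real_inner_le_norm n z
  have hfi : IntegrableOn f (closedBall (0 : Euc N) κ)ᶜ := by
    refine integrableOn_mul_fracKernel hN hs0 hs1 hκ hκ1 (C := 1) ?_ zero_le_one fun z => ?_
    · exact (by fun_prop : Continuous fun z : Euc N =>
        posPow s d - posPow s (d + ⟪n, z⟫)).measurable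
    · have := abs_posPow_sub_le hs0 hs1 d (d + ⟪n, z⟫)
      rw [sub_add_cancel_left, abs_neg] at this
      linarith [abs_inner_rpow_le hs0 hn z]
  have hfi' : IntegrableOn (fun z => f (-z)) (closedBall (0 : Euc N) κ)ᶜ := by
    refine integrableOn_mul_fracKernel hN hs0 hs1 hκ hκ1 (C := 1)
      (f := fun z => posPow s d - posPow s (d + ⟪n, -z⟫)) ?_ zero_le_one (fun z => ?_) |>.congr ?_
    · exact (by fun_prop : Continuous fun z : Euc N =>
        posPow s d - posPow s (d + ⟪n, -z⟫)).measurable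
    · have := abs_posPow_sub_le hs0 hs1 d (d + ⟪n, -z⟫)
      rw [sub_add_cancel_left, abs_neg] at this
      have h2 := abs_inner_rpow_le hs0 hn (-z)
      rw [norm_neg] at h2
      linarith
    · exact Eventually.of_forall fun z => by simp only [hf, fracKernel_neg]
  have hS := integrable_posPowSecondDiff_inner hN hs0 hs1 hn hd0
  -- Symmetrising under `z ↦ -z` produces the second difference. Its integral over the whole space
  -- is nonnegative, so only the part over the small ball is lost.
  have hsum : 2 * ∫ z in (closedBall (0 : Euc N) κ)ᶜ, f z =
      ∫ z in (closedBall (0 : Euc N) κ)ᶜ, posPowSecondDiff s d ⟪n, z⟫ * fracKernel s z := by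
    rw [two_mul]
    nth_rewrite 2 [← setIntegral_compl_closedBall_neg]
    rw [← integral_add hfi hfi']
    refine integral_congr_ae (Eventually.of_forall fun z => ?_)
    simp only [hf, fracKernel_neg, inner_neg_right, posPowSecondDiff, ← sub_eq_add_neg]
    ring
  have hsplit := integral_add_compl (measurableSet_closedBall (x := (0 : Euc N)) (ε := κ)) hS
  have h0 := integral_posPowSecondDiff_inner_nonneg hN hs0 hs1 n hd0
  have hnear : ∫ z in closedBall (0 : Euc N) κ, posPowSecondDiff s d ⟪n, z⟫ * fracKernel s z ≤
      2 * η ^ (s - 2) * ∫ z in closedBall (0 : Euc N) κ, kernelWeight s z * fracKernel s z := by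
    rw [← integral_const_mul]
    refine setIntegral_mono_on hS.integrableOn
      ((integrable_kernelWeight_mul hN hs0 hs1).const_mul _).integrableOn
      measurableSet_closedBall fun z hz => ?_
    rw [mem_closedBall_zero_iff] at hz
    rw [← mul_assoc, kernelWeight_of_le_one hs1 (hz.trans hκ1)]
    refine mul_le_mul_of_nonneg_right ?_ (fracKernel_nonneg s z)
    refine (posPowSecondDiff_bounds hs0 hs1 hd0
      ((hin z).trans (hz.trans (hκη.trans hd)))).2.trans ?_
    have h1 : d ^ (s - 2) ≤ η ^ (s - 2) := Real.rpow_le_rpow_of_nonpos hη hd (by linarith)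
    rw [← sq_abs]
    gcongr
    exact hin z
  linarith

/-- The truncated profile `t ↦ min (t₊ˢ) (εˢ)`. -/
noncomputable def truncPow (s ε t : ℝ) : ℝ := min (posPow s t) (ε ^ s)

lemma truncPow_nonneg {ε : ℝ} (hε : 0 ≤ ε) (t : ℝ) : 0 ≤ truncPow s ε t :=
  le_min (posPow_nonneg s t) (Real.rpow_nonneg hε s)

lemma truncPow_le (ε t : ℝ) : truncPow s ε t ≤ ε ^ s := min_le_right _ _

lemma truncPow_mono (hs0 : 0 < s) (ε : ℝ) : Monotone (truncPow s ε) := fun _ _ h =>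
  min_le_min_right _ (posPow_mono hs0 h)

lemma continuous_truncPow (hs0 : 0 < s) (ε : ℝ) : Continuous (truncPow s ε) :=
  (continuous_posPow hs0).min continuous_const

lemma truncPow_of_le (hs0 : 0 < s) {ε t : ℝ} (hε : 0 ≤ ε) (h : t ≤ ε) :
    truncPow s ε t = posPow s t := by
  refine min_eq_left ?_
  rw [← posPow_of_nonneg hε]; exact posPow_mono hs0 h

lemma truncPow_of_ge (hs0 : 0 < s) {ε t : ℝ} (hε : 0 ≤ ε) (h : ε ≤ t) :
    truncPow s ε t = ε ^ s := by
  refine min_eq_right ?_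
  rw [← posPow_of_nonneg hε]; exact posPow_mono hs0 h

lemma truncPow_add_sub_le (hs0 : 0 < s) (hs1 : s < 1) (ε : ℝ) {a q : ℝ} (ha : a ≠ 0)
    (hq : 0 ≤ q) : truncPow s ε (a + q) - truncPow s ε a ≤ |a| ^ (s - 1) * q := by
  have h := posPow_add_le_add_mul hs0 hs1 ha hq
  have h2 : 0 ≤ |a| ^ (s - 1) * q := by positivity
  unfold truncPow
  rcases le_total (posPow s a) (ε ^ s) with h1 | h1
  · rw [min_eq_left h1]; linarith [min_le_left (posPow s (a + q)) (ε ^ s)]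
  · rw [min_eq_right h1]; linarith [min_le_right (posPow s (a + q)) (ε ^ s)]

/-- The gain from truncating the profile. -/
lemma le_integral_truncation_gain (hN : 0 < N) (hs0 : 0 < s) (hs1 : s < 1) {n : Euc N}
    (hn : ‖n‖ = 1) {d ε κ : ℝ} (hd : 0 < d) (hdε : d ≤ ε) (hκ : 0 < κ) (hκ1 : κ ≤ 1)
    (hκε : κ ≤ ε) :
    (2 ^ s - 1) * (4 ^ ((N : ℝ) + 2 * s))⁻¹ * volume.real (ball (0 : Euc N) 1) * ε ^ (-s) ≤
      ∫ z in (closedBall (0 : Euc N) κ)ᶜ,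
        (posPow s (d + ⟪n, z⟫) - truncPow s ε (d + ⟪n, z⟫)) * fracKernel s z := by
  have hε : 0 < ε := hd.trans_le hdε
  set f : Euc N → ℝ := fun z =>
    (posPow s (d + ⟪n, z⟫) - truncPow s ε (d + ⟪n, z⟫)) * fracKernel s z with hf
  have hpp := continuous_posPow hs0
  have htp := continuous_truncPow hs0 ε
  have hnn : ∀ t, 0 ≤ posPow s t - truncPow s ε t := fun t => sub_nonneg.2 (min_le_left _ _)
  have hint : IntegrableOn f (closedBall (0 : Euc N) κ)ᶜ := by
    refine integrableOn_mul_fracKernel hN hs0 hs1 hκ hκ1 (C := 1) ?_ zero_le_one fun z => ?_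
    · exact (by fun_prop : Continuous fun z : Euc N =>
        posPow s (d + ⟪n, z⟫) - truncPow s ε (d + ⟪n, z⟫)).measurable
    · rw [abs_of_nonneg (hnn _), one_mul, sub_le_comm]
      have h1 := abs_le.1 (abs_posPow_sub_le hs0 hs1 (d + ⟪n, z⟫) d)
      rw [add_sub_cancel_left] at h1
      have h2 := abs_inner_rpow_le hs0 hn z
      refine le_min (by linarith [Real.rpow_nonneg (norm_nonneg z) s]) ?_
      have h3 : posPow s d ≤ ε ^ s := by
        rw [← posPow_of_nonneg hε.le]; exact posPow_mono hs0 hdε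
      linarith
  -- On this ball the profile exceeds its truncation by at least `(2ˢ - 1) εˢ` and the kernel is at
  -- least `(4ε)^{-N-2s}`; with volume of order `ε^N` the product scales as `ε^{-s}`.
  have hball : ∀ z ∈ ball ((3 * ε) • n) ε, 2 * ε < (⟪n, z⟫ : ℝ) ∧ ‖z‖ ≤ 4 * ε := by
    intro z hz
    rw [mem_ball, dist_eq_norm] at hz
    have hin := abs_le.1 (abs_real_inner_le_norm n (z - (3 * ε) • n))
    rw [hn, one_mul, inner_sub_right, inner_smul_right, real_inner_self_eq_norm_sq, hn] at hin
    have hnorm : ‖(3 * ε) • n‖ = 3 * ε := by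
      rw [norm_smul, hn, mul_one, Real.norm_of_nonneg (by positivity)]
    have := norm_sub_norm_le z ((3 * ε) • n)
    constructor <;> linarith
  have hsub : ball ((3 * ε) • n) ε ⊆ (closedBall (0 : Euc N) κ)ᶜ := by
    intro z hz
    rw [mem_compl_iff, mem_closedBall_zero_iff, not_le]
    have h1 := (hball z hz).1
    have h2 := (abs_le.1 (abs_real_inner_le_norm n z)).2
    rw [hn, one_mul] at h2
    linarith
  have hvol : volume.real (ball ((3 * ε) • n) ε) = ε ^ (N : ℝ) * volume.real (ball (0 : Euc N) 1) := by
    rw [measureReal_def, Measure.addHaar_ball_of_pos _ _ hε, finrank_euclideanSpace_fin,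
      ENNReal.toReal_mul, ENNReal.toReal_ofReal (by positivity), Real.rpow_natCast,
      measureReal_def]
  calc _ = ∫ z in ball ((3 * ε) • n) ε, (2 ^ s - 1) * ε ^ s * ((4 * ε) ^ ((N : ℝ) + 2 * s))⁻¹ := by
        rw [setIntegral_const, smul_eq_mul, hvol, Real.mul_rpow (by norm_num) hε.le, mul_inv,
          ← Real.rpow_neg hε.le]
        have : ε ^ (-s) = ε ^ (N : ℝ) * (ε ^ s * ε ^ (-((N : ℝ) + 2 * s))) := by
          rw [← Real.rpow_add hε, ← Real.rpow_add hε]; congr 1; ring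
        rw [this]; ring
    _ ≤ ∫ z in ball ((3 * ε) • n) ε, f z := by
        refine setIntegral_mono_on (integrableOn_const measure_ball_lt_top.ne)
          (hint.mono_set hsub) measurableSet_ball fun z hz => ?_
        obtain ⟨h1, h2⟩ := hball z hz
        have hz0 : z ≠ 0 := by
          rintro rfl
          rw [inner_zero_right] at h1; linarith
        have h3 : (2 * ε) ^ s ≤ posPow s (d + ⟪n, z⟫) := by
          rw [← posPow_of_nonneg (by positivity)]; exact posPow_mono hs0 (by linarith)
        rw [Real.mul_rpow zero_le_two hε.le] at h3
        have h4 := fracKernel_anti hs0 hz0 h2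
        refine mul_le_mul ?_ h4 (by positivity) (hnn _)
        linarith [truncPow_le (s := s) ε (d + ⟪n, z⟫)]
    _ ≤ _ := setIntegral_mono_set hint
        (Eventually.of_forall fun z => mul_nonneg (hnn _) (fracKernel_nonneg s z))
        hsub.eventuallyLE

/-- The error from the curvature of the boundary. -/
lemma exists_integral_curvature_error_le (hN : 0 < N) (hs0 : 0 < s) (hs1 : s < 1) {R : ℝ}
    (hR : 0 < R) : ∃ C : ℝ, 0 ≤ C ∧ ∀ n : Euc N, ‖n‖ = 1 → ∀ d ε κ ρ : ℝ, 0 < d → 0 < ε → ε ≤ 1 →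
      0 < κ → κ ≤ 1 → R ≤ ρ →
      IntegrableOn (fun z : Euc N => (truncPow s ε (d + ⟪n, z⟫ + ‖z‖ ^ 2 / (2 * ρ)) -
        truncPow s ε (d + ⟪n, z⟫)) * fracKernel s z) (closedBall (0 : Euc N) κ)ᶜ ∧
      ∫ z in (closedBall (0 : Euc N) κ)ᶜ, (truncPow s ε (d + ⟪n, z⟫ + ‖z‖ ^ 2 / (2 * ρ)) -
        truncPow s ε (d + ⟪n, z⟫)) * fracKernel s z ≤ C := by
  obtain ⟨C₁, hC₁, h₁⟩ := exists_lintegral_hyperplane_singularity_le hN hs0 hs1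
  have hK : IntegrableOn (fun z : Euc N => 1 * fracKernel s z) (closedBall 0 1)ᶜ :=
    integrableOn_mul_fracKernel hN hs0 hs1 one_pos le_rfl measurable_const zero_le_one fun z => by
      simpa using Real.rpow_nonneg (norm_nonneg z) s
  set C₂ : ℝ≥0∞ := ∫⁻ z in (closedBall (0 : Euc N) 1)ᶜ, ENNReal.ofReal (fracKernel s z) with hC₂
  have hC₂top : C₂ ≠ ⊤ := by
    simp only [one_mul] at hK
    rw [hC₂, ← ofReal_integral_eq_lintegral_ofReal hK
      (Eventually.of_forall fun z => fracKernel_nonneg s z)]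
    exact ENNReal.ofReal_ne_top
  have hTop : ENNReal.ofReal (2 * R)⁻¹ * C₁ + C₂ ≠ ⊤ := by finiteness
  refine ⟨(ENNReal.ofReal (2 * R)⁻¹ * C₁ + C₂).toReal, ENNReal.toReal_nonneg,
    fun n hn d ε κ ρ hd hε hε1 hκ hκ1 hρ => ?_⟩
  have hρ0 : 0 < ρ := hR.trans_le hρ
  have htp := continuous_truncPow hs0 ε
  set e : Euc N → ℝ := fun z => truncPow s ε (d + ⟪n, z⟫ + ‖z‖ ^ 2 / (2 * ρ)) -
    truncPow s ε (d + ⟪n, z⟫) with he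
  have hem : Measurable e := (by fun_prop : Continuous e).measurable
  have he0 : ∀ z, 0 ≤ e z := fun z => sub_nonneg.2 (truncPow_mono hs0 ε (by
    have : 0 ≤ ‖z‖ ^ 2 / (2 * ρ) := by positivity
    linarith))
  have he1 : ∀ z, e z ≤ 1 := fun z => by
    have h1 := truncPow_le (s := s) ε (d + ⟪n, z⟫ + ‖z‖ ^ 2 / (2 * ρ))
    have h2 := truncPow_nonneg (s := s) hε.le (d + ⟪n, z⟫)
    have h3 : ε ^ s ≤ 1 := Real.rpow_le_one hε.le hε1 hs0.le
    simp only [he]; linarith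
  have hint : IntegrableOn (fun z : Euc N => e z * fracKernel s z) (closedBall 0 κ)ᶜ :=
    integrableOn_mul_fracKernel hN hs0 hs1 hκ hκ1 hem zero_le_one fun z => by
      rw [abs_of_nonneg (he0 z)]
      linarith [he1 z, Real.rpow_nonneg (norm_nonneg z) s]
  refine ⟨hint, ?_⟩
  rw [integral_eq_lintegral_of_nonneg_ae
    (Eventually.of_forall fun z => mul_nonneg (he0 z) (fracKernel_nonneg s z))
    hint.aestronglyMeasurable]
  refine ENNReal.toReal_mono hTop ?_
  have hk := measurable_fracKernel (N := N) s
  calc _ ≤ ∫⁻ z, ENNReal.ofReal (e z * fracKernel s z) :=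
        lintegral_mono' Measure.restrict_le_self le_rfl
    _ = (∫⁻ z in closedBall (0 : Euc N) 1, ENNReal.ofReal (e z * fracKernel s z)) +
        ∫⁻ z in (closedBall (0 : Euc N) 1)ᶜ, ENNReal.ofReal (e z * fracKernel s z) :=
        (lintegral_add_compl _ measurableSet_closedBall).symm
    _ ≤ _ := by
        refine add_le_add ?_ ?_
        · refine le_trans ?_ (mul_le_mul_right (h₁ n hn d hd) _)
          rw [← lintegral_const_mul _ (by fun_prop)]
          refine lintegral_mono fun z => ?_
          simp only
          -- On the singular hyperplane the majorant is `⊤`: there `z ≠ 0` because `d > 0`, so the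
          -- factor `|z|²` times the kernel is positive.
          rcases eq_or_ne (d + (⟪n, z⟫ : ℝ)) 0 with h0 | h0
          · rcases eq_or_ne z 0 with rfl | hz
            · simp at h0; exact absurd h0 hd.ne'
            · rw [h0, enorm_zero, ENNReal.zero_rpow_of_neg (by linarith), ENNReal.top_mul,
                ENNReal.mul_top]
              · exact le_top
              · exact (ENNReal.ofReal_pos.2 (by positivity)).ne'
              · refine (ENNReal.ofReal_pos.2 ?_).ne'
                have := norm_pos_iff.2 hz
                unfold fracKernel
                positivity
          · rw [Real.enorm_eq_ofReal_abs, ENNReal.ofReal_rpow_of_pos (abs_pos.2 h0),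
              ← ENNReal.ofReal_mul (by positivity), ← ENNReal.ofReal_mul (by positivity)]
            refine ENNReal.ofReal_le_ofReal ?_
            have hh := truncPow_add_sub_le hs0 hs1 ε h0 (q := ‖z‖ ^ 2 / (2 * ρ)) (by positivity)
            have hk0 := fracKernel_nonneg s z
            calc e z * fracKernel s z
                ≤ |d + (⟪n, z⟫ : ℝ)| ^ (s - 1) * (‖z‖ ^ 2 / (2 * ρ)) * fracKernel s z := by
                  gcongr
              _ ≤ |d + (⟪n, z⟫ : ℝ)| ^ (s - 1) * (‖z‖ ^ 2 / (2 * R)) * fracKernel s z := by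
                  gcongr
              _ = _ := by rw [div_eq_mul_inv]; ring
        · refine lintegral_mono fun z => ENNReal.ofReal_le_ofReal ?_
          exact mul_le_of_le_one_left (fracKernel_nonneg s z) (he1 z)

/-- The barrier outside the ball `B(c, ρ)`. -/
noncomputable def ballBarrier (s ε : ℝ) (c : Euc N) (ρ : ℝ) (y : Euc N) : ℝ :=
  truncPow s ε (‖y - c‖ - ρ)

lemma continuous_ballBarrier (hs0 : 0 < s) (ε : ℝ) (c : Euc N) (ρ : ℝ) :
    Continuous (ballBarrier s ε c ρ) :=
  (continuous_truncPow hs0 ε).comp (by fun_prop)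

/-- A rearrangement of `2 |u| |u + z| ≤ |u|² + |u + z|²`. It replaces the distance to a ball by the
distance to the tangent half-space, with a quadratic error. -/
lemma norm_add_le_of_inner {u z : Euc N} (hu : u ≠ 0) :
    ‖u + z‖ ≤ ‖u‖ + ⟪‖u‖⁻¹ • u, z⟫ + ‖z‖ ^ 2 / (2 * ‖u‖) := by
  have hp : 0 < ‖u‖ := norm_pos_iff.2 hu
  have h1 : ‖u + z‖ ^ 2 = ‖u‖ ^ 2 + 2 * ⟪u, z⟫ + ‖z‖ ^ 2 := norm_add_sq_real u z
  rw [inner_smul_left]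
  simp only [map_inv₀, RCLike.conj_to_real]
  have h2 : ‖u‖ + ‖u‖⁻¹ * ⟪u, z⟫ + ‖z‖ ^ 2 / (2 * ‖u‖) =
      (‖u + z‖ ^ 2 + ‖u‖ ^ 2) / (2 * ‖u‖) := by
    rw [h1]; field_simp; ring
  rw [h2, le_div_iff₀ (by positivity)]
  nlinarith [sq_nonneg (‖u + z‖ - ‖u‖)]

/-- The barrier is a strict supersolution near the ball, uniformly in the centre and, up to an error
that vanishes with the truncation radius, at all points at a positive distance from the ball. -/
theorem exists_ballBarrier_supersolution (hN : 0 < N) (hs0 : 0 < s) (hs1 : s < 1) {R : ℝ}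
    (hR : 0 < R) : ∃ ε : ℝ, 0 < ε ∧ ∀ (c x : Euc N) (ρ η κ : ℝ), R ≤ ρ → 0 < η →
      η ≤ ‖x - c‖ - ρ → ‖x - c‖ - ρ < ε → 0 < κ → κ ≤ 1 → κ ≤ η →
      1 - η ^ (s - 2) * ∫ z in closedBall (0 : Euc N) κ, kernelWeight s z * fracKernel s z ≤
        ∫ z in (closedBall (0 : Euc N) κ)ᶜ,
          (ballBarrier s ε c ρ x - ballBarrier s ε c ρ (x + z)) * fracKernel s z := by
  obtain ⟨C, hC, hcurv⟩ := exists_integral_curvature_error_le (N := N) hN hs0 hs1 hR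
  set c₂ : ℝ := (2 ^ s - 1) * (4 ^ ((N : ℝ) + 2 * s))⁻¹ * volume.real (ball (0 : Euc N) 1) with hc₂
  have hc₂pos : 0 < c₂ := by
    have h1 : (1 : ℝ) < 2 ^ s := Real.one_lt_rpow one_lt_two hs0
    have h2 : 0 < volume.real (ball (0 : Euc N) 1) :=
      ENNReal.toReal_pos (measure_ball_pos _ _ one_pos).ne' measure_ball_lt_top.ne
    have h3 : 0 < (2 : ℝ) ^ s - 1 := by linarith
    positivity
  -- `ε` is defined by `ε^{-s} = Q`, so that the truncation gain `c₂ Q` absorbs the curvature error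
  -- `C` and leaves `1`; `Q ≥ 1` ensures `ε ≤ 1`. This is not circular because `C` does not depend
  -- on `ε`.
  set Q : ℝ := max 1 ((1 + C) / c₂) with hQ
  have hQ1 : 1 ≤ Q := le_max_left _ _
  have hQ0 : 0 < Q := one_pos.trans_le hQ1
  set ε : ℝ := Q ^ (-s⁻¹) with hε_def
  have hε : 0 < ε := by positivity
  have hε1 : ε ≤ 1 := Real.rpow_le_one_of_one_le_of_nonpos hQ1 (by
    rw [Left.neg_nonpos_iff]; positivity)
  have hεs : ε ^ (-s) = Q := by
    rw [hε_def, ← Real.rpow_mul hQ0.le, neg_mul_neg, inv_mul_cancel₀ hs0.ne', Real.rpow_one]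
  refine ⟨ε, hε, fun c x ρ η κ hρ hη hd hdε hκ hκ1 hκη => ?_⟩
  set d : ℝ := ‖x - c‖ - ρ with hd_def
  have hd0 : 0 < d := hη.trans_le hd
  have hρ0 : 0 < ρ := hR.trans_le hρ
  have hu : 0 < ‖x - c‖ := by linarith
  have hu0 : x - c ≠ 0 := norm_pos_iff.1 hu
  set n : Euc N := ‖x - c‖⁻¹ • (x - c) with hn_def
  have hn : ‖n‖ = 1 := norm_smul_inv_norm hu0
  have hI1 := neg_le_integral_posPow_sub hN hs0 hs1 hn hη hd hκ hκ1 hκη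
  have hI2 := le_integral_truncation_gain hN hs0 hs1 hn hd0 hdε.le hκ hκ1 (by linarith)
  obtain ⟨hi3, hI3⟩ := hcurv n hn d ε κ ρ hd0 hε hε1 hκ hκ1 hρ
  rw [← hc₂, hεs] at hI2
  have hgain : 1 + C ≤ c₂ * Q := by
    rw [← div_le_iff₀' hc₂pos]; exact le_max_right _ _
  have htp := continuous_truncPow hs0 ε
  have hεs1 : ε ^ s ≤ 1 := Real.rpow_le_one hε.le hε1 hs0.le
  have hbd : ∀ t t', |truncPow s ε t - truncPow s ε t'| ≤ 1 := fun t t' => by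
    have h1 := truncPow_nonneg (s := s) hε.le t
    have h2 := truncPow_nonneg (s := s) hε.le t'
    rw [abs_le]
    constructor <;> linarith [truncPow_le (s := s) ε t, truncPow_le (s := s) ε t']
  have hone : ∀ z : Euc N, (1 : ℝ) ≤ 1 * (1 + ‖z‖ ^ s) := fun z => by
    linarith [Real.rpow_nonneg (norm_nonneg z) s]
  have hi0 : IntegrableOn (fun z : Euc N => (truncPow s ε d - truncPow s ε (d + ⟪n, z⟫)) *
      fracKernel s z) (closedBall 0 κ)ᶜ :=
    integrableOn_mul_fracKernel hN hs0 hs1 hκ hκ1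
      (by fun_prop : Continuous fun z : Euc N =>
        truncPow s ε d - truncPow s ε (d + ⟪n, z⟫)).measurable zero_le_one
      fun z => (hbd _ _).trans (hone z)
  have hiw : IntegrableOn (fun z : Euc N => (ballBarrier s ε c ρ x - ballBarrier s ε c ρ (x + z)) *
      fracKernel s z) (closedBall 0 κ)ᶜ := by
    have hb := continuous_ballBarrier hs0 ε c ρ
    exact integrableOn_mul_fracKernel hN hs0 hs1 hκ hκ1
      (by fun_prop : Continuous fun z : Euc N =>
        ballBarrier s ε c ρ x - ballBarrier s ε c ρ (x + z)).measurable zero_le_one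
      fun z => (hbd _ _).trans (hone z)
  have hpp := continuous_posPow hs0
  have hi1 : IntegrableOn (fun z : Euc N => (posPow s d - posPow s (d + ⟪n, z⟫)) *
      fracKernel s z) (closedBall 0 κ)ᶜ := by
    refine integrableOn_mul_fracKernel hN hs0 hs1 hκ hκ1
      (by fun_prop : Continuous fun z : Euc N =>
        posPow s d - posPow s (d + ⟪n, z⟫)).measurable zero_le_one fun z => ?_
    have := abs_posPow_sub_le hs0 hs1 d (d + ⟪n, z⟫)
    rw [sub_add_cancel_left, abs_neg] at this
    linarith [abs_inner_rpow_le hs0 hn z]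
  have hi2 : IntegrableOn (fun z : Euc N => (posPow s (d + ⟪n, z⟫) - truncPow s ε (d + ⟪n, z⟫)) *
      fracKernel s z) (closedBall 0 κ)ᶜ := by
    refine (hi0.sub hi1).congr (Eventually.of_forall fun z => ?_)
    simp only [Pi.sub_apply, truncPow_of_le hs0 hε.le hdε.le]
    ring
  -- The increment of the barrier is bounded below by half-space profile, plus truncation gain,
  -- minus curvature error.
  have hmono : ∫ z in (closedBall (0 : Euc N) κ)ᶜ,
      ((posPow s d - posPow s (d + ⟪n, z⟫)) * fracKernel s z +
        (posPow s (d + ⟪n, z⟫) - truncPow s ε (d + ⟪n, z⟫)) * fracKernel s z -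
        (truncPow s ε (d + ⟪n, z⟫ + ‖z‖ ^ 2 / (2 * ρ)) -
          truncPow s ε (d + ⟪n, z⟫)) * fracKernel s z) ≤
      ∫ z in (closedBall (0 : Euc N) κ)ᶜ,
        (ballBarrier s ε c ρ x - ballBarrier s ε c ρ (x + z)) * fracKernel s z := by
    refine integral_mono ((hi1.add hi2).sub hi3) hiw fun z => ?_
    simp only
    rw [← add_mul, ← sub_mul]
    refine mul_le_mul_of_nonneg_right ?_ (fracKernel_nonneg s z)
    have h1 : ballBarrier s ε c ρ x = posPow s d := truncPow_of_le hs0 hε.le hdε.le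
    have h2 : ballBarrier s ε c ρ (x + z) ≤
        truncPow s ε (d + ⟪n, z⟫ + ‖z‖ ^ 2 / (2 * ρ)) := by
      refine truncPow_mono hs0 ε ?_
      have h3 := norm_add_le_of_inner (z := z) hu0
      rw [show x - c + z = x + z - c by abel] at h3
      have h4 : ‖z‖ ^ 2 / (2 * ‖x - c‖) ≤ ‖z‖ ^ 2 / (2 * ρ) := by
        gcongr; linarith
      linarith
    rw [h1]; linarith
  have e1 := integral_sub (hi1.add hi2) hi3
  simp only [Pi.add_apply] at e1
  rw [e1, integral_add hi1 hi2] at hmono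
  linarith

end Barrier

/-! ### The energy form, barriers of infinite total energy, and the Poincaré inequality. -/

section EnergyForm

open Set Filter Topology Metric
open scoped ENNReal RealInnerProductSpace

variable {N : ℕ} {s : ℝ} {Ω : Set (Euc N)} {u v φ w : Euc N → ℝ}

/-- The integrand of the energy form. -/
noncomputable def pairDensity (s : ℝ) (u v : Euc N → ℝ) (p : Euc N × Euc N) : ℝ :=
  (u p.1 - u p.2) * (v p.1 - v p.2) * fracKernel s (p.1 - p.2)

lemma fracLaplacianPairing_eq (s : ℝ) (u v : Euc N → ℝ) :
    fracLaplacianPairing s u v = ∫ p, pairDensity s u v p ∂(volume.prod volume) := rfl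

lemma fracLaplacianPairing_comm (s : ℝ) (u v : Euc N → ℝ) :
    fracLaplacianPairing s u v = fracLaplacianPairing s v u := by
  rw [fracLaplacianPairing_eq, fracLaplacianPairing_eq]
  congr 1; ext p; unfold pairDensity; ring

lemma pairDensity_self (s : ℝ) (u : Euc N → ℝ) (p : Euc N × Euc N) :
    pairDensity s u u p = (u p.1 - u p.2) ^ 2 * fracKernel s (p.1 - p.2) := by
  unfold pairDensity; ring

lemma pairDensity_self_nonneg (s : ℝ) (u : Euc N → ℝ) (p : Euc N × Euc N) :
    0 ≤ pairDensity s u u p := by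
  rw [pairDensity_self]; exact mul_nonneg (sq_nonneg _) (fracKernel_nonneg _ _)

lemma abs_pairDensity_le (s : ℝ) (u v : Euc N → ℝ) (p : Euc N × Euc N) :
    |pairDensity s u v p| ≤ pairDensity s u u p + pairDensity s v v p := by
  rw [pairDensity_self, pairDensity_self, ← add_mul, pairDensity, abs_mul, abs_mul,
    abs_of_nonneg (fracKernel_nonneg s (p.1 - p.2))]
  refine mul_le_mul_of_nonneg_right ?_ (fracKernel_nonneg _ _)
  rw [← sq_abs (u p.1 - u p.2), ← sq_abs (v p.1 - v p.2)]
  nlinarith [two_mul_le_add_sq |u p.1 - u p.2| |v p.1 - v p.2|, abs_nonneg (u p.1 - u p.2),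
    abs_nonneg (v p.1 - v p.2), mul_nonneg (abs_nonneg (u p.1 - u p.2)) (abs_nonneg (v p.1 - v p.2))]

lemma aestronglyMeasurable_comp_fst (hu : AEStronglyMeasurable u volume) :
    AEStronglyMeasurable (fun p : Euc N × Euc N => u p.1) (volume.prod volume) :=
  hu.comp_quasiMeasurePreserving Measure.quasiMeasurePreserving_fst

lemma aestronglyMeasurable_comp_snd (hu : AEStronglyMeasurable u volume) :
    AEStronglyMeasurable (fun p : Euc N × Euc N => u p.2) (volume.prod volume) :=
  hu.comp_quasiMeasurePreserving Measure.quasiMeasurePreserving_snd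

lemma measurable_fracKernel_sub (s : ℝ) :
    Measurable fun p : Euc N × Euc N => fracKernel s (p.1 - p.2) :=
  (measurable_fracKernel s).comp (measurable_fst.sub measurable_snd)

lemma aestronglyMeasurable_pairDensity (hu : AEStronglyMeasurable u volume)
    (hv : AEStronglyMeasurable v volume) :
    AEStronglyMeasurable (pairDensity s u v) (volume.prod volume) :=
  (((aestronglyMeasurable_comp_fst hu).sub (aestronglyMeasurable_comp_snd hu)).mul
    ((aestronglyMeasurable_comp_fst hv).sub (aestronglyMeasurable_comp_snd hv))).mul
    (measurable_fracKernel_sub s).aestronglyMeasurable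

lemma MemX0.integrable_pairDensity_self (hu : MemX0 s Ω u) :
    Integrable (pairDensity s u u) (volume.prod volume) := by
  refine hu.energy.congr (Eventually.of_forall fun p => ?_)
  simp only [sq_abs, pairDensity_self, fracKernel, div_eq_mul_inv]

lemma memX0_of_pairDensity (h1 : MemLp u 2 volume) (h2 : ∀ᵐ x ∂volume, x ∉ Ω → u x = 0)
    (h3 : Integrable (pairDensity s u u) (volume.prod volume)) : MemX0 s Ω u := by
  refine ⟨h1, h2, h3.congr (Eventually.of_forall fun p => ?_)⟩
  simp only [sq_abs, pairDensity_self, fracKernel, div_eq_mul_inv]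

lemma MemX0.aestronglyMeasurable (hu : MemX0 s Ω u) : AEStronglyMeasurable u volume := hu.memLp.1

lemma MemX0.integrable_pairDensity (hu : MemX0 s Ω u) (hv : MemX0 s Ω v) :
    Integrable (pairDensity s u v) (volume.prod volume) :=
  Integrable.mono' (hu.integrable_pairDensity_self.add hv.integrable_pairDensity_self)
    (aestronglyMeasurable_pairDensity hu.aestronglyMeasurable hv.aestronglyMeasurable)
    (Eventually.of_forall fun p => abs_pairDensity_le s u v p)

lemma MemX0.sub (hu : MemX0 s Ω u) (hv : MemX0 s Ω v) : MemX0 s Ω (fun x => u x - v x) := by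
  refine memX0_of_pairDensity (hu.memLp.sub hv.memLp) ?_ ?_
  · filter_upwards [hu.ae_eq_zero, hv.ae_eq_zero] with x h1 h2 hx
    rw [h1 hx, h2 hx, sub_zero]
  · refine ((hu.integrable_pairDensity_self.sub ((hu.integrable_pairDensity hv).const_mul 2)).add
      hv.integrable_pairDensity_self).congr (Eventually.of_forall fun p => ?_)
    simp only [Pi.add_apply, Pi.sub_apply, pairDensity]; ring

lemma MemX0.const_mul (c : ℝ) (hu : MemX0 s Ω u) : MemX0 s Ω (fun x => c * u x) := by
  refine memX0_of_pairDensity (hu.memLp.const_mul c) ?_ ?_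
  · filter_upwards [hu.ae_eq_zero] with x h1 hx
    rw [h1 hx, mul_zero]
  · refine (hu.integrable_pairDensity_self.const_mul (c ^ 2)).congr
      (Eventually.of_forall fun p => ?_)
    simp only [pairDensity]; ring

lemma fracLaplacianPairing_sub_left (hu : MemX0 s Ω u) (hv : MemX0 s Ω v) (hw : MemX0 s Ω w) :
    fracLaplacianPairing s (fun x => u x - v x) w =
      fracLaplacianPairing s u w - fracLaplacianPairing s v w := by
  simp only [fracLaplacianPairing_eq]
  rw [← integral_sub (hu.integrable_pairDensity hw) (hv.integrable_pairDensity hw)]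
  congr 1; ext p; simp only [pairDensity]; ring

lemma fracLaplacianPairing_const_mul_left (s c : ℝ) (u v : Euc N → ℝ) :
    fracLaplacianPairing s (fun x => c * u x) v = c * fracLaplacianPairing s u v := by
  simp only [fracLaplacianPairing_eq]
  rw [← integral_const_mul]
  congr 1; ext p; simp only [pairDensity]; ring

lemma ae_prod_of_ae {P : Euc N → Prop} (h : ∀ᵐ x ∂volume, P x) :
    ∀ᵐ p : Euc N × Euc N ∂(volume.prod volume), P p.1 ∧ P p.2 :=
  (Measure.quasiMeasurePreserving_fst.ae h).and (Measure.quasiMeasurePreserving_snd.ae h)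

lemma MemX0.integrable (hΩ : MeasurableSet Ω) (hΩfin : volume Ω ≠ ⊤) (hu : MemX0 s Ω u) :
    Integrable u volume := by
  have h1 : IntegrableOn u Ω := by
    have : Fact (volume Ω < ⊤) := ⟨hΩfin.lt_top⟩
    exact (hu.memLp.restrict Ω).integrable one_le_two
  refine ((integrable_indicator_iff hΩ).2 h1).congr ?_
  filter_upwards [hu.ae_eq_zero] with x hx
  by_cases h : x ∈ Ω
  · rw [indicator_of_mem h]
  · rw [indicator_of_notMem h, hx h]

lemma integral_eq_setIntegral_of_ae_eq_zero {f : Euc N → ℝ} (hΩ : MeasurableSet Ω)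
    (h : ∀ᵐ x ∂volume, x ∉ Ω → f x = 0) : ∫ x, f x = ∫ x in Ω, f x := by
  rw [← integral_indicator hΩ]
  refine integral_congr_ae ?_
  filter_upwards [h] with x hx
  by_cases h : x ∈ Ω
  · rw [indicator_of_mem h]
  · rw [indicator_of_notMem h, hx h]

/-- A product integrability criterion for convolution-type integrands. -/
lemma integrable_mul_comp_sub {f g : Euc N → ℝ} (hf : Integrable f) (hg : Integrable g) :
    Integrable (fun p : Euc N × Euc N => f p.2 * g (p.1 - p.2)) (volume.prod volume) := by
  simpa using Integrable.convolution_integrand (ContinuousLinearMap.mul ℝ ℝ) hf hg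

lemma integrable_mul_comp_sub' {f g : Euc N → ℝ} (hf : Integrable f) (hg : Integrable g)
    (hge : ∀ z, g (-z) = g z) :
    Integrable (fun p : Euc N × Euc N => f p.1 * g (p.1 - p.2)) (volume.prod volume) := by
  refine (integrable_mul_comp_sub hf hg).swap.congr (Eventually.of_forall fun p => ?_)
  simp only [Function.comp, Prod.fst_swap, Prod.snd_swap]
  rw [← hge, neg_sub]

/-- The integrable majorant of the energy density of functions that are Lipschitz near `Ω`. -/
noncomputable def lipMajorant (s : ℝ) (Ω : Set (Euc N)) (p : Euc N × Euc N) : ℝ :=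
  (Ω.indicator 1 p.1 + Ω.indicator 1 p.2) *
    (min (‖p.1 - p.2‖ ^ 2) 1 * fracKernel s (p.1 - p.2))

lemma integrable_min_sq_one_mul_fracKernel (hN : 0 < N) (hs0 : 0 < s) (hs1 : s < 1) :
    Integrable fun z : Euc N => min (‖z‖ ^ 2) 1 * fracKernel s z := by
  refine Integrable.mono' (integrable_kernelWeight_mul hN hs0 hs1)
    ((by fun_prop : Measurable fun z : Euc N => min (‖z‖ ^ 2) (1 : ℝ)).mul
      (measurable_fracKernel s)).aestronglyMeasurable (Eventually.of_forall fun z => ?_)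
  rw [Real.norm_of_nonneg (mul_nonneg (by positivity) (fracKernel_nonneg s z))]
  exact mul_le_mul_of_nonneg_right (min_sq_one_le_kernelWeight hs0 hs1 z) (fracKernel_nonneg s z)

lemma integrable_lipMajorant (hN : 0 < N) (hs0 : 0 < s) (hs1 : s < 1) (hΩ : MeasurableSet Ω)
    (hΩfin : volume Ω ≠ ⊤) : Integrable (lipMajorant s Ω) (volume.prod volume) := by
  have h1 : Integrable (Ω.indicator (1 : Euc N → ℝ)) :=
    (integrable_indicator_iff hΩ).2 (integrableOn_const hΩfin)
  have h2 := integrable_min_sq_one_mul_fracKernel (N := N) hN hs0 hs1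
  refine ((integrable_mul_comp_sub' h1 h2 fun z => ?_).add (integrable_mul_comp_sub h1 h2)).congr
    (Eventually.of_forall fun p => ?_)
  · rw [norm_neg, fracKernel_neg]
  · simp only [Pi.add_apply, lipMajorant]; ring

/-- Bounded nonnegative functions that are Lipschitz near `Ω`: the class of barriers. -/
structure IsBarrier (Ω : Set (Euc N)) (w : Euc N → ℝ) : Prop where
  measurable : Measurable w
  nonneg : ∀ x, 0 ≤ w x
  bounded : ∃ M, ∀ x, w x ≤ M
  lipschitz : ∃ C, 0 ≤ C ∧ ∀ x ∈ Ω, ∀ y, (w x - w y) ^ 2 ≤ C * min (‖x - y‖ ^ 2) 1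

lemma IsBarrier.const_mul {c : ℝ} (hc : 0 ≤ c) (hw : IsBarrier Ω w) :
    IsBarrier Ω (fun x => c * w x) := by
  obtain ⟨M, hM⟩ := hw.bounded
  obtain ⟨C, hC, h⟩ := hw.lipschitz
  refine ⟨hw.measurable.const_mul c, fun x => mul_nonneg hc (hw.nonneg x),
    ⟨c * M, fun x => mul_le_mul_of_nonneg_left (hM x) hc⟩, c ^ 2 * C, by positivity,
    fun x hx y => ?_⟩
  rw [← mul_sub, mul_pow, mul_assoc]
  exact mul_le_mul_of_nonneg_left (h x hx y) (sq_nonneg c)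

lemma IsBarrier.exists_pairDensity_self_le (hw : IsBarrier Ω w) :
    ∃ C, 0 ≤ C ∧ ∀ p : Euc N × Euc N, p.1 ∈ Ω ∨ p.2 ∈ Ω →
      pairDensity s w w p ≤ C * lipMajorant s Ω p := by
  obtain ⟨C, hC, h⟩ := hw.lipschitz
  refine ⟨C, hC, fun p hp => ?_⟩
  have h1 : (w p.1 - w p.2) ^ 2 ≤ C * min (‖p.1 - p.2‖ ^ 2) 1 := by
    rcases hp with hp | hp
    · exact h _ hp _
    · rw [← neg_sub, neg_sq, norm_sub_rev]; exact h _ hp _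
  have h2 : (1 : ℝ) ≤ Ω.indicator 1 p.1 + Ω.indicator 1 p.2 := by
    have ha : ∀ x, (0 : ℝ) ≤ Ω.indicator 1 x := fun x => indicator_nonneg (fun _ _ => zero_le_one) x
    rcases hp with hp | hp
    · rw [indicator_of_mem hp]; simpa using ha p.2
    · rw [indicator_of_mem hp]; simpa using ha p.1
  have hk := fracKernel_nonneg s (p.1 - p.2)
  rw [pairDensity_self, lipMajorant]
  calc _ ≤ C * min (‖p.1 - p.2‖ ^ 2) 1 * fracKernel s (p.1 - p.2) := by gcongr
    _ = C * (1 * (min (‖p.1 - p.2‖ ^ 2) 1 * fracKernel s (p.1 - p.2))) := by ring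
    _ ≤ _ := by gcongr

/-- A barrier need not have finite energy on the whole space, but `v` vanishes off `Ω`, so only
pairs with a point in `Ω` count, and on these the barrier is Lipschitz. -/
lemma IsBarrier.integrable_pairDensity (hN : 0 < N) (hs0 : 0 < s) (hs1 : s < 1)
    (hΩ : MeasurableSet Ω) (hΩfin : volume Ω ≠ ⊤) (hw : IsBarrier Ω w) (hv : MemX0 s Ω v) :
    Integrable (pairDensity s w v) (volume.prod volume) := by
  obtain ⟨C, hC, h⟩ := hw.exists_pairDensity_self_le (s := s)
  refine Integrable.mono' (((integrable_lipMajorant hN hs0 hs1 hΩ hΩfin).const_mul C).add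
    hv.integrable_pairDensity_self) (aestronglyMeasurable_pairDensity
      hw.measurable.aestronglyMeasurable hv.aestronglyMeasurable) ?_
  filter_upwards [ae_prod_of_ae hv.ae_eq_zero] with p hp
  rw [Real.norm_eq_abs]
  by_cases hm : p.1 ∈ Ω ∨ p.2 ∈ Ω
  · exact (abs_pairDensity_le s w v p).trans (add_le_add (h p hm) le_rfl)
  · push Not at hm
    have h0 : pairDensity s w v p = 0 := by
      rw [pairDensity, hp.1 hm.1, hp.2 hm.2]; simp
    have h1 : 0 ≤ lipMajorant s Ω p := by
      unfold lipMajorant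
      rw [indicator_of_notMem hm.1, indicator_of_notMem hm.2]; simp
    rw [h0, abs_zero]
    exact add_nonneg (mul_nonneg hC h1) (pairDensity_self_nonneg s v p)

/-- Makes `(φ - w)₊` an admissible test function: it vanishes outside `Ω` because `w ≥ 0`, and its
energy density is controlled by those of `φ` and `w` on pairs that meet `Ω`. -/
lemma MemX0.posPart_sub (hN : 0 < N) (hs0 : 0 < s) (hs1 : s < 1)
    (hΩ : MeasurableSet Ω) (hΩfin : volume Ω ≠ ⊤) (hφ : MemX0 s Ω φ) (hw : IsBarrier Ω w) :
    MemX0 s Ω (fun x => max (φ x - w x) 0) := by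
  have hm : AEStronglyMeasurable (fun x => max (φ x - w x) 0) volume :=
    (hφ.aestronglyMeasurable.sub hw.measurable.aestronglyMeasurable).sup
      aestronglyMeasurable_const
  have hz : ∀ᵐ x ∂volume, x ∉ Ω → max (φ x - w x) 0 = 0 := by
    filter_upwards [hφ.ae_eq_zero] with x hx hxΩ
    rw [hx hxΩ]
    exact max_eq_right (by linarith [hw.nonneg x])
  refine memX0_of_pairDensity (hφ.memLp.mono hm (Eventually.of_forall fun x => ?_)) hz ?_
  · rw [Real.norm_of_nonneg (le_max_right _ _), Real.norm_eq_abs]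
    exact max_le (by linarith [le_abs_self (φ x), hw.nonneg x]) (abs_nonneg _)
  obtain ⟨C, hC, h⟩ := hw.exists_pairDensity_self_le (s := s)
  refine Integrable.mono' ((hφ.integrable_pairDensity_self.const_mul 2).add
    ((integrable_lipMajorant hN hs0 hs1 hΩ hΩfin).const_mul (2 * C)))
    (aestronglyMeasurable_pairDensity hm hm) ?_
  filter_upwards [ae_prod_of_ae hz] with p hp
  rw [Real.norm_of_nonneg (pairDensity_self_nonneg _ _ _)]
  simp only [Pi.add_apply]
  by_cases hmem : p.1 ∈ Ω ∨ p.2 ∈ Ω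
  · have h1 := h p hmem
    have h2 : pairDensity s (fun x => max (φ x - w x) 0) (fun x => max (φ x - w x) 0) p ≤
        2 * pairDensity s φ φ p + 2 * pairDensity s w w p := by
      simp only [pairDensity_self]
      rw [← mul_assoc, ← mul_assoc, ← add_mul]
      refine mul_le_mul_of_nonneg_right ?_ (fracKernel_nonneg _ _)
      have h3 := abs_max_sub_max_le_abs (φ p.1 - w p.1) (φ p.2 - w p.2) 0
      have h4 := sq_le_sq.2 h3
      nlinarith [sq_nonneg ((φ p.1 - φ p.2) + (w p.1 - w p.2))]
    linarith
  · push Not at hmem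
    have h0 : pairDensity s (fun x => max (φ x - w x) 0) (fun x => max (φ x - w x) 0) p = 0 := by
      rw [pairDensity_self, hp.1 hmem.1, hp.2 hmem.2]; simp
    have h1 : lipMajorant s Ω p = 0 := by
      unfold lipMajorant
      rw [indicator_of_notMem hmem.1, indicator_of_notMem hmem.2]; simp
    rw [h0, h1, mul_zero, add_zero]
    exact mul_nonneg zero_le_two (pairDensity_self_nonneg s φ p)

/-- A reference ball outside a bounded set. -/
lemma exists_exterior_ball_of_isBounded (hN : 0 < N) (hΩ : Bornology.IsBounded Ω) :
    ∃ (q : Euc N) (M : ℝ), 0 < M ∧ ∀ x ∈ Ω, ∀ y ∈ ball q 1, 1 ≤ ‖x - y‖ ∧ ‖x - y‖ ≤ M := by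
  have : Nonempty (Fin N) := ⟨⟨0, hN⟩⟩
  obtain ⟨ρ, hρ0, hρ⟩ := hΩ.subset_closedBall_lt 0 0
  obtain ⟨q, hq⟩ := NormedSpace.exists_lt_norm ℝ (Euc N) (ρ + 2)
  refine ⟨q, ‖q‖ + 1 + ρ, by positivity, fun x hx y hy => ?_⟩
  have h1 := hρ hx
  rw [mem_closedBall_zero_iff] at h1
  rw [mem_ball, dist_eq_norm] at hy
  have h2 := norm_sub_norm_le q (q - y)
  rw [sub_sub_cancel, ← norm_sub_rev y q] at h2
  have h3 := norm_sub_norm_le y x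
  have h4 := norm_sub_le x y
  have h5 := norm_sub_norm_le y q
  rw [← norm_sub_rev x y] at h3
  constructor <;> linarith

lemma volume_ball_one_pos (q : Euc N) : 0 < volume.real (ball q 1) :=
  ENNReal.toReal_pos (measure_ball_pos _ _ one_pos).ne' measure_ball_lt_top.ne

/-- The fractional Poincaré inequality. -/
theorem exists_poincare (hN : 0 < N) (hs0 : 0 < s) (hΩ : MeasurableSet Ω)
    (hΩb : Bornology.IsBounded Ω) :
    ∃ C : ℝ, 0 < C ∧ ∀ u, MemX0 s Ω u → ∫ x, u x ^ 2 ≤ C * fracLaplacianPairing s u u := by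
  obtain ⟨q, M, hM, hq⟩ := exists_exterior_ball_of_isBounded hN hΩb
  set k : ℝ := (M ^ ((N : ℝ) + 2 * s))⁻¹ with hk
  have hk0 : 0 < k := by positivity
  have hv := volume_ball_one_pos q
  refine ⟨(k * volume.real (ball q 1))⁻¹, by positivity, fun u hu => ?_⟩
  rw [inv_mul_eq_div, le_div_iff₀ (by positivity), integral_eq_setIntegral_of_ae_eq_zero hΩ
    (by filter_upwards [hu.ae_eq_zero] with x hx h; rw [hx h]; ring)]
  have hu2 : Integrable fun x => u x ^ 2 := hu.memLp.integrable_sq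
  have hprod := Integrable.mul_prod (f := Ω.indicator fun x => u x ^ 2)
    (g := (ball q 1).indicator fun _ => k) (hu2.indicator hΩ)
    ((integrable_indicator_iff measurableSet_ball).2
      (integrableOn_const (measure_ball_lt_top (μ := volume)).ne))
  have hint := integral_prod_mul (μ := (volume : Measure (Euc N))) (ν := (volume : Measure (Euc N)))
    (Ω.indicator fun x => u x ^ 2) ((ball q 1).indicator fun _ => k)
  rw [integral_indicator hΩ, integral_indicator measurableSet_ball, setIntegral_const,
    smul_eq_mul, mul_comm (volume.real _) k] at hint
  rw [← hint, fracLaplacianPairing_eq]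
  -- The energy is restricted to `Ω × B(q, 1)`, where `u(y) = 0` and the kernel is at least `k`, as
  -- the distances lie between `1` and `M`.
  refine integral_mono_ae hprod hu.integrable_pairDensity_self ?_
  filter_upwards [ae_prod_of_ae hu.ae_eq_zero] with p hp
  by_cases h1 : p.1 ∈ Ω
  · by_cases h2 : p.2 ∈ ball q 1
    · obtain ⟨h3, h4⟩ := hq _ h1 _ h2
      have h5 : p.2 ∉ Ω := fun h => by
        have := (hq _ h _ h2).1
        rw [sub_self, norm_zero] at this
        linarith
      rw [indicator_of_mem h1, indicator_of_mem h2, pairDensity_self, hp.2 h5, sub_zero]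
      refine mul_le_mul_of_nonneg_left ?_ (sq_nonneg _)
      refine fracKernel_anti hs0 (fun h => ?_) h4
      rw [h, norm_zero] at h3; linarith
    · rw [indicator_of_notMem h2, mul_zero]; exact pairDensity_self_nonneg _ _ _
  · rw [indicator_of_notMem h1, zero_mul]; exact pairDensity_self_nonneg _ _ _

end EnergyForm

/-! ### Weak comparison with barriers, and the uniform bound. -/

section Comparison

open Set Filter Topology Metric
open scoped ENNReal RealInnerProductSpace

variable {N : ℕ} {s : ℝ} {Ω : Set (Euc N)} {u v φ w : Euc N → ℝ}

/-- The kernel truncated near the origin. -/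
noncomputable def truncKernel (s κ : ℝ) : Euc N → ℝ :=
  (closedBall (0 : Euc N) κ)ᶜ.indicator (fracKernel s)

lemma truncKernel_neg (s κ : ℝ) (z : Euc N) : truncKernel s κ (-z) = truncKernel s κ z := by
  simp [truncKernel, indicator, fracKernel_neg]

lemma integrable_truncKernel (hN : 0 < N) (hs0 : 0 < s) (hs1 : s < 1) {κ : ℝ} (hκ : 0 < κ)
    (hκ1 : κ ≤ 1) : Integrable (truncKernel s κ : Euc N → ℝ) := by
  refine (integrable_indicator_iff measurableSet_closedBall.compl).2 ?_
  simpa using integrableOn_mul_fracKernel hN hs0 hs1 hκ hκ1 (f := fun _ : Euc N => (1 : ℝ))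
    measurable_const zero_le_one fun z => by simpa using Real.rpow_nonneg (norm_nonneg z) s

lemma measurable_truncKernel (s κ : ℝ) : Measurable (truncKernel s κ : Euc N → ℝ) :=
  (measurable_fracKernel s).indicator measurableSet_closedBall.compl

/-- The truncated energy form of a bounded function against an integrable function. -/
lemma integral_truncated_pairDensity (hN : 0 < N) (hs0 : 0 < s) (hs1 : s < 1) {κ : ℝ} (hκ : 0 < κ)
    (hκ1 : κ ≤ 1) (hw : IsBarrier Ω w) (hv : Integrable v) :
    Integrable (fun x => v x * ∫ z in (closedBall (0 : Euc N) κ)ᶜ,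
      (w x - w (x + z)) * fracKernel s z) ∧
    ∫ p : Euc N × Euc N, (w p.1 - w p.2) * (v p.1 - v p.2) * truncKernel s κ (p.1 - p.2)
      ∂(volume.prod volume) =
    2 * ∫ x, v x * ∫ z in (closedBall (0 : Euc N) κ)ᶜ, (w x - w (x + z)) * fracKernel s z := by
  obtain ⟨M, hM⟩ := hw.bounded
  have hk := integrable_truncKernel (N := N) hN hs0 hs1 hκ hκ1
  set f : Euc N × Euc N → ℝ :=
    fun p => (w p.1 - w p.2) * (v p.1 * truncKernel s κ (p.1 - p.2)) with hf
  have hfi : Integrable f (volume.prod volume) := by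
    refine (integrable_mul_comp_sub' hv hk (truncKernel_neg s κ)).bdd_mul (c := M)
      ((hw.measurable.comp measurable_fst).sub
        (hw.measurable.comp measurable_snd)).aestronglyMeasurable
      (Eventually.of_forall fun p => ?_)
    rw [Real.norm_eq_abs, abs_le]
    constructor <;> linarith [hM p.1, hM p.2, hw.nonneg p.1, hw.nonneg p.2]
  have hinner : ∀ x, ∫ y, f (x, y) =
      v x * ∫ z in (closedBall (0 : Euc N) κ)ᶜ, (w x - w (x + z)) * fracKernel s z := by
    intro x
    rw [← integral_add_left_eq_self (fun y => f (x, y)) x,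
      ← integral_indicator measurableSet_closedBall.compl, ← integral_const_mul]
    refine integral_congr_ae (Eventually.of_forall fun z => ?_)
    simp only [hf]
    rw [show x - (x + z) = -z by abel, truncKernel_neg, truncKernel]
    by_cases hz : z ∈ (closedBall (0 : Euc N) κ)ᶜ
    · rw [indicator_of_mem hz, indicator_of_mem hz]; ring
    · rw [indicator_of_notMem hz, indicator_of_notMem hz]; ring
  refine ⟨hfi.integral_prod_left.congr (Eventually.of_forall hinner), ?_⟩
  -- The truncated energy density is `f + f ∘ swap`. Both halves are integrable separately because
  -- the cut-off kernel is, whence the factor `2`.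
  have hswap : ∫ p, f p.swap ∂((volume : Measure (Euc N)).prod volume) =
      ∫ p, f p ∂(volume.prod volume) := integral_prod_swap f
  have hsum : ∫ p : Euc N × Euc N,
      (w p.1 - w p.2) * (v p.1 - v p.2) * truncKernel s κ (p.1 - p.2) ∂(volume.prod volume) =
      ∫ p, (f p + f p.swap) ∂(volume.prod volume) := by
    congr 1; ext p
    simp only [hf, Prod.fst_swap, Prod.snd_swap]
    rw [← truncKernel_neg s κ (p.2 - p.1), neg_sub]; ring
  have hfs : Integrable (fun p : Euc N × Euc N => f p.swap) (volume.prod volume) := hfi.swap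
  rw [hsum, integral_add hfi hfs, hswap, integral_prod _ hfi, two_mul]
  simp only [hinner]

/-- Pointwise supersolutions, in the sense of truncated singular integrals, are weak
supersolutions. -/
theorem integral_le_pairing_of_truncated (hN : 0 < N) (hs0 : 0 < s) (hs1 : s < 1)
    (hΩ : MeasurableSet Ω) (hΩfin : volume Ω ≠ ⊤) (hw : IsBarrier Ω w) (hv : MemX0 s Ω v)
    (hv0 : ∀ x, 0 ≤ v x) {κ r : ℕ → ℝ} (hκ : ∀ n, 0 < κ n) (hκ1 : ∀ n, κ n ≤ 1)
    (hκ0 : Tendsto κ atTop (𝓝 0)) (hr : Tendsto r atTop (𝓝 0))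
    (h : ∀ n, ∀ᵐ x ∂volume, v x ≠ 0 → 1 - r n ≤ ∫ z in (closedBall (0 : Euc N) (κ n))ᶜ,
      (w x - w (x + z)) * fracKernel s z) :
    2 * ∫ x, v x ≤ fracLaplacianPairing s w v := by
  have hvi := hv.integrable hΩ hΩfin
  have hlim : Tendsto (fun n => ∫ p : Euc N × Euc N,
      (w p.1 - w p.2) * (v p.1 - v p.2) * truncKernel s (κ n) (p.1 - p.2) ∂(volume.prod volume))
      atTop (𝓝 (fracLaplacianPairing s w v)) := by
    rw [fracLaplacianPairing_eq]
    refine tendsto_integral_of_dominated_convergence (fun p => |pairDensity s w v p|) (fun n => ?_)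
      (hw.integrable_pairDensity hN hs0 hs1 hΩ hΩfin hv).abs (fun n => Eventually.of_forall
        fun p => ?_) (Eventually.of_forall fun p => ?_)
    · exact (((aestronglyMeasurable_comp_fst hw.measurable.aestronglyMeasurable).sub
        (aestronglyMeasurable_comp_snd hw.measurable.aestronglyMeasurable)).mul
        ((aestronglyMeasurable_comp_fst hv.aestronglyMeasurable).sub
        (aestronglyMeasurable_comp_snd hv.aestronglyMeasurable))).mul
        ((measurable_truncKernel s (κ n)).comp
          (measurable_fst.sub measurable_snd)).aestronglyMeasurable
    · rw [Real.norm_eq_abs, pairDensity, abs_mul, abs_mul _ (fracKernel s _)]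
      refine mul_le_mul_of_nonneg_left ?_ (abs_nonneg _)
      unfold truncKernel
      by_cases hz : p.1 - p.2 ∈ (closedBall (0 : Euc N) (κ n))ᶜ
      · rw [indicator_of_mem hz]
      · rw [indicator_of_notMem hz, abs_zero]; exact abs_nonneg _
    · rcases eq_or_ne p.1 p.2 with he | he
      -- On the diagonal both integrands vanish; off it the cut-off kernel eventually equals the
      -- full one.
      · simp [pairDensity, he]
      · refine tendsto_const_nhds.congr' ?_
        have hpos : 0 < ‖p.1 - p.2‖ := norm_pos_iff.2 (sub_ne_zero.2 he)
        filter_upwards [hκ0.eventually_lt_const hpos] with n hn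
        rw [pairDensity, truncKernel, indicator_of_mem]
        rwa [mem_compl_iff, mem_closedBall_zero_iff, not_le]
  have hlow : Tendsto (fun n => 2 * ((1 - r n) * ∫ x, v x)) atTop (𝓝 (2 * ∫ x, v x)) := by
    have := ((hr.const_sub 1).mul_const (∫ x, v x)).const_mul 2
    simpa using this
  refine le_of_tendsto_of_tendsto' hlow hlim fun n => ?_
  obtain ⟨hi, he⟩ := integral_truncated_pairDensity hN hs0 hs1 (hκ n) (hκ1 n) hw hvi
  rw [he, ← integral_const_mul]
  refine mul_le_mul_of_nonneg_left (integral_mono_ae (hvi.const_mul _) hi ?_) zero_le_two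
  filter_upwards [h n] with x hx
  rcases eq_or_ne (v x) 0 with h0 | h0
  · simp [h0]
  · rw [mul_comm]
    exact mul_le_mul_of_nonneg_left (hx h0) (hv0 x)

/-- Weak solutions of the Dirichlet problem with right-hand side `g`. -/
structure IsEnergySolution (s : ℝ) (Ω : Set (Euc N)) (g φ : Euc N → ℝ) : Prop where
  memX0 : MemX0 s Ω φ
  pairing_eq : ∀ v, MemX0 s Ω v → fracLaplacianPairing s φ v = ∫ x in Ω, g x * v x

lemma ae_eq_zero_of_pairing_nonpos (hN : 0 < N) (hs0 : 0 < s) (hΩ : MeasurableSet Ω)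
    (hΩb : Bornology.IsBounded Ω) (hu : MemX0 s Ω u) (h : fracLaplacianPairing s u u ≤ 0) :
    ∀ᵐ x ∂volume, u x = 0 := by
  obtain ⟨C, hC, hP⟩ := exists_poincare hN hs0 hΩ hΩb
  have h1 : ∫ x, u x ^ 2 = 0 :=
    le_antisymm ((hP u hu).trans (mul_nonpos_of_nonneg_of_nonpos hC.le h))
      (integral_nonneg fun x => sq_nonneg _)
  rw [integral_eq_zero_iff_of_nonneg (fun x => sq_nonneg _) hu.memLp.integrable_sq] at h1
  filter_upwards [h1] with x hx
  simpa using hx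

/-- Comparison of an energy solution with a barrier. -/
theorem ae_le_of_barrier (hN : 0 < N) (hs0 : 0 < s) (hs1 : s < 1)
    (hΩ : MeasurableSet Ω) (hΩb : Bornology.IsBounded Ω) {g : Euc N → ℝ}
    (hg : ∀ x, g x ≤ 1) (hgi : AEStronglyMeasurable g (volume.restrict Ω)) (hgb : ∃ C, ∀ x, |g x| ≤ C)
    (hφ : IsEnergySolution s Ω g φ) (hw : IsBarrier Ω w)
    (hsup : ∫ x, max (φ x - w x) 0 ≤ fracLaplacianPairing s w fun x => max (φ x - w x) 0) :
    ∀ᵐ x ∂volume, φ x ≤ w x := by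
  have hΩfin : volume Ω ≠ ⊤ := hΩb.measure_lt_top.ne
  set v : Euc N → ℝ := fun x => max (φ x - w x) 0 with hv_def
  have hv : MemX0 s Ω v := hφ.memX0.posPart_sub hN hs0 hs1 hΩ hΩfin hw
  have hvi := hv.integrable hΩ hΩfin
  -- The inequality `(a₊ - b₊)² ≤ (a - b)(a₊ - b₊)`, applied to `φ - w`. With `h2` and `hsup` the
  -- energy of `(φ - w)₊` is at most `0`, and Poincaré makes it vanish.
  have h1 : fracLaplacianPairing s v v ≤
      fracLaplacianPairing s φ v - fracLaplacianPairing s w v := by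
    simp only [fracLaplacianPairing_eq]
    rw [← integral_sub (hφ.memX0.integrable_pairDensity hv)
      (hw.integrable_pairDensity hN hs0 hs1 hΩ hΩfin hv)]
    refine integral_mono hv.integrable_pairDensity_self
      ((hφ.memX0.integrable_pairDensity hv).sub
        (hw.integrable_pairDensity hN hs0 hs1 hΩ hΩfin hv)) fun p => ?_
    simp only [pairDensity]
    rw [← sub_mul]
    refine mul_le_mul_of_nonneg_right ?_ (fracKernel_nonneg _ _)
    have key : ∀ a b : ℝ, (max a 0 - max b 0) * (max a 0 - max b 0) ≤
        (a - b) * (max a 0 - max b 0) := by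
      intro a b
      rcases le_total a 0 with ha | ha <;> rcases le_total b 0 with hb | hb <;>
        simp only [max_eq_left, max_eq_right, ha, hb] <;> nlinarith
    have := key (φ p.1 - w p.1) (φ p.2 - w p.2)
    simp only [hv_def]
    linarith
  have h2 : fracLaplacianPairing s φ v ≤ ∫ x, v x := by
    rw [hφ.pairing_eq v hv, integral_eq_setIntegral_of_ae_eq_zero hΩ hv.ae_eq_zero]
    obtain ⟨C, hC⟩ := hgb
    refine integral_mono (hvi.integrableOn.bdd_mul hgi (Eventually.of_forall hC)) hvi.integrableOn
      fun x => ?_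
    exact mul_le_of_le_one_left (le_max_right _ _) (hg x)
  have h3 := ae_eq_zero_of_pairing_nonpos hN hs0 hΩ hΩb hv (by linarith)
  filter_upwards [h3] with x hx
  have := le_max_left (φ x - w x) 0
  simp only [hv_def] at hx
  linarith

/-- The uniform bound. -/
theorem exists_energySolution_le (hN : 0 < N) (hs0 : 0 < s) (hs1 : s < 1)
    (hΩ : MeasurableSet Ω) (hΩb : Bornology.IsBounded Ω) :
    ∃ C : ℝ, 0 < C ∧ ∀ g φ : Euc N → ℝ, (∀ x, |g x| ≤ 1) →
      AEStronglyMeasurable g (volume.restrict Ω) → IsEnergySolution s Ω g φ →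
      ∀ᵐ x ∂volume, φ x ≤ C := by
  obtain ⟨q, M, hM, hq⟩ := exists_exterior_ball_of_isBounded hN hΩb
  have hvol := volume_ball_one_pos q
  set k : ℝ := (M ^ ((N : ℝ) + 2 * s))⁻¹ with hk
  have hk0 : 0 < k := by positivity
  set C : ℝ := (k * volume.real (ball q 1))⁻¹ with hC
  have hC0 : 0 < C := by positivity
  refine ⟨C, hC0, fun g φ hg hgm hφ => ?_⟩
  -- Constant near `Ω` with a drop to `0` on a remote ball: from `Ω` the drop alone contributes at
  -- least `C k |B(q, 1)| = 1`.
  set w : Euc N → ℝ := (ball q 1)ᶜ.indicator fun _ => C with hw_def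
  have hw0 : ∀ x, 0 ≤ w x := fun x => indicator_nonneg (fun _ _ => hC0.le) x
  have hwC : ∀ x, w x ≤ C := fun x => indicator_apply_le' (fun _ => le_rfl) fun _ => hC0.le
  have hΩw : ∀ x ∈ Ω, w x = C := fun x hx => by
    refine indicator_of_mem (fun hb => ?_) _
    have := (hq x hx x hb).1
    rw [sub_self, norm_zero] at this
    linarith
  have hw : IsBarrier Ω w := by
    refine ⟨measurable_const.indicator measurableSet_ball.compl, hw0, ⟨C, hwC⟩, C ^ 2,
      sq_nonneg C, fun x hx y => ?_⟩
    rw [hΩw x hx]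
    by_cases hy : y ∈ ball q 1
    · have h1 := (hq x hx y hy).1
      rw [min_eq_right (one_le_pow₀ h1), hw_def, indicator_of_notMem (not_not.2 hy)]
      simp
    · rw [hw_def, indicator_of_mem hy, sub_self, zero_pow two_ne_zero]
      positivity
  have hv := hφ.memX0.posPart_sub hN hs0 hs1 hΩ hΩb.measure_lt_top.ne hw
  have hle : ∀ᵐ x ∂volume, φ x ≤ w x := by
    refine ae_le_of_barrier hN hs0 hs1 hΩ hΩb (fun x => (le_abs_self _).trans (hg x)) hgm
      ⟨1, hg⟩ hφ hw ?_
    -- The exponent `n + 1` keeps the cutoff strictly below `1`, so the remote ball, at distance at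
    -- least `1`, is never cut off.
    have hκ0 : Tendsto (fun n : ℕ => (1 / 2 : ℝ) ^ (n + 1)) atTop (𝓝 0) :=
      (tendsto_pow_atTop_nhds_zero_of_lt_one (by norm_num) (by norm_num)).comp
        (tendsto_add_atTop_nat 1)
    have hv0 : 0 ≤ ∫ x, max (φ x - w x) 0 := integral_nonneg fun x => le_max_right _ _
    refine le_trans (by linarith) (integral_le_pairing_of_truncated hN hs0 hs1 hΩ
      hΩb.measure_lt_top.ne hw hv (fun x => le_max_right _ _)
      (κ := fun n => (1 / 2 : ℝ) ^ (n + 1)) (r := fun _ => 0) (fun n => by positivity)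
      (fun n => pow_le_one₀ (by norm_num) (by norm_num)) hκ0 tendsto_const_nhds fun n => ?_)
    filter_upwards [hv.ae_eq_zero] with x hx hne
    have hxΩ : x ∈ Ω := by
      by_contra hx'
      exact hne (hx hx')
    have hκ1 : (1 / 2 : ℝ) ^ (n + 1) < 1 := pow_lt_one₀ (by norm_num) (by norm_num) (by simp)
    set κ : ℝ := (1 / 2 : ℝ) ^ (n + 1) with hκ
    have hκpos : 0 < κ := by positivity
    have hball : ∀ z ∈ ball (q - x) 1, x + z ∈ ball q 1 := fun z hz => by
      rw [mem_ball, dist_eq_norm] at hz ⊢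
      rwa [show x + z - q = z - (q - x) by abel]
    have hnorm : ∀ z ∈ ball (q - x) 1, 1 ≤ ‖z‖ ∧ ‖z‖ ≤ M := fun z hz => by
      have := hq x hxΩ _ (hball z hz)
      rwa [sub_add_cancel_left, norm_neg] at this
    have hint : IntegrableOn (fun z => (w x - w (x + z)) * fracKernel s z)
        (closedBall (0 : Euc N) κ)ᶜ := by
      refine integrableOn_mul_fracKernel hN hs0 hs1 hκpos hκ1.le
        (measurable_const.sub (hw.measurable.comp (measurable_const_add x))) hC0.le fun z => ?_
      have h1 : |w x - w (x + z)| ≤ C := by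
        rw [abs_le]; constructor <;> linarith [hw0 x, hw0 (x + z), hwC x, hwC (x + z)]
      nlinarith [Real.rpow_nonneg (norm_nonneg z) s]
    have hsub : ball (q - x) 1 ⊆ (closedBall (0 : Euc N) κ)ᶜ := fun z hz => by
      rw [mem_compl_iff, mem_closedBall_zero_iff, not_le]
      exact hκ1.trans_le (hnorm z hz).1
    calc (1 : ℝ) - 0 = ∫ z in ball (q - x) 1, C * k := by
          rw [setIntegral_const, smul_eq_mul, Measure.real, Measure.addHaar_ball_center,
            ← Measure.addHaar_ball_center volume q, ← measureReal_def, sub_zero, hC]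
          field_simp
      _ ≤ ∫ z in ball (q - x) 1, (w x - w (x + z)) * fracKernel s z := by
          refine setIntegral_mono_on (integrableOn_const (measure_ball_lt_top (μ := volume)).ne)
            (hint.mono_set hsub) measurableSet_ball fun z hz => ?_
          have h0 : w (x + z) = 0 := indicator_of_notMem (not_not.2 (hball z hz)) _
          rw [hΩw x hxΩ, h0, sub_zero]
          refine mul_le_mul_of_nonneg_left (fracKernel_anti hs0 (fun h => ?_) (hnorm z hz).2) hC0.le
          have := (hnorm z hz).1
          rw [h, norm_zero] at this
          linarith
      _ ≤ _ := setIntegral_mono_set hint (Eventually.of_forall fun z => by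
          refine mul_nonneg ?_ (fracKernel_nonneg s z)
          rw [hΩw x hxΩ]; exact sub_nonneg.2 (hwC _)) hsub.eventuallyLE
  filter_upwards [hle] with x hx
  exact hx.trans (hwC x)

end Comparison

/-! ### Bounds for energy solutions near an exterior ball. -/

section BoundaryBound

open Set Filter Topology Metric
open scoped ENNReal RealInnerProductSpace

variable {N : ℕ} {s : ℝ} {Ω : Set (Euc N)} {φ : Euc N → ℝ}

/-- One point stays at distance `η` from the singularity at `0`. If the other is above `η/2`, the
slope bound `(η/2)^{s-1}` applies; otherwise the points are at least `η/2` apart and the total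
oscillation `εˢ` suffices. -/
lemma abs_truncPow_sub_le (hs0 : 0 < s) (hs1 : s < 1) {ε η t : ℝ} (hε : 0 < ε) (hη : 0 < η)
    (ht : η ≤ t) (t' : ℝ) :
    |truncPow s ε t - truncPow s ε t'| ≤ ((η / 2) ^ (s - 1) + ε ^ s * (2 / η)) * |t - t'| := by
  have h0 : 0 ≤ ε ^ s * (2 / η) := by positivity
  have h0' : 0 ≤ (η / 2) ^ (s - 1) := by positivity
  have aux : ∀ a b : ℝ, η / 2 ≤ a → a ≤ b →
      |truncPow s ε b - truncPow s ε a| ≤ (η / 2) ^ (s - 1) * |b - a| := by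
    intro a b ha hab
    have ha0 : 0 < a := by linarith [half_pos hη]
    have h1 := truncPow_add_sub_le hs0 hs1 ε ha0.ne' (sub_nonneg.2 hab)
    rw [add_sub_cancel, abs_of_pos ha0] at h1
    rw [abs_of_nonneg (sub_nonneg.2 (truncPow_mono hs0 ε hab)), abs_of_nonneg (sub_nonneg.2 hab)]
    refine h1.trans (mul_le_mul_of_nonneg_right ?_ (sub_nonneg.2 hab))
    exact Real.rpow_le_rpow_of_nonpos (half_pos hη) ha (by linarith)
  rw [add_mul]
  rcases le_total t t' with h | h
  · rw [abs_sub_comm, abs_sub_comm t]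
    exact (aux t t' (by linarith) h).trans (le_add_of_nonneg_right (by positivity))
  rcases le_total (η / 2) t' with h2 | h2
  · exact (aux t' t h2 h).trans (le_add_of_nonneg_right (by positivity))
  · refine le_trans ?_ (le_add_of_nonneg_left (by positivity))
    have h3 : η / 2 ≤ |t - t'| := by rw [abs_of_nonneg (by linarith)]; linarith
    have h4 : |truncPow s ε t - truncPow s ε t'| ≤ ε ^ s := by
      rw [abs_le]
      constructor <;> linarith [truncPow_nonneg (s := s) hε.le t, truncPow_nonneg (s := s) hε.le t',
        truncPow_le (s := s) ε t, truncPow_le (s := s) ε t']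
    calc _ ≤ ε ^ s := h4
      _ = ε ^ s * (2 / η) * (η / 2) := by field_simp
      _ ≤ _ := by gcongr

lemma isBarrier_ballBarrier (hs0 : 0 < s) (hs1 : s < 1) {ε R ρ : ℝ} (hε : 0 < ε) (hρ : ρ < R)
    {c : Euc N} (hc : ∀ x ∈ Ω, R ≤ ‖x - c‖) : IsBarrier Ω (ballBarrier s ε c ρ) := by
  have hη : 0 < R - ρ := sub_pos.2 hρ
  set L : ℝ := ((R - ρ) / 2) ^ (s - 1) + ε ^ s * (2 / (R - ρ)) with hL
  have hL0 : 0 ≤ L := by positivity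
  refine ⟨(continuous_ballBarrier hs0 ε c ρ).measurable, fun x => truncPow_nonneg hε.le _,
    ⟨ε ^ s, fun x => truncPow_le _ _⟩, L ^ 2 + (ε ^ s) ^ 2, by positivity, fun x hx y => ?_⟩
  have h1 : (ballBarrier s ε c ρ x - ballBarrier s ε c ρ y) ^ 2 ≤ (L * ‖x - y‖) ^ 2 := by
    rw [sq_le_sq, abs_of_nonneg (by positivity : 0 ≤ L * ‖x - y‖)]
    refine (abs_truncPow_sub_le hs0 hs1 hε hη (by linarith [hc x hx]) _).trans ?_
    gcongr
    have := abs_norm_sub_norm_le (x - c) (y - c)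
    rw [sub_sub_sub_cancel_right] at this
    rwa [sub_sub_sub_cancel_right]
  have h2 : (ballBarrier s ε c ρ x - ballBarrier s ε c ρ y) ^ 2 ≤ (ε ^ s) ^ 2 := by
    rw [sq_le_sq, abs_of_nonneg (by positivity : 0 ≤ ε ^ s), abs_le]
    unfold ballBarrier
    constructor <;> linarith [truncPow_nonneg (s := s) hε.le (‖x - c‖ - ρ),
      truncPow_nonneg (s := s) hε.le (‖y - c‖ - ρ), truncPow_le (s := s) ε (‖x - c‖ - ρ),
      truncPow_le (s := s) ε (‖y - c‖ - ρ)]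
  rcases le_total (‖x - y‖ ^ 2) 1 with h | h
  · rw [min_eq_left h]; nlinarith [sq_nonneg (ε ^ s), sq_nonneg ‖x - y‖]
  · rw [min_eq_right h]; nlinarith [sq_nonneg L]

lemma tendsto_setIntegral_closedBall_zero (hN : 0 < N) {f : Euc N → ℝ} (hf : Integrable f)
    {κ : ℕ → ℝ} (hκ : ∀ n, 0 < κ n) (hanti : Antitone κ) (hκ0 : Tendsto κ atTop (𝓝 0)) :
    Tendsto (fun n => ∫ z in closedBall (0 : Euc N) (κ n), f z) atTop (𝓝 0) := by
  have : Nonempty (Fin N) := ⟨⟨0, hN⟩⟩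
  have h := tendsto_setIntegral_of_antitone (μ := volume) (f := f)
    (s := fun n => closedBall (0 : Euc N) (κ n)) (fun n => measurableSet_closedBall)
    (fun m n hmn => closedBall_subset_closedBall (hanti hmn)) ⟨0, hf.integrableOn⟩
  have hI : ⋂ n, closedBall (0 : Euc N) (κ n) = {0} := by
    ext z
    simp only [mem_iInter, mem_closedBall_zero_iff, mem_singleton_iff]
    refine ⟨fun hz => norm_le_zero_iff.1 (ge_of_tendsto' hκ0 hz), ?_⟩
    rintro rfl n
    rw [norm_zero]; exact (hκ n).le
  rw [hI] at h
  simpa using h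

/-- Bound of energy solutions near an exterior ball. -/
theorem exists_energySolution_le_posPow (hN : 0 < N) (hs0 : 0 < s) (hs1 : s < 1)
    (hΩ : MeasurableSet Ω) (hΩb : Bornology.IsBounded Ω) {R : ℝ} (hR : 0 < R) :
    ∃ K : ℝ, 0 < K ∧ ∀ g φ : Euc N → ℝ, (∀ x, |g x| ≤ 1) →
      AEStronglyMeasurable g (volume.restrict Ω) → IsEnergySolution s Ω g φ →
      ∀ c : Euc N, (∀ x ∈ Ω, R ≤ ‖x - c‖) → ∀ᵐ x ∂volume, φ x ≤ K * posPow s (‖x - c‖ - R) := by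
  obtain ⟨C, hC, hbound⟩ := exists_energySolution_le hN hs0 hs1 hΩ hΩb
  obtain ⟨ε, hε, hsup⟩ := exists_ballBarrier_supersolution (N := N) hN hs0 hs1 (half_pos hR)
  have hεs : 0 < ε ^ s := by positivity
  -- `K ≥ 1` preserves the supersolution property, and `K εˢ ≥ C` puts the plateau of the barrier
  -- above the uniform bound on `φ`.
  set K : ℝ := max 1 (C / ε ^ s) with hK
  have hK1 : 1 ≤ K := le_max_left _ _
  have hK0 : 0 < K := one_pos.trans_le hK1
  have hKC : C ≤ K * ε ^ s := by rw [← div_le_iff₀ hεs]; exact le_max_right _ _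
  refine ⟨K, hK0, fun g φ hg hgm hφ c hc => ?_⟩
  have hφC := hbound g φ hg hgm hφ
  have hΩfin : volume Ω ≠ ⊤ := hΩb.measure_lt_top.ne
  -- With `ρ < R` the set `Ω` keeps the distance `η = R - ρ` from the ball, so the barrier is
  -- Lipschitz there; the constants depend only on `ρ ≥ R/2`, which permits `ρ ↑ R`.
  have main : ∀ ρ, R / 2 ≤ ρ → ρ < R → ∀ᵐ x ∂volume, φ x ≤ K * ballBarrier s ε c ρ x := by
    intro ρ hρ hρR
    have hη : 0 < R - ρ := sub_pos.2 hρR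
    have hb := isBarrier_ballBarrier (Ω := Ω) hs0 hs1 hε hρR hc
    have hw := hb.const_mul hK0.le
    have hv := hφ.memX0.posPart_sub hN hs0 hs1 hΩ hΩfin hw
    refine ae_le_of_barrier hN hs0 hs1 hΩ hΩb (fun x => (le_abs_self _).trans (hg x)) hgm
      ⟨1, hg⟩ hφ hw ?_
    rw [fracLaplacianPairing_const_mul_left]
    have hv0 : 0 ≤ ∫ x, max (φ x - K * ballBarrier s ε c ρ x) 0 :=
      integral_nonneg fun x => le_max_right _ _
    set κ : ℕ → ℝ := fun n => min (R - ρ) 1 * (1 / ((n : ℝ) + 1)) with hκ_def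
    have hm0 : 0 < min (R - ρ) 1 := lt_min hη one_pos
    have hκ : ∀ n, 0 < κ n := fun n => by positivity
    have hκle : ∀ n, κ n ≤ min (R - ρ) 1 := fun n => by
      refine mul_le_of_le_one_right hm0.le ?_
      rw [div_le_one (by positivity)]; linarith [(Nat.cast_nonneg n : (0 : ℝ) ≤ n)]
    have hκ0 : Tendsto κ atTop (𝓝 0) := by
      have := (tendsto_one_div_add_atTop_nhds_zero_nat (𝕜 := ℝ)).const_mul (min (R - ρ) 1)
      rwa [mul_zero] at this
    have hanti : Antitone κ := fun m n hmn => by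
      simp only [hκ_def]; gcongr
    have hr := (tendsto_setIntegral_closedBall_zero hN
      (integrable_kernelWeight_mul (N := N) hN hs0 hs1) hκ hanti hκ0).const_mul ((R - ρ) ^ (s - 2))
    rw [mul_zero] at hr
    have key := integral_le_pairing_of_truncated hN hs0 hs1 hΩ hΩfin hb hv
      (fun x => le_max_right _ _) hκ (fun n => (hκle n).trans (min_le_right _ _)) hκ0 hr
      fun n => ?_
    · nlinarith
    filter_upwards [hv.ae_eq_zero, hφC] with x hx hxC hne
    have hxΩ : x ∈ Ω := by
      by_contra hx'
      exact hne (hx hx')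
    refine hsup c x ρ (R - ρ) (κ n) hρ hη (by linarith [hc x hxΩ]) ?_ (hκ n)
      ((hκle n).trans (min_le_right _ _)) ((hκle n).trans (min_le_left _ _))
    -- On the plateau `K w = K εˢ ≥ C ≥ φ`, so the test function vanishes there and the
    -- supersolution inequality is needed only at distance less than `ε`.
    by_contra! hge
    apply hne
    refine max_eq_right ?_
    have : ballBarrier s ε c ρ x = ε ^ s := truncPow_of_ge hs0 hε.le hge
    rw [this]; linarith
  set ρ : ℕ → ℝ := fun n => R - R / 2 * (1 / ((n : ℝ) + 1)) with hρ_def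
  have hρlim : Tendsto ρ atTop (𝓝 R) := by
    have := (tendsto_one_div_add_atTop_nhds_zero_nat (𝕜 := ℝ)).const_mul (R / 2)
    have h2 := this.const_sub R
    rwa [mul_zero, sub_zero] at h2
  have hall : ∀ᵐ x ∂volume, ∀ n, φ x ≤ K * ballBarrier s ε c (ρ n) x := by
    refine ae_all_iff.2 fun n => main _ ?_ ?_
    · have : R / 2 * (1 / ((n : ℝ) + 1)) ≤ R / 2 := by
        refine mul_le_of_le_one_right (by positivity) ?_
        rw [div_le_one (by positivity)]; linarith [(Nat.cast_nonneg n : (0 : ℝ) ≤ n)]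
      simp only [hρ_def]; linarith
    · simp only [hρ_def]
      have : 0 < R / 2 * (1 / ((n : ℝ) + 1)) := by positivity
      linarith
  filter_upwards [hall] with x hx
  have hlim : Tendsto (fun n => K * posPow s (‖x - c‖ - ρ n)) atTop
      (𝓝 (K * posPow s (‖x - c‖ - R))) :=
    (((continuous_posPow hs0).tendsto _).comp (hρlim.const_sub _)).const_mul K
  exact ge_of_tendsto' hlim fun n => (hx n).trans (mul_le_mul_of_nonneg_left (min_le_left _ _) hK0.le)

end BoundaryBound

/-! ### The uniform exterior ball condition. -/

section ExteriorBall

open Set Filter Topology Metric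
open scoped RealInnerProductSpace

variable {N : ℕ} {Ω : Set (Euc N)}

/-- The exterior ball condition at all boundary points near a given one. -/
lemma IsSmoothBoundedDomain.exists_local_exterior_ball (hΩ : IsSmoothBoundedDomain Ω) {x₀ : Euc N}
    (hx₀ : x₀ ∈ frontier Ω) : ∃ t ∈ 𝓝 x₀, ∃ R₀ : ℝ, 0 < R₀ ∧ ∀ x₁ ∈ t ∩ frontier Ω, ∀ R, 0 < R →
      R ≤ R₀ → ∃ c, dist x₁ c = R ∧ ∀ x ∈ Ω, R ≤ ‖x - c‖ := by
  obtain ⟨U, ρ, hU, hxU, hρ, hd0, hmem⟩ := hΩ.smooth_boundary x₀ hx₀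
  have hat : ContDiffAt ℝ ∞ ρ x₀ := hρ.contDiffAt (hU.mem_nhds hxU)
  have hfd : ContDiffAt ℝ 1 (fderiv ℝ ρ) x₀ := hat.fderiv_right (m := 1) (by
    rw [one_add_one_eq_two]
    exact (WithTop.coe_le_coe.2 le_top : ((2 : ℕ∞) : WithTop ℕ∞) ≤ ((⊤ : ℕ∞) : WithTop ℕ∞)))
  obtain ⟨L, t, ht, hL⟩ := hfd.exists_lipschitzOnWith
  set m : ℝ := ‖fderiv ℝ ρ x₀‖ / 2 with hm
  have hn0 : 0 < ‖fderiv ℝ ρ x₀‖ := norm_pos_iff.2 hd0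
  have hm0 : 0 < m := half_pos hn0
  have hev : ∀ᶠ x in 𝓝 x₀, m < ‖fderiv ℝ ρ x‖ :=
    hfd.continuousAt.norm.eventually_const_lt (half_lt_self hn0)
  obtain ⟨r, hr, hball⟩ := Metric.mem_nhds_iff.1
    (inter_mem (inter_mem (hU.mem_nhds hxU) ht) hev)
  -- `R ≤ r/4` settles the points with `|x - x₁| ≥ r/2 ≥ 2R`; nearer points stay in the good ball
  -- `B(x₀, r)`. The second bound gives `2RL ≤ m`, with `m` below the gradient norm, and `L + 1`
  -- avoids dividing by zero.
  refine ⟨ball x₀ (r / 2), ball_mem_nhds _ (half_pos hr), min (r / 4) (m / (2 * (L + 1))),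
    by positivity, ?_⟩
  rintro x₁ ⟨hx₁, hx₁f⟩ R hR hRle
  have hR1 : R ≤ r / 4 := hRle.trans (min_le_left _ _)
  have hR2 : R * (2 * (L + 1)) ≤ m := by
    rw [← le_div_iff₀ (by positivity)]; exact hRle.trans (min_le_right _ _)
  have hx₁b : x₁ ∈ ball x₀ r := ball_subset_ball (by linarith) hx₁
  set D := fderiv ℝ ρ x₁ with hD
  set G : Euc N := (InnerProductSpace.toDual ℝ (Euc N)).symm D with hG
  have hGn : ‖G‖ = ‖D‖ := LinearIsometryEquiv.norm_map _ _
  have hDm : m < ‖D‖ := (hball hx₁b).2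
  have hG0 : 0 < ‖G‖ := by rw [hGn]; linarith
  have hGD : ∀ h, ⟪G, h⟫ = D h := fun h => InnerProductSpace.toDual_symm_apply
  have hν : ‖‖G‖⁻¹ • G‖ = 1 := norm_smul_inv_norm (norm_pos_iff.1 hG0)
  refine ⟨x₁ + R • (‖G‖⁻¹ • G), ?_, fun x hx => ?_⟩
  · rw [dist_self_add_right, norm_smul, hν, mul_one, Real.norm_of_nonneg hR.le]
  rw [← sub_sub]
  have hRν : ‖R • (‖G‖⁻¹ • G)‖ = R := by rw [norm_smul, hν, mul_one, Real.norm_of_nonneg hR.le]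
  rcases le_or_gt (r / 2) ‖x - x₁‖ with hfar | hnear
  · have := norm_sub_norm_le (x - x₁) (R • (‖G‖⁻¹ • G))
    linarith
  have hsub : closedBall x₁ ‖x - x₁‖ ⊆ ball x₀ r := by
    intro y hy
    rw [mem_closedBall] at hy
    rw [mem_ball] at hx₁ ⊢
    linarith [dist_triangle y x₁ x₀]
  have hxmem : x ∈ closedBall x₁ ‖x - x₁‖ := by rw [mem_closedBall, dist_eq_norm]
  have hx₁mem : x₁ ∈ closedBall x₁ ‖x - x₁‖ := mem_closedBall_self (norm_nonneg _)
  have htaylor : ‖ρ x - ρ x₁ - D (x - x₁)‖ ≤ L * ‖x - x₁‖ * ‖x - x₁‖ := by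
    refine (convex_closedBall x₁ ‖x - x₁‖).norm_image_sub_le_of_norm_hasFDerivWithin_le'
      (f' := fun y => fderiv ℝ ρ y) (fun y hy => ?_) (fun y hy => ?_) hx₁mem hxmem
    · have hyU := (hball (hsub hy)).1.1
      exact ((hρ.contDiffAt (hU.mem_nhds hyU)).differentiableAt
        (by simp)).hasFDerivAt.hasFDerivWithinAt
    · have h1 := hL.dist_le_mul y (hball (hsub hy)).1.2 x₁ (hball hx₁b).1.2
      rw [dist_eq_norm] at h1
      refine h1.trans ?_
      gcongr
      exact hy
  have hρx : ρ x < 0 := (hmem x (hball (hsub hxmem)).1.1).1 hx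
  have hρx₁ : 0 ≤ ρ x₁ := by
    rw [hΩ.isOpen.frontier_eq] at hx₁f
    by_contra! h
    exact hx₁f.2 ((hmem x₁ (hball hx₁b).1.1).2 h)
  have hDh : D (x - x₁) ≤ L * ‖x - x₁‖ ^ 2 := by
    have := (abs_le.1 htaylor).1
    nlinarith
  -- With `h = x - x₁` the square expands to `|h|² - 2R D(h)/|G| + R²`, and `D(h) ≤ L|h|²` with `2RL
  -- ≤ m < |G|` makes the first two terms nonnegative together.
  have hsq : R ^ 2 ≤ ‖x - x₁ - R • (‖G‖⁻¹ • G)‖ ^ 2 := by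
    rw [norm_sub_sq_real, hRν, inner_smul_right, inner_smul_right, real_inner_comm, hGD]
    have h1 : R * (‖G‖⁻¹ * D (x - x₁)) * 2 ≤ ‖x - x₁‖ ^ 2 := by
      have h2 : R * (‖G‖⁻¹ * D (x - x₁)) * 2 = (2 * R * D (x - x₁)) / ‖G‖ := by
        field_simp
      rw [h2, div_le_iff₀ hG0, hGn]
      have h3 : 2 * R * D (x - x₁) ≤ 2 * R * (L * ‖x - x₁‖ ^ 2) := by gcongr
      have h4 : 2 * R * (L * ‖x - x₁‖ ^ 2) ≤ ‖x - x₁‖ ^ 2 * m := by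
        nlinarith [sq_nonneg ‖x - x₁‖, mul_nonneg hR.le (sq_nonneg ‖x - x₁‖)]
      nlinarith [sq_nonneg ‖x - x₁‖]
    linarith
  exact le_of_sq_le_sq hsq (norm_nonneg _)

/-- The uniform exterior ball condition. -/
theorem IsSmoothBoundedDomain.exists_exterior_ball (hΩ : IsSmoothBoundedDomain Ω) :
    ∃ R : ℝ, 0 < R ∧ ∀ x₁ ∈ frontier Ω, ∃ c, dist x₁ c = R ∧ ∀ x ∈ Ω, R ≤ ‖x - c‖ := by
  have hcomp : IsCompact (frontier Ω) :=
    hΩ.isBounded.isCompact_closure.of_isClosed_subset isClosed_frontier frontier_subset_closure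
  -- Asking for all radii up to `R₀` makes the property stable under finite unions, by taking the
  -- minimum.
  have h : ∃ R₀ : ℝ, 0 < R₀ ∧ ∀ x₁ ∈ frontier Ω ∩ frontier Ω, ∀ R, 0 < R →
      R ≤ R₀ → ∃ c, dist x₁ c = R ∧ ∀ x ∈ Ω, R ≤ ‖x - c‖ := by
    refine hcomp.induction_on (p := fun t => ∃ R₀ : ℝ, 0 < R₀ ∧ ∀ x₁ ∈ t ∩ frontier Ω, ∀ R, 0 < R →
      R ≤ R₀ → ∃ c, dist x₁ c = R ∧ ∀ x ∈ Ω, R ≤ ‖x - c‖) ⟨1, one_pos, by simp⟩ ?_ ?_ ?_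
    · rintro S T hST ⟨R₀, h0, h⟩
      exact ⟨R₀, h0, fun x hx => h x ⟨hST hx.1, hx.2⟩⟩
    · rintro S T ⟨R₀, h0, h⟩ ⟨R₁, h1, h'⟩
      refine ⟨min R₀ R₁, lt_min h0 h1, ?_⟩
      rintro x ⟨hx | hx, hxf⟩ R hR hle
      · exact h x ⟨hx, hxf⟩ R hR (hle.trans (min_le_left _ _))
      · exact h' x ⟨hx, hxf⟩ R hR (hle.trans (min_le_right _ _))
    · intro x hx
      obtain ⟨t, ht, h⟩ := hΩ.exists_local_exterior_ball hx
      exact ⟨t, mem_nhdsWithin_of_mem_nhds ht, h⟩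
  obtain ⟨R₀, h0, h⟩ := h
  exact ⟨R₀, h0, fun x hx => h x ⟨hx, hx⟩ R₀ h0 le_rfl⟩

lemma IsSmoothBoundedDomain.frontier_nonempty (hN : 0 < N) (hΩ : IsSmoothBoundedDomain Ω) :
    (frontier Ω).Nonempty := by
  have : Nonempty (Fin N) := ⟨⟨0, hN⟩⟩
  rw [nonempty_iff_ne_empty, Ne, frontier_eq_empty_iff]
  rintro (h | h)
  · exact hΩ.isConnected.nonempty.ne_empty h
  · exact NormedSpace.unbounded_univ ℝ (Euc N) (h ▸ hΩ.isBounded)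

end ExteriorBall

/-! ### Decay of energy solutions like `δˢ`. -/

section BoundaryDecay

open Set Filter Topology Metric

variable {N : ℕ} {s : ℝ} {Ω : Set (Euc N)}

/-- Energy solutions with bounded right-hand side decay like `δˢ`. -/
theorem IsSmoothBoundedDomain.exists_energySolution_le_boundaryDist (hN : 0 < N) (hs0 : 0 < s)
    (hs1 : s < 1) (hΩ : IsSmoothBoundedDomain Ω) :
    ∃ K : ℝ, 0 < K ∧ ∀ g φ : Euc N → ℝ, (∀ x, |g x| ≤ 1) →
      AEStronglyMeasurable g (volume.restrict Ω) → IsEnergySolution s Ω g φ →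
      ∀ᵐ x ∂volume, x ∈ Ω → φ x ≤ K * boundaryDist Ω x ^ s := by
  obtain ⟨R, hR, hext⟩ := hΩ.exists_exterior_ball
  obtain ⟨K, hK, hbound⟩ := exists_energySolution_le_posPow hN hs0 hs1 hΩ.isOpen.measurableSet
    hΩ.isBounded hR
  refine ⟨K, hK, fun g φ hg hgm hφ => ?_⟩
  -- The exceptional null set depends on the centre `c`, while the centre must depend on `x`. A
  -- countable dense set of centres gives one null set, and continuity in `c` recovers all centres.
  set Z : Set (Euc N) := {c | ∀ x ∈ Ω, R ≤ ‖x - c‖}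
  obtain ⟨D, hDc, hDd⟩ := TopologicalSpace.exists_countable_dense Z
  have := hDc.to_subtype
  have hall : ∀ᵐ x ∂volume, ∀ c : D, φ x ≤ K * posPow s (‖x - (c : Z)‖ - R) :=
    ae_all_iff.2 fun c => hbound g φ hg hgm hφ _ (c : Z).2
  filter_upwards [hall] with x hx hxΩ
  have hcl : IsClosed {c : Z | φ x ≤ K * posPow s (‖x - c‖ - R)} := by
    have := continuous_posPow hs0
    exact isClosed_le continuous_const (by fun_prop)
  have huniv : ∀ c : Z, φ x ≤ K * posPow s (‖x - c‖ - R) := fun c =>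
    hcl.closure_subset_iff.2 (fun c hc => hx ⟨c, hc⟩) (hDd c)
  obtain ⟨x₁, hx₁, hd⟩ := isClosed_frontier.exists_infDist_eq_dist
    (hΩ.frontier_nonempty hN) x
  obtain ⟨c, hc, hcZ⟩ := hext x₁ hx₁
  refine (huniv ⟨c, hcZ⟩).trans (mul_le_mul_of_nonneg_left ?_ hK.le)
  have hle : ‖x - c‖ - R ≤ boundaryDist Ω x := by
    rw [boundaryDist, hd, ← hc, ← dist_eq_norm]
    linarith [dist_triangle x x₁ c]
  exact (posPow_mono hs0 hle).trans_eq (posPow_of_nonneg (t := boundaryDist Ω x) infDist_nonneg)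

end BoundaryDecay

/-! ### The energy space as a Hilbert space, and existence of energy solutions. -/

section EnergySpace

open Set Filter Topology Metric
open scoped ENNReal RealInnerProductSpace

variable {N : ℕ} {s : ℝ} {Ω : Set (Euc N)} {u v φ : Euc N → ℝ}

/-- The square root of the energy density: `(u(x) - u(y)) |x - y|^{-(N+2s)/2}`. -/
noncomputable def diffQuot (s : ℝ) (u : Euc N → ℝ) (p : Euc N × Euc N) : ℝ :=
  (u p.1 - u p.2) * √(fracKernel s (p.1 - p.2))

lemma diffQuot_mul (s : ℝ) (u v : Euc N → ℝ) (p : Euc N × Euc N) :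
    diffQuot s u p * diffQuot s v p = pairDensity s u v p := by
  unfold diffQuot pairDensity
  have := Real.mul_self_sqrt (fracKernel_nonneg s (p.1 - p.2))
  linear_combination (u p.1 - u p.2) * (v p.1 - v p.2) * this

lemma aestronglyMeasurable_diffQuot (hu : AEStronglyMeasurable u volume) :
    AEStronglyMeasurable (diffQuot s u) (volume.prod volume) :=
  ((aestronglyMeasurable_comp_fst hu).sub (aestronglyMeasurable_comp_snd hu)).mul
    (measurable_fracKernel_sub s).sqrt.aestronglyMeasurable

lemma MemX0.memLp_diffQuot (hu : MemX0 s Ω u) : MemLp (diffQuot s u) 2 (volume.prod volume) := by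
  rw [memLp_two_iff_integrable_sq (aestronglyMeasurable_diffQuot hu.aestronglyMeasurable)]
  refine hu.integrable_pairDensity_self.congr (Eventually.of_forall fun p => ?_)
  simp only [sq, diffQuot_mul]

lemma diffQuot_congr_ae (h : u =ᵐ[volume] v) :
    diffQuot s u =ᵐ[volume.prod volume] diffQuot s v := by
  filter_upwards [ae_prod_of_ae h] with p hp
  simp only [diffQuot, hp.1, hp.2]

/-- The ambient Hilbert space `L²(ℝ^N) × L²(ℝ^N × ℝ^N)`. -/
abbrev EnergyAmbient (N : ℕ) :=
  WithLp 2 (Lp ℝ 2 (volume : Measure (Euc N)) ×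
    Lp ℝ 2 ((volume : Measure (Euc N)).prod (volume : Measure (Euc N))))

/-- `X₀ˢ(Ω)` as the graph of the difference quotient operator. -/
noncomputable def energySpace (s : ℝ) (Ω : Set (Euc N)) : Submodule ℝ (EnergyAmbient N) where
  carrier := {x | (∀ᵐ t ∂volume, t ∉ Ω → x.fst t = 0) ∧
    x.snd =ᵐ[volume.prod volume] diffQuot s x.fst}
  add_mem' := by
    rintro x y ⟨hx1, hx2⟩ ⟨hy1, hy2⟩
    refine ⟨?_, ?_⟩
    · filter_upwards [hx1, hy1, Lp.coeFn_add x.fst y.fst] with t h1 h2 h3 ht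
      rw [WithLp.add_fst, h3, Pi.add_apply, h1 ht, h2 ht, add_zero]
    · filter_upwards [hx2, hy2, ae_prod_of_ae (Lp.coeFn_add x.fst y.fst),
        Lp.coeFn_add x.snd y.snd] with p h1 h2 h3 h4
      rw [WithLp.add_snd, h4, Pi.add_apply, h1, h2, diffQuot, diffQuot, diffQuot, WithLp.add_fst,
        h3.1, h3.2, Pi.add_apply, Pi.add_apply]
      ring
  zero_mem' := by
    refine ⟨?_, ?_⟩
    · filter_upwards [Lp.coeFn_zero ℝ 2 (volume : Measure (Euc N))] with t h1 _
      rw [WithLp.zero_fst, h1, Pi.zero_apply]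
    · filter_upwards [ae_prod_of_ae (Lp.coeFn_zero ℝ 2 (volume : Measure (Euc N))),
        Lp.coeFn_zero ℝ 2 ((volume : Measure (Euc N)).prod (volume : Measure (Euc N)))] with p h1 h2
      rw [WithLp.zero_snd, h2, diffQuot, WithLp.zero_fst, h1.1, h1.2]
      simp
  smul_mem' := by
    rintro c x ⟨hx1, hx2⟩
    refine ⟨?_, ?_⟩
    · filter_upwards [hx1, Lp.coeFn_smul c x.fst] with t h1 h3 ht
      rw [WithLp.smul_fst, h3, Pi.smul_apply, h1 ht, smul_zero]
    · filter_upwards [hx2, ae_prod_of_ae (Lp.coeFn_smul c x.fst),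
        Lp.coeFn_smul c x.snd] with p h1 h3 h4
      rw [WithLp.smul_snd, h4, Pi.smul_apply, h1, diffQuot, diffQuot, WithLp.smul_fst,
        h3.1, h3.2, Pi.smul_apply, Pi.smul_apply, smul_eq_mul, smul_eq_mul, smul_eq_mul]
      ring

lemma mem_energySpace {x : EnergyAmbient N} : x ∈ energySpace s Ω ↔
    (∀ᵐ t ∂volume, t ∉ Ω → x.fst t = 0) ∧ x.snd =ᵐ[volume.prod volume] diffQuot s x.fst := Iff.rfl

lemma memX0_of_mem_energySpace {x : EnergyAmbient N} (hx : x ∈ energySpace s Ω) :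
    MemX0 s Ω x.fst := by
  refine memX0_of_pairDensity (Lp.memLp x.fst) hx.1 ((Lp.memLp x.snd).integrable_sq.congr ?_)
  filter_upwards [hx.2] with p hp
  rw [hp, sq, diffQuot_mul]

/-- The element of the energy space given by a function in `X₀ˢ(Ω)`. -/
noncomputable def MemX0.toEnergy (hu : MemX0 s Ω u) : energySpace s Ω :=
  ⟨WithLp.toLp 2 (hu.memLp.toLp u, hu.memLp_diffQuot.toLp (diffQuot s u)), by
    refine mem_energySpace.2 ⟨?_, ?_⟩
    · filter_upwards [hu.ae_eq_zero, hu.memLp.coeFn_toLp] with t h1 h2 ht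
      exact h2.trans (h1 ht)
    · exact hu.memLp_diffQuot.coeFn_toLp.trans (diffQuot_congr_ae hu.memLp.coeFn_toLp).symm⟩

/-- Both defining conditions hold pointwise a.e., and `L²` convergence gives a.e. convergence along
a subsequence, extracted once for each component. -/
lemma isClosed_energySpace (s : ℝ) (Ω : Set (Euc N)) :
    IsClosed (energySpace s Ω : Set (EnergyAmbient N)) := by
  refine IsSeqClosed.isClosed fun x y hx hy => ?_
  have hy1 : Tendsto (fun n => (x n).fst) atTop (𝓝 y.fst) :=
    ((WithLp.prod_continuous_ofLp 2 _ _).fst.tendsto y).comp hy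
  have hy2 : Tendsto (fun n => (x n).snd) atTop (𝓝 y.snd) :=
    ((WithLp.prod_continuous_ofLp 2 _ _).snd.tendsto y).comp hy
  obtain ⟨a, ha, hae⟩ := (tendstoInMeasure_of_tendsto_Lp hy1).exists_seq_tendsto_ae
  obtain ⟨b, hb, hbe⟩ :=
    (tendstoInMeasure_of_tendsto_Lp (hy2.comp ha.tendsto_atTop)).exists_seq_tendsto_ae
  have hae' : ∀ᵐ t ∂volume, Tendsto (fun n => (x (a (b n))).fst t) atTop (𝓝 (y.fst t)) := by
    filter_upwards [hae] with t ht
    exact ht.comp hb.tendsto_atTop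
  refine mem_energySpace.2 ⟨?_, ?_⟩
  · filter_upwards [hae', ae_all_iff.2 fun n => (hx (a (b n))).1] with t h1 h2 ht
    exact tendsto_nhds_unique h1 (tendsto_const_nhds.congr fun n => (h2 n ht).symm)
  · filter_upwards [ae_prod_of_ae hae', hbe, ae_all_iff.2 fun n => (hx (a (b n))).2]
      with p h1 h2 h3
    refine tendsto_nhds_unique h2 ?_
    have h4 : Tendsto (fun n => diffQuot s (x (a (b n))).fst p) atTop (𝓝 (diffQuot s y.fst p)) :=
      (h1.1.sub h1.2).mul_const _
    exact h4.congr fun n => (h3 n).symm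

/-- The projection of the energy space to the `L²(ℝ^N)` component. -/
noncomputable def energyFst (s : ℝ) (Ω : Set (Euc N)) :
    energySpace s Ω →L[ℝ] Lp ℝ 2 (volume : Measure (Euc N)) :=
  (ContinuousLinearMap.fst ℝ _ _).comp
    ((WithLp.prodContinuousLinearEquiv 2 ℝ _ _).toContinuousLinearMap.comp
      (energySpace s Ω).subtypeL)

/-- The projection of the energy space to the difference quotient. -/
noncomputable def energySnd (s : ℝ) (Ω : Set (Euc N)) : energySpace s Ω →L[ℝ]
    Lp ℝ 2 ((volume : Measure (Euc N)).prod (volume : Measure (Euc N))) :=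
  (ContinuousLinearMap.snd ℝ _ _).comp
    ((WithLp.prodContinuousLinearEquiv 2 ℝ _ _).toContinuousLinearMap.comp
      (energySpace s Ω).subtypeL)

lemma energyFst_apply (x : energySpace s Ω) : energyFst s Ω x = (x : EnergyAmbient N).fst := rfl

lemma energySnd_apply (x : energySpace s Ω) : energySnd s Ω x = (x : EnergyAmbient N).snd := rfl

lemma real_inner_eq_mul (a b : ℝ) : ⟪a, b⟫ = a * b := by
  rw [RCLike.inner_apply, conj_trivial, mul_comm]

lemma inner_energySnd (x y : energySpace s Ω) : ⟪energySnd s Ω x, energySnd s Ω y⟫ =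
    fracLaplacianPairing s (energyFst s Ω x) (energyFst s Ω y) := by
  rw [L2.inner_def, fracLaplacianPairing_eq]
  refine integral_congr_ae ?_
  filter_upwards [x.2.2, y.2.2] with p h1 h2
  rw [energySnd_apply, energySnd_apply, h1, h2, energyFst_apply, energyFst_apply, ← diffQuot_mul,
    real_inner_eq_mul]

/-- The Lax-Milgram theorem for a form `⟪Q x, Q y⟫`. -/
lemma exists_forall_inner_eq_inner {V A B : Type*} [NormedAddCommGroup V] [InnerProductSpace ℝ V]
    [CompleteSpace V] [NormedAddCommGroup A] [InnerProductSpace ℝ A] [NormedAddCommGroup B]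
    [InnerProductSpace ℝ B] (P : V →L[ℝ] A) (Q : V →L[ℝ] B) {c : ℝ} (hc : 0 < c)
    (h : ∀ x, c * ‖x‖ ^ 2 ≤ ‖Q x‖ ^ 2) (a : A) : ∃ x, ∀ y, ⟪Q x, Q y⟫ = ⟪a, P y⟫ := by
  set F : V →L[ℝ] V →L[ℝ] ℝ := (innerSL ℝ).bilinearComp Q Q with hF
  have hFa : ∀ x y, F x y = ⟪Q x, Q y⟫ := fun x y => by
    rw [hF, ContinuousLinearMap.bilinearComp_apply, innerSL_apply_apply]
  have hco : IsCoercive F := ⟨c, hc, fun x => by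
    rw [hFa, real_inner_self_eq_norm_sq, mul_assoc, ← sq]; exact h x⟩
  set y := (InnerProductSpace.toDual ℝ V).symm ((innerSL ℝ a).comp P) with hy
  refine ⟨hco.continuousLinearEquivOfBilin.symm y, fun z => ?_⟩
  rw [← hFa, ← hco.continuousLinearEquivOfBilin_apply, ContinuousLinearEquiv.apply_symm_apply, hy,
    InnerProductSpace.toDual_symm_apply, ContinuousLinearMap.comp_apply, innerSL_apply_apply]

/-- Poincaré bounds the `L²` component by the energy, so the energy alone controls the full norm. -/
lemma exists_energySnd_coercive (hN : 0 < N) (hs0 : 0 < s) (hΩ : MeasurableSet Ω)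
    (hΩb : Bornology.IsBounded Ω) : ∃ c : ℝ, 0 < c ∧ ∀ x : energySpace s Ω,
      c * ‖x‖ ^ 2 ≤ ‖energySnd s Ω x‖ ^ 2 := by
  obtain ⟨C, hC, hP⟩ := exists_poincare hN hs0 hΩ hΩb
  refine ⟨(1 + C)⁻¹, by positivity, fun x => ?_⟩
  have h2 : ‖x‖ ^ 2 = ‖energyFst s Ω x‖ ^ 2 + ‖energySnd s Ω x‖ ^ 2 :=
    WithLp.prod_norm_sq_eq_of_L2 (x : EnergyAmbient N)
  have h3 : ‖energyFst s Ω x‖ ^ 2 ≤ C * ‖energySnd s Ω x‖ ^ 2 := by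
    have h4 := hP _ (memX0_of_mem_energySpace x.2)
    rw [← real_inner_self_eq_norm_sq (energySnd s Ω x), inner_energySnd,
      ← real_inner_self_eq_norm_sq, L2.inner_def]
    refine le_trans (le_of_eq ?_) h4
    congr 1; ext t
    rw [real_inner_eq_mul, sq, energyFst_apply]
  rw [inv_mul_le_iff₀ (by positivity)]
  linarith

/-- Existence of energy solutions for bounded right-hand sides. -/
theorem exists_isEnergySolution (hN : 0 < N) (hs0 : 0 < s) (hΩ : MeasurableSet Ω)
    (hΩb : Bornology.IsBounded Ω) {g : Euc N → ℝ}
    (hgm : AEStronglyMeasurable g (volume.restrict Ω)) (hgb : ∃ C, ∀ x, |g x| ≤ C) :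
    ∃ φ, IsEnergySolution s Ω g φ := by
  obtain ⟨C, hC⟩ := hgb
  have hfin : Fact (volume Ω < ⊤) := ⟨hΩb.measure_lt_top⟩
  have hg2 : MemLp (Ω.indicator g) 2 volume := (memLp_indicator_iff_restrict hΩ).2
    (MemLp.of_bound hgm C (Eventually.of_forall hC))
  have : CompleteSpace (energySpace s Ω) := (isClosed_energySpace s Ω).completeSpace_coe
  obtain ⟨c, hc, hco⟩ := exists_energySnd_coercive (s := s) hN hs0 hΩ hΩb
  obtain ⟨x, hx⟩ := exists_forall_inner_eq_inner (energyFst s Ω) (energySnd s Ω) hc hco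
    (hg2.toLp _)
  refine ⟨energyFst s Ω x, memX0_of_mem_energySpace x.2, fun v hv => ?_⟩
  have h1 := hx hv.toEnergy
  rw [inner_energySnd] at h1
  have hvae : (energyFst s Ω hv.toEnergy : Euc N → ℝ) =ᵐ[volume] v := hv.memLp.coeFn_toLp
  have h3 : fracLaplacianPairing s (energyFst s Ω x) (energyFst s Ω hv.toEnergy) =
      fracLaplacianPairing s (energyFst s Ω x) v := by
    rw [fracLaplacianPairing_eq, fracLaplacianPairing_eq]
    refine integral_congr_ae ?_
    filter_upwards [ae_prod_of_ae hvae] with p hp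
    simp only [pairDensity, hp.1, hp.2]
  have h4 : ⟪hg2.toLp _, energyFst s Ω hv.toEnergy⟫ = ∫ t in Ω, g t * v t := by
    rw [L2.inner_def, ← integral_indicator hΩ]
    refine integral_congr_ae ?_
    filter_upwards [hg2.coeFn_toLp, hvae] with t h5 h6
    rw [h5, h6, real_inner_eq_mul]
    by_cases ht : t ∈ Ω
    · rw [indicator_of_mem ht, indicator_of_mem ht]
    · rw [indicator_of_notMem ht, indicator_of_notMem ht, zero_mul]
  rw [← h3, h1, h4]

end EnergySpace

/-! ### Duality, truncation of the data, and `L¹`-weak solutions. -/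

section WeakSolutions

open Set Filter Topology Metric
open scoped ENNReal

variable {N : ℕ} {s : ℝ} {Ω : Set (Euc N)} {f f₁ f₂ g u u₁ u₂ φ : Euc N → ℝ}

lemma IsEnergySolution.const_mul (c : ℝ) (hu : IsEnergySolution s Ω f u) :
    IsEnergySolution s Ω (fun x => c * f x) (fun x => c * u x) := by
  refine ⟨hu.memX0.const_mul c, fun v hv => ?_⟩
  rw [fracLaplacianPairing_const_mul_left, hu.pairing_eq v hv, ← integral_const_mul]
  simp only [mul_assoc]

lemma integrableOn_bounded_mul (hfm : AEStronglyMeasurable f (volume.restrict Ω))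
    (hfb : ∃ C, ∀ x, |f x| ≤ C) (hu : IntegrableOn u Ω) : IntegrableOn (fun x => f x * u x) Ω := by
  obtain ⟨C, hC⟩ := hfb
  exact hu.bdd_mul hfm (Eventually.of_forall hC)

lemma IsEnergySolution.sub (hΩ : MeasurableSet Ω) (hΩb : Bornology.IsBounded Ω)
    (hm₁ : AEStronglyMeasurable f₁ (volume.restrict Ω)) (hb₁ : ∃ C, ∀ x, |f₁ x| ≤ C)
    (hm₂ : AEStronglyMeasurable f₂ (volume.restrict Ω)) (hb₂ : ∃ C, ∀ x, |f₂ x| ≤ C)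
    (h₁ : IsEnergySolution s Ω f₁ u₁) (h₂ : IsEnergySolution s Ω f₂ u₂) :
    IsEnergySolution s Ω (fun x => f₁ x - f₂ x) (fun x => u₁ x - u₂ x) := by
  refine ⟨h₁.memX0.sub h₂.memX0, fun v hv => ?_⟩
  have hvi := (hv.integrable hΩ hΩb.measure_lt_top.ne).integrableOn (s := Ω)
  rw [fracLaplacianPairing_sub_left h₁.memX0 h₂.memX0 hv, h₁.pairing_eq v hv, h₂.pairing_eq v hv,
    ← integral_sub (integrableOn_bounded_mul hm₁ hb₁ hvi) (integrableOn_bounded_mul hm₂ hb₂ hvi)]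
  simp only [sub_mul]

/-- `|φ| ≤ K C δˢ` for the constant `K` of the boundary estimate. -/
def BoundaryEstimate (s K : ℝ) (Ω : Set (Euc N)) : Prop :=
  ∀ (g φ : Euc N → ℝ) (C : ℝ), 0 < C → (∀ x, |g x| ≤ C) →
    AEStronglyMeasurable g (volume.restrict Ω) → IsEnergySolution s Ω g φ →
    ∀ᵐ x ∂(volume.restrict Ω), |φ x| ≤ C * K * boundaryDist Ω x ^ s

/-- By linearity the one-sided bound applies to both `φ/C` and `-φ/C`. -/
theorem IsSmoothBoundedDomain.exists_boundaryEstimate (hN : 0 < N) (hs0 : 0 < s) (hs1 : s < 1)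
    (hΩ : IsSmoothBoundedDomain Ω) : ∃ K : ℝ, 0 < K ∧ BoundaryEstimate s K Ω := by
  obtain ⟨K, hK, h⟩ := hΩ.exists_energySolution_le_boundaryDist hN hs0 hs1
  refine ⟨K, hK, fun g φ C hC hg hgm hφ => ?_⟩
  have aux : ∀ c : ℝ, |c| = C⁻¹ → ∀ᵐ x ∂volume, x ∈ Ω → c * φ x ≤ K * boundaryDist Ω x ^ s := by
    intro c hc
    refine h _ _ (fun x => ?_) (hgm.const_mul c) (hφ.const_mul c)
    rw [abs_mul, hc, inv_mul_le_iff₀ hC, mul_one]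
    exact hg x
  rw [ae_restrict_iff' hΩ.isOpen.measurableSet]
  filter_upwards [aux C⁻¹ (abs_of_pos (by positivity)),
    aux (-C⁻¹) (by rw [abs_neg, abs_of_pos (by positivity)])] with x h1 h2 hx
  have h3 := h1 hx
  have h4 := h2 hx
  rw [inv_mul_le_iff₀ hC] at h3
  rw [neg_mul, ← mul_neg, inv_mul_le_iff₀ hC] at h4
  rw [abs_le, mul_assoc]
  constructor <;> linarith

lemma MemWeightedL1.aestronglyMeasurable (hf : MemWeightedL1 s Ω f) :
    AEStronglyMeasurable f (volume.restrict Ω) := hf.locallyIntegrableOn.aestronglyMeasurable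

lemma boundaryDist_rpow_nonneg (s : ℝ) (Ω : Set (Euc N)) (x : Euc N) :
    0 ≤ boundaryDist Ω x ^ s := Real.rpow_nonneg infDist_nonneg s

lemma MemWeightedL1.integrableOn_mul {C : ℝ} (hf : MemWeightedL1 s Ω f)
    (hφ : AEStronglyMeasurable φ volume)
    (h : ∀ᵐ x ∂(volume.restrict Ω), |φ x| ≤ C * boundaryDist Ω x ^ s) :
    IntegrableOn (fun x => f x * φ x) Ω := by
  refine Integrable.mono' (hf.integrableOn.const_mul C) (hf.aestronglyMeasurable.mul hφ.restrict) ?_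
  filter_upwards [h] with x hx
  rw [Real.norm_eq_abs, abs_mul]
  calc |f x| * |φ x| ≤ |f x| * (C * boundaryDist Ω x ^ s) := by gcongr
    _ = _ := by ring

/-- The `L¹` bound for energy solutions, by duality. -/
theorem IsEnergySolution.integral_abs_le (hN : 0 < N) (hs0 : 0 < s) (hΩ : MeasurableSet Ω)
    (hΩb : Bornology.IsBounded Ω) {K : ℝ} (hK : BoundaryEstimate s K Ω)
    (hf : MemWeightedL1 s Ω f) (hu : IsEnergySolution s Ω f u) :
    ∫ x in Ω, |u x| ≤ K * weightedL1Norm s Ω f := by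
  -- The sign of `u`, with `0 / 0 = 0` where `u` vanishes.
  set g : Euc N → ℝ := fun x => u x / |u x| with hg
  have hg1 : ∀ x, |g x| ≤ 1 := fun x => by
    simp only [hg, abs_div, abs_abs]; exact div_self_le_one _
  have hum := hu.memX0.aestronglyMeasurable
  have hgm : AEStronglyMeasurable g (volume.restrict Ω) :=
    (hum.aemeasurable.div (by simpa using hum.norm.aemeasurable)).aestronglyMeasurable.restrict
  obtain ⟨ψ, hψ⟩ := exists_isEnergySolution (s := s) hN hs0 hΩ hΩb hgm ⟨1, hg1⟩
  have hψb := hK g ψ 1 one_pos hg1 hgm hψ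
  rw [one_mul] at hψb
  have h1 : ∫ x in Ω, |u x| = ∫ x in Ω, f x * ψ x := by
    rw [← hu.pairing_eq ψ hψ.memX0, fracLaplacianPairing_comm, hψ.pairing_eq u hu.memX0]
    refine integral_congr_ae (Eventually.of_forall fun x => ?_)
    simp only [hg]
    rcases eq_or_ne (u x) 0 with h0 | h0
    · simp [h0]
    · rw [div_mul_eq_mul_div, ← abs_mul_abs_self, mul_div_cancel_right₀ _ (abs_ne_zero.2 h0)]
  rw [h1, weightedL1Norm, ← integral_const_mul]
  refine integral_mono_ae (hf.integrableOn_mul hψ.memX0.aestronglyMeasurable hψb)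
    (hf.integrableOn.const_mul K) ?_
  filter_upwards [hψb] with x hx
  calc f x * ψ x ≤ |f x| * |ψ x| := by rw [← abs_mul]; exact le_abs_self _
    _ ≤ |f x| * (K * boundaryDist Ω x ^ s) := by gcongr
    _ = _ := by ring

/-- Truncation of values at height `n`. -/
noncomputable def cutValue (n : ℕ) (t : ℝ) : ℝ := if |t| ≤ n then t else 0

lemma measurable_cutValue (n : ℕ) : Measurable (cutValue n) :=
  Measurable.ite (measurableSet_le measurable_id.abs measurable_const) measurable_id
    measurable_const

lemma abs_cutValue_le (n : ℕ) (t : ℝ) : |cutValue n t| ≤ n := by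
  unfold cutValue; split_ifs with h
  · exact h
  · simp

lemma abs_cutValue_le_abs (n : ℕ) (t : ℝ) : |cutValue n t| ≤ |t| := by
  unfold cutValue; split_ifs <;> simp

lemma abs_sub_cutValue_le_abs (n : ℕ) (t : ℝ) : |t - cutValue n t| ≤ |t| := by
  unfold cutValue; split_ifs <;> simp

lemma abs_sub_cutValue_anti {m n : ℕ} (h : m ≤ n) (t : ℝ) :
    |t - cutValue n t| ≤ |t - cutValue m t| := by
  unfold cutValue
  have : (m : ℝ) ≤ n := Nat.cast_le.2 h
  split_ifs with h1 h2 h2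
  · simp
  · simp
  · exact absurd (h2.trans this) h1
  · simp

lemma tendsto_cutValue (t : ℝ) : Tendsto (fun n => cutValue n t) atTop (𝓝 t) := by
  refine tendsto_const_nhds.congr' ?_
  filter_upwards [eventually_ge_atTop ⌈|t|⌉₊] with n hn
  rw [cutValue, if_pos (Nat.ceil_le.1 hn)]

lemma MemWeightedL1.of_abs_le {h : Euc N → ℝ} (hf : MemWeightedL1 s Ω f) (hΩb : Bornology.IsBounded Ω)
    (hm : AEStronglyMeasurable h (volume.restrict Ω)) (hb : ∃ C, ∀ x, |h x| ≤ C)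
    (hle : ∃ C, ∀ x, |h x| ≤ C * |f x|) : MemWeightedL1 s Ω h := by
  obtain ⟨C, hC⟩ := hb
  obtain ⟨C', hC'⟩ := hle
  have hfin : Fact (volume Ω < ⊤) := ⟨hΩb.measure_lt_top⟩
  have hint : IntegrableOn h Ω := Integrable.of_bound hm C (Eventually.of_forall hC)
  refine ⟨hint.locallyIntegrableOn, ?_⟩
  refine Integrable.mono' (hf.integrableOn.const_mul C') ?_ (Eventually.of_forall fun x => ?_)
  · exact hm.norm.mul (((continuous_infDist_pt (frontier Ω)).measurable.pow_const
      s).aestronglyMeasurable)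
  · have := boundaryDist_rpow_nonneg s Ω x
    rw [Real.norm_of_nonneg (by positivity), ← mul_assoc]
    gcongr
    exact hC' x

lemma IsTestFunction.isEnergySolution (h : IsTestFunction s Ω φ g) : IsEnergySolution s Ω g φ :=
  ⟨h.memX0, h.pairing_eq⟩

lemma IsSmoothCompactlySupportedIn.exists_bound (hg : IsSmoothCompactlySupportedIn Ω g) :
    ∃ C : ℝ, 0 < C ∧ ∀ x, |g x| ≤ C := by
  obtain ⟨C, hC⟩ := hg.hasCompactSupport.exists_bound_of_continuous hg.contDiff.continuous
  exact ⟨max C 1, by positivity, fun x => (hC x).trans (le_max_left _ _)⟩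

lemma IsSmoothCompactlySupportedIn.aestronglyMeasurable (hg : IsSmoothCompactlySupportedIn Ω g) :
    AEStronglyMeasurable g (volume.restrict Ω) := hg.contDiff.continuous.aestronglyMeasurable

/-- Uniqueness of `L¹`-weak solutions. -/
theorem IsL1WeakSolution.unique (hN : 0 < N) (hs0 : 0 < s) (hΩ : IsSmoothBoundedDomain Ω)
    {u v : Lp ℝ 1 (volume.restrict Ω)} (hu : IsL1WeakSolution s Ω f u)
    (hv : IsL1WeakSolution s Ω f v) : u = v := by
  have hui : Integrable u (volume.restrict Ω) := L1.integrable_coeFn u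
  have hvi : Integrable v (volume.restrict Ω) := L1.integrable_coeFn v
  have h0 : ∀ᵐ x ∂(volume.restrict Ω), x ∈ Ω → u x - v x = 0 := by
    refine hΩ.isOpen.ae_eq_zero_of_integral_contDiff_smul_eq_zero
      ((hui.sub hvi).locallyIntegrable.locallyIntegrableOn Ω) fun g h1 h2 h3 => ?_
    have hg : IsSmoothCompactlySupportedIn Ω g := ⟨h1, h2, h3⟩
    obtain ⟨C, -, hC⟩ := hg.exists_bound
    -- Every `g ∈ C_c^∞(Ω)` arises from a test function, so `u - v` is orthogonal to all of them.
    obtain ⟨φ, hφ⟩ := exists_isEnergySolution (s := s) hN hs0 hΩ.isOpen.measurableSet hΩ.isBounded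
      hg.aestronglyMeasurable ⟨C, hC⟩
    have ht : IsTestFunction s Ω φ g := ⟨hφ.memX0, hg, hφ.pairing_eq⟩
    have e1 := (hu φ g ht).2
    have e2 := (hv φ g ht).2
    have i1 : Integrable (fun x => u x * g x) (volume.restrict Ω) :=
      hui.mul_bdd hg.aestronglyMeasurable (Eventually.of_forall hC)
    have i2 : Integrable (fun x => v x * g x) (volume.restrict Ω) :=
      hvi.mul_bdd hg.aestronglyMeasurable (Eventually.of_forall hC)
    calc ∫ x in Ω, g x • (u x - v x) = ∫ x in Ω, (u x * g x - v x * g x) := by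
          congr 1; ext x; rw [smul_eq_mul]; ring
      _ = 0 := by rw [integral_sub i1 i2, e1, e2, sub_self]
  refine Lp.ext ?_
  filter_upwards [h0, ae_restrict_mem hΩ.isOpen.measurableSet] with x hx hxΩ
  exact sub_eq_zero.1 (hx hxΩ)

/-- Existence of `L¹`-weak solutions, with the estimate. -/
theorem exists_isL1WeakSolution (hN : 0 < N) (hs0 : 0 < s) (hΩ : IsSmoothBoundedDomain Ω) {K : ℝ}
    (hK0 : 0 < K) (hK : BoundaryEstimate s K Ω) (hf : MemWeightedL1 s Ω f) :
    ∃ u : Lp ℝ 1 (volume.restrict Ω), IsL1WeakSolution s Ω f u ∧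
      ‖u‖ ≤ K * weightedL1Norm s Ω f := by
  have hΩm := hΩ.isOpen.measurableSet
  have hΩb := hΩ.isBounded
  have hfm := hf.aestronglyMeasurable
  set F : ℕ → Euc N → ℝ := fun n x => cutValue n (f x) with hF
  have hFm : ∀ n, AEStronglyMeasurable (F n) (volume.restrict Ω) := fun n =>
    ((measurable_cutValue n).comp_aemeasurable hfm.aemeasurable).aestronglyMeasurable
  have hFb : ∀ n, ∃ C, ∀ x, |F n x| ≤ C := fun n => ⟨n, fun x => abs_cutValue_le n _⟩
  have hFw : ∀ n, MemWeightedL1 s Ω (F n) := fun n => hf.of_abs_le hΩb (hFm n) (hFb n)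
    ⟨1, fun x => by rw [one_mul]; exact abs_cutValue_le_abs n _⟩
  choose U hU using fun n => exists_isEnergySolution (s := s) hN hs0 hΩm hΩb (hFm n) (hFb n)
  have hUi : ∀ n, Integrable (U n) (volume.restrict Ω) := fun n =>
    ((hU n).memX0.integrable hΩm hΩb.measure_lt_top.ne).restrict
  set W : ℕ → Lp ℝ 1 (volume.restrict Ω) := fun n => (hUi n).toL1 (U n) with hW
  have hWn : ∀ n, ‖W n‖ ≤ K * weightedL1Norm s Ω f := by
    intro n
    rw [hW, L1.norm_of_fun_eq_integral_norm]
    refine ((hU n).integral_abs_le hN hs0 hΩm hΩb hK (hFw n)).trans ?_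
    refine mul_le_mul_of_nonneg_left (integral_mono (hFw n).integrableOn hf.integrableOn
      fun x => ?_) hK0.le
    exact mul_le_mul_of_nonneg_right (abs_cutValue_le_abs n _) (boundaryDist_rpow_nonneg s Ω x)
  -- The weighted truncation error: the duality bound applied to differences of solutions turns it
  -- into a Cauchy modulus for `W`.
  set a : ℕ → ℝ := fun n => ∫ x in Ω, |f x - F n x| * boundaryDist Ω x ^ s with ha
  have hδm : AEStronglyMeasurable (fun x => boundaryDist Ω x ^ s) (volume.restrict Ω) :=
    ((continuous_infDist_pt (frontier Ω)).measurable.pow_const s).aestronglyMeasurable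
  have hai : ∀ n, IntegrableOn (fun x => |f x - F n x| * boundaryDist Ω x ^ s) Ω := fun n => by
    refine Integrable.mono' hf.integrableOn ((hfm.sub (hFm n)).norm.mul hδm)
      (Eventually.of_forall fun x => ?_)
    have := boundaryDist_rpow_nonneg s Ω x
    rw [Real.norm_of_nonneg (by positivity)]
    exact mul_le_mul_of_nonneg_right (abs_sub_cutValue_le_abs n _) this
  have haanti : Antitone a := fun m n hmn => integral_mono (hai n) (hai m) fun x =>
    mul_le_mul_of_nonneg_right (abs_sub_cutValue_anti hmn _) (boundaryDist_rpow_nonneg s Ω x)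
  have halim : Tendsto a atTop (𝓝 0) := by
    have := tendsto_integral_of_dominated_convergence (μ := volume.restrict Ω)
      (F := fun n x => |f x - F n x| * boundaryDist Ω x ^ s) (f := fun _ => 0)
      (fun x => |f x| * boundaryDist Ω x ^ s) (fun n => (hai n).aestronglyMeasurable)
      hf.integrableOn (fun n => Eventually.of_forall fun x => ?_)
      (Eventually.of_forall fun x => ?_)
    · simpa using this
    · have := boundaryDist_rpow_nonneg s Ω x
      rw [Real.norm_of_nonneg (by positivity)]
      exact mul_le_mul_of_nonneg_right (abs_sub_cutValue_le_abs n _) this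
    · have := (((tendsto_cutValue (f x)).const_sub (f x)).abs).mul_const (boundaryDist Ω x ^ s)
      simpa using this
  have hdist : ∀ m n k, k ≤ m → k ≤ n → dist (W m) (W n) ≤ K * (2 * a k) := by
    intro m n k hm hn
    have hdiff := (hU m).sub hΩm hΩb (hFm m) (hFb m) (hFm n) (hFb n) (hU n)
    have hw : MemWeightedL1 s Ω (fun x => F m x - F n x) := hf.of_abs_le hΩb
      ((hFm m).sub (hFm n))
      ⟨m + n, fun x => (abs_sub _ _).trans (add_le_add (abs_cutValue_le m _) (abs_cutValue_le n _))⟩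
      ⟨2, fun x => (abs_sub _ _).trans
        (by linarith [abs_cutValue_le_abs m (f x), abs_cutValue_le_abs n (f x)])⟩
    rw [dist_eq_norm, hW]
    simp only
    rw [← Integrable.toL1_sub, L1.norm_of_fun_eq_integral_norm]
    refine (hdiff.integral_abs_le hN hs0 hΩm hΩb hK hw).trans ?_
    refine mul_le_mul_of_nonneg_left ?_ hK0.le
    calc weightedL1Norm s Ω (fun x => F m x - F n x) ≤ a m + a n := by
          rw [weightedL1Norm, ha, ← integral_add (hai m) (hai n)]
          refine integral_mono hw.integrableOn ((hai m).add (hai n)) fun x => ?_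
          simp only
          rw [← add_mul]
          refine mul_le_mul_of_nonneg_right ?_ (boundaryDist_rpow_nonneg s Ω x)
          have := abs_sub_le (F m x) (f x) (F n x)
          rwa [abs_sub_comm (F m x) (f x)] at this
      _ ≤ 2 * a k := by linarith [haanti hm, haanti hn]
  have hcauchy : CauchySeq W := by
    refine cauchySeq_of_le_tendsto_0 (fun k => K * (2 * a k)) hdist ?_
    have := (halim.const_mul 2).const_mul K
    simpa using this
  obtain ⟨V, hV⟩ := cauchySeq_tendsto_of_complete hcauchy
  refine ⟨V, fun φ g ht => ?_, le_of_tendsto' hV.norm hWn⟩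
  obtain ⟨C, hC0, hC⟩ := ht.smooth.exists_bound
  have hgm := ht.smooth.aestronglyMeasurable
  have hφb := hK g φ C hC0 hC hgm ht.isEnergySolution
  have hfφ := hf.integrableOn_mul ht.memX0.aestronglyMeasurable hφb
  refine ⟨hfφ, ?_⟩
  have hleft : Tendsto (fun n => ∫ x in Ω, W n x * g x) atTop (𝓝 (∫ x in Ω, V x * g x)) := by
    rw [tendsto_iff_dist_tendsto_zero]
    have hb : Tendsto (fun n => C * dist (W n) V) atTop (𝓝 0) := by
      have := (tendsto_iff_dist_tendsto_zero.1 hV).const_mul C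
      simpa using this
    refine squeeze_zero (fun _ => dist_nonneg) (fun n => ?_) hb
    have i1 : Integrable (fun x => W n x * g x) (volume.restrict Ω) :=
      (L1.integrable_coeFn (W n)).mul_bdd hgm (Eventually.of_forall hC)
    have i2 : Integrable (fun x => V x * g x) (volume.restrict Ω) :=
      (L1.integrable_coeFn V).mul_bdd hgm (Eventually.of_forall hC)
    rw [dist_eq_norm, dist_eq_norm, ← integral_sub i1 i2, L1.norm_eq_integral_norm,
      ← integral_const_mul]
    refine norm_integral_le_of_norm_le ((L1.integrable_coeFn (W n - V)).norm.const_mul C) ?_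
    filter_upwards [Lp.coeFn_sub (W n) V] with x hx
    rw [hx, Pi.sub_apply, ← sub_mul, norm_mul, mul_comm]
    exact mul_le_mul_of_nonneg_right (hC x) (norm_nonneg _)
  have hright : Tendsto (fun n => ∫ x in Ω, F n x * φ x) atTop (𝓝 (∫ x in Ω, f x * φ x)) := by
    refine tendsto_integral_of_dominated_convergence (fun x => |f x * φ x|)
      (fun n => (hFm n).mul ht.memX0.aestronglyMeasurable.restrict) hfφ.abs
      (fun n => Eventually.of_forall fun x => ?_) (Eventually.of_forall fun x => ?_)
    · rw [Real.norm_eq_abs, abs_mul, abs_mul]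
      exact mul_le_mul_of_nonneg_right (abs_cutValue_le_abs n _) (abs_nonneg _)
    · exact (tendsto_cutValue (f x)).mul_const _
  refine tendsto_nhds_unique hleft (hright.congr fun n => ?_)
  -- For truncated data the weak formulation is the symmetry of the form, as `φ` and `U n` are
  -- admissible tests for each other.
  rw [← (hU n).pairing_eq φ ht.memX0, fracLaplacianPairing_comm, ht.pairing_eq _ (hU n).memX0]
  refine integral_congr_ae ?_
  filter_upwards [(hUi n).coeFn_toL1] with x hx
  rw [hW]
  simp only
  rw [hx, mul_comm]

end WeakSolutions

theorem mainTheorem5 {N : ℕ} (s : ℝ) (hs0 : 0 < s) (hs1 : s < 1) (hN : 2 * s < (N : ℝ))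
    (Ω : Set (EuclideanSpace ℝ (Fin N))) (hΩ : IsSmoothBoundedDomain Ω) :
    (∀ f : EuclideanSpace ℝ (Fin N) → ℝ, MemWeightedL1 s Ω f →
      ∃! u : Lp ℝ 1 (volume.restrict Ω), IsL1WeakSolution s Ω f u) ∧
    ∃ C : ℝ, 0 < C ∧
      ∀ f : EuclideanSpace ℝ (Fin N) → ℝ, MemWeightedL1 s Ω f →
        ∀ u : Lp ℝ 1 (volume.restrict Ω), IsL1WeakSolution s Ω f u →
          ‖u‖ ≤ C * weightedL1Norm s Ω f := by
  have hN0 : 0 < N := by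
    have : (0 : ℝ) < N := by linarith
    exact_mod_cast this
  obtain ⟨K, hK0, hK⟩ := hΩ.exists_boundaryEstimate hN0 hs0 hs1
  refine ⟨fun f hf => ?_, K, hK0, fun f hf u hu => ?_⟩
  · obtain ⟨u, hu, -⟩ := exists_isL1WeakSolution hN0 hs0 hΩ hK0 hK hf
    exact ⟨u, hu, fun v hv => hv.unique hN0 hs0 hΩ hu⟩
  · obtain ⟨v, hv, hle⟩ := exists_isL1WeakSolution hN0 hs0 hΩ hK0 hK hf
    rwa [hu.unique hN0 hs0 hΩ hv]
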